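/- **Setting.** Let $\lambda,a>0$ with $A:=\lambda a>1$. Let $h:\mathbb R\to\mathbb R$ be smooth with $h(T)=\pi/2$ for $T\le 0$, $0<h(T)<\pi/2$ for $0<T<1$, and $h(T)=0$ for $T\ge 1$. On $(0,1)$ put $g=\tan h$, and assume $g'''<0$ on $(0,1)$. Let $B(T)=1$ for $T\le 0$ and $B(T)=\exp\int_0^T\cot h(z)\,dz$ for $0<T<1$. For $K>0$ define $$R_K(y)=\begin{cases}-e^{-iKy}, & y\le -A,\\[1mm] -e^{-iKy}+\dfrac{2i\sin(AK)}{B(y+A)}\displaystyle\int_0^{y+A}e^{-iKz}B'(z)\,dz, & -A<y<1-A,\\[1mm] -e^{-iK(y+2A)}, & y\ge 1-A,\end{cases}$$ $$F(y)=\int_0^\infty\frac{dK}{K}\big[|R_K'(y)|^2-K^2\big],\qquad \mathcal G_{\rm out}(y,w)=\int_0^\infty\frac{dK}{K}\Big[|e^{-iKw}+R_K(y)|^2-|e^{-iKw}-e^{-iKy}|^2\Big].$$ The integral in $F$ is regularized by a factor $e^{-\delta K}$, $\delta\to0^+$. The integral in $\mathcal G_{\rm out}$ is an improper integral at $K=\infty$.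 With $y=\lambda(t-r)$ and $w=\lambda(t+r)$, the renormalized energy density outside the shell ($r>a$) of the massless scalar field in the presence of a spherical wall, formed at $r=a$ during $0<t<1/\lambda$, is $$\langle T_{00}\rangle(t,r)=\frac{\lambda^2}{16\pi^2r^2}\,F(y)-\frac{1}{32\pi^2r^2}\,\frac{\partial}{\partial r}\Big(\frac{\mathcal G_{\rm out}}{r}\Big),$$ where $\partial/\partial r$ is taken at fixed $t$. **Theorem.** 1. For $-A<y<1-A$, each $R_K$ is differentiable at $y$ and $F(y)$ exists. If moreover $w>y+2A$ (that is, $r>a$), then $\mathcal G_{\rm out}(y,w)$ exists. On the intermediate outside region $r>a$, $-A<\lambda(t-r)<1-A$, the function $r\mapsto\mathcal G_{\rm out}/r$ is differentiable at fixed $t$. 2. As $y+A\to1^-$, $$F(y)\sim-\frac{g'(y+A)}{g(y+A)^2}\longrightarrow+\infty,$$ where $\sim$ means that the ratio tends to $1$. In particular $F(y)\to+\infty$. 3. For every $w_0>1+A$, $$\mathcal G_{\rm out}(y,w)\to 2\ln\frac{w_0-y_0-2A}{w_0-y_0},\qquad y_0=1-A,$$ as $y\to(1-A)^-$ and $w\to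 w_0$ jointly (in particular for fixed $w=w_0$). This matches the future region: for all $y\ge1-A$ and $w>y+2A$, $\mathcal G_{\rm out}(y,w)$ exists and equals $2\ln\frac{w-y-2A}{w-y}$. 4. Consequently the energy density diverges positively just before the outgoing light cone of the event $(t=1/\lambda,\ r=a)$: if $r_0>a$ and $t_0-r_0=1/\lambda-a$, then $\langle T_{00}\rangle(t,r)\to+\infty$ as $(t,r)\to(t_0,r_0)$ with $t-r<1/\lambda-a$. -/

import Mathlib

open Filter Topology MeasureTheory Set
open scoped ContDiff

noncomputable section

namespace ShellFormation

/-- The switching profile `h` of the shell, a function of the dimensionless time `T = lam * t`: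
a smooth interpolation from `π / 2` (no wall, `T ≤ 0`) to `0` (Dirichlet wall, `T ≥ 1`). -/
structure IsSwitchingProfile (h : ℝ → ℝ) : Prop where
  smooth : ContDiff ℝ ∞ h
  before : ∀ T : ℝ, T ≤ 0 → h T = Real.pi / 2
  during : ∀ T : ℝ, 0 < T → T < 1 → 0 < h T ∧ h T < Real.pi / 2
  after : ∀ T : ℝ, 1 ≤ T → h T = 0

/-- `g = tan ∘ h`; it is only used on `(0, 1)`. -/
def g (h : ℝ → ℝ) (T : ℝ) : ℝ := Real.tan (h T)

/-- The auxiliary function `B`, with `B' / B = cot ∘ h = 1 / g` and `B = 1` for `T ≤ 0`;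
it is only used for `T < 1`. -/
def B (h : ℝ → ℝ) (T : ℝ) : ℝ :=
  if T ≤ 0 then 1 else Real.exp (∫ z in (0 : ℝ)..T, Real.cot (h z))

/-- The outgoing part `R_K(y)` of the mode function outside the shell, where `y = lam * (t - r)`
and `A = lam * a`: early, intermediate and late region. -/
def R (h : ℝ → ℝ) (A K y : ℝ) : ℂ :=
  if y ≤ -A then
    -Complex.exp (-(Complex.I * K * y))
  else if y < 1 - A then
    -Complex.exp (-(Complex.I * K * y))
      + 2 * Complex.I * ((Real.sin (A * K) : ℝ) : ℂ) / ((B h (y + A) : ℝ) : ℂ)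
        * ∫ z in (0 : ℝ)..(y + A), Complex.exp (-(Complex.I * K * z)) * ((deriv (B h) z : ℝ) : ℂ)
  else
    -Complex.exp (-(Complex.I * K * (y + 2 * A)))

/-- `∫₀^∞ f(K) dK = L`, the integral being regularized by the factor `exp (-δ K)`, `δ → 0⁺`. -/
def HasAbelIntegral (f : ℝ → ℝ) (L : ℝ) : Prop :=
  (∀ δ : ℝ, 0 < δ → IntegrableOn (fun K : ℝ => Real.exp (-(δ * K)) * f K) (Ioi 0)) ∧
  Tendsto (fun δ : ℝ => ∫ K in Ioi (0 : ℝ), Real.exp (-(δ * K)) * f K) (𝓝[>] 0) (𝓝 L)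

/-- The value of the regularized integral over `(0, ∞)`; meaningful when it exists. -/
def abelIntegral (f : ℝ → ℝ) : ℝ :=
  limUnder (𝓝[>] (0 : ℝ)) (fun δ : ℝ => ∫ K in Ioi (0 : ℝ), Real.exp (-(δ * K)) * f K)

/-- `∫₀^∞ f(K) dK = L` as an improper integral at infinity. -/
def HasImproperIntegral (f : ℝ → ℝ) (L : ℝ) : Prop :=
  (∀ b : ℝ, 0 < b → IntervalIntegrable f volume 0 b) ∧
  Tendsto (fun b : ℝ => ∫ K in (0 : ℝ)..b, f K) atTop (𝓝 L)

/-- The value of the improper integral over `(0, ∞)`; meaningful when it exists. -/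
def improperIntegral (f : ℝ → ℝ) : ℝ :=
  limUnder atTop (fun b : ℝ => ∫ K in (0 : ℝ)..b, f K)

/-- The integrand `(|R_K'(y)|² - K²) / K` of `F(y)`. -/
def FIntegrand (h : ℝ → ℝ) (A y K : ℝ) : ℝ :=
  (‖deriv (fun x : ℝ => R h A K x) y‖ ^ 2 - K ^ 2) / K

/-- `F(y) = ∫₀^∞ (|R_K'(y)|² - K²) dK / K`. -/
def F (h : ℝ → ℝ) (A y : ℝ) : ℝ := abelIntegral (FIntegrand h A y)

/-- The integrand of `𝒢_out`, with `y = lam * (t - r)` and `w = lam * (t + r)`. -/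
def GoutIntegrand (h : ℝ → ℝ) (A y w K : ℝ) : ℝ :=
  (‖Complex.exp (-(Complex.I * K * w)) + R h A K y‖ ^ 2
    - ‖Complex.exp (-(Complex.I * K * w)) - Complex.exp (-(Complex.I * K * y))‖ ^ 2) / K

/-- `𝒢_out(y, w) = ∫₀^∞ (|e^{-iKw} + R_K(y)|² - |e^{-iKw} - e^{-iKy}|²) dK / K`. -/
def Gout (h : ℝ → ℝ) (A y w : ℝ) : ℝ := improperIntegral (GoutIntegrand h A y w)

/-- `𝒢_out / r` as a function of `(t, r)`. -/
def GoutOverR (h : ℝ → ℝ) (lam a t r : ℝ) : ℝ :=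
  Gout h (lam * a) (lam * (t - r)) (lam * (t + r)) / r

/-- The renormalized energy density `⟨T₀₀⟩(t, r)` outside the shell, `r > a`. -/
def T00 (h : ℝ → ℝ) (lam a t r : ℝ) : ℝ :=
  lam ^ 2 / (16 * Real.pi ^ 2 * r ^ 2) * F h (lam * a) (lam * (t - r))
    - 1 / (32 * Real.pi ^ 2 * r ^ 2) * deriv (fun x : ℝ => GoutOverR h lam a t x) r

end ShellFormation

end

/-!
Both frequency integrals are computed exactly in position space. Write `c = cot ∘ h = B' / B = 1 / g`
and `s = y + A ∈ (0, 1)`. In the intermediate region `R_K` and `R_K'` are combinations of the cosine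
and sine transforms of `u ↦ B'(s - u)`, and the squared modulus that occurs in `|R_K'|²` and `|R_K|²`
satisfies (`IsSwitchingProfile.sq_add_sq_eq`)
`|B(s) - ∫₀ˢ e^{iK(s-z)} B'(z) dz|² = 1 + 2 K ∫₀¹ sin(K u) V(s, u) du`, where
`V(s, u) = ∫₀ˢ B(x) B'(x - u) dx`. The integrands of `F` and `𝒢_out` are therefore sums of sine
transforms `∫₀¹ sin(K (α + β u)) φ(u) du`, together with one sine. The regularized integral and the
improper integral over `K` of such a transform are both `∫₀¹ φ(u) / (α + β u) du`: for the first this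
is Fubini and dominated convergence, for the second the Riemann-Lebesgue lemma. When the phase is
`u`, the densities `φ` combine into functions of order `u`, built from
`Xi s u = B(s) B(s - u) - 1 - 2 V(s, u)` and from the increments `c(s) - c(s - u)`.

As `s → 1` both `c` and `B` tend to infinity, and `c³ = O(B)`. The exact value of `F` is
`2 (c / B) rateIncr - 2 (c / B)² XiInt + O(c)`. Convexity of `g`, which follows from `g''' < 0` and
the flatness of `g` at `1`, gives `rateIncr / B = c' / c + O(1)`. Since `XiInt' = B rateIncr`,
comparison with `B² (-g')` gives also `2 c XiInt / B² = c' / c + O(1)`. Both estimates are in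
`IsSwitchingProfile.exists_bounds`. Hence `F = c' + O(c)` with `c' = -g' / g²`, and
`c' / c ≥ 1 / (1 - s)` by convexity, so that `F ∼ c' → +∞`.

In `𝒢_out` the same bounds show that every term tends to zero except one logarithm, which is the late
value. In the radial derivative of `𝒢_out` the two terms of order `c' / c` are `rateIncr / B` and
`2 c XiInt / B²`; they enter with opposite signs and cancel up to `O(1)`, so that this derivative stays
bounded and the energy density diverges with `F`.
-/

namespace ShellFormation

/-! ### Sine transforms and the two notions of integral over the frequency -/

theorem integral_exp_neg_mul_sin {δ : ℝ} (hδ : 0 < δ) (x : ℝ) :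
    ∫ K in Ioi (0 : ℝ), Real.exp (-(δ * K)) * Real.sin (K * x) = x / (x ^ 2 + δ ^ 2) := by
  have hne : x ^ 2 + δ ^ 2 ≠ 0 := by positivity
  have hint0 : IntegrableOn (fun K : ℝ => Real.exp (-δ * K)) (Ioi 0) :=
    integrableOn_exp_mul_Ioi (by linarith) 0
  have hint : IntegrableOn (fun K : ℝ => Real.exp (-(δ * K)) * Real.sin (K * x)) (Ioi 0) := by
    refine Integrable.mono' hint0 (by fun_prop) (Eventually.of_forall fun K => ?_)
    rw [norm_mul, Real.norm_eq_abs, Real.norm_eq_abs, Real.abs_exp, neg_mul]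
    exact mul_le_of_le_one_right (Real.exp_pos _).le (Real.abs_sin_le_one _)
  have hder : ∀ K ∈ Ici (0 : ℝ), HasDerivAt
      (fun K : ℝ => -(Real.exp (-(δ * K)) * (δ * Real.sin (K * x) + x * Real.cos (K * x)))
        / (x ^ 2 + δ ^ 2)) (Real.exp (-(δ * K)) * Real.sin (K * x)) K := by
    intro K _
    have h1 : HasDerivAt (fun K : ℝ => Real.exp (-(δ * K))) (Real.exp (-(δ * K)) * (-(δ * 1))) K :=
      (((hasDerivAt_id K).const_mul δ).neg).exp
    have h2 : HasDerivAt (fun K : ℝ => Real.sin (K * x)) (Real.cos (K * x) * (1 * x)) K :=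
      ((hasDerivAt_id K).mul_const x).sin
    have h3 : HasDerivAt (fun K : ℝ => Real.cos (K * x)) (-Real.sin (K * x) * (1 * x)) K :=
      ((hasDerivAt_id K).mul_const x).cos
    refine ((h1.mul ((h2.const_mul δ).add (h3.const_mul x))).neg.div_const
      (x ^ 2 + δ ^ 2)).congr_deriv ?_
    simp only [Pi.add_apply]
    field_simp
    ring
  have hlim : Tendsto (fun K : ℝ => -(Real.exp (-(δ * K)) *
      (δ * Real.sin (K * x) + x * Real.cos (K * x))) / (x ^ 2 + δ ^ 2)) atTop (𝓝 0) := by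
    have h1 : Tendsto (fun K : ℝ => Real.exp (-(δ * K))) atTop (𝓝 0) :=
      Real.tendsto_exp_neg_atTop_nhds_zero.comp (tendsto_id.const_mul_atTop hδ)
    have h2 : Tendsto (fun K : ℝ => Real.exp (-(δ * K)) *
        (δ * Real.sin (K * x) + x * Real.cos (K * x))) atTop (𝓝 0) := by
      refine h1.zero_mul_isBoundedUnder_le ?_
      refine isBoundedUnder_of ⟨δ + |x|, fun K => ?_⟩
      simp only [Function.comp, Real.norm_eq_abs]
      refine (abs_add_le _ _).trans ?_
      rw [abs_mul, abs_mul, abs_of_pos hδ]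
      exact add_le_add (mul_le_of_le_one_right hδ.le (Real.abs_sin_le_one _))
        (mul_le_of_le_one_right (abs_nonneg x) (Real.abs_cos_le_one _))
    simpa using (h2.neg.div_const (x ^ 2 + δ ^ 2))
  rw [integral_Ioi_of_hasDerivAt_of_tendsto' hder hint hlim]
  simp
  field_simp

/-- A bounded continuous integrand becomes integrable after multiplication by `exp (-δ K)`. -/
theorem integrableOn_exp_mul_of_bounded {f : ℝ → ℝ} (hf : Continuous f) {M : ℝ}
    (hM : ∀ K, |f K| ≤ M) {δ : ℝ} (hδ : 0 < δ) :
    IntegrableOn (fun K : ℝ => Real.exp (-(δ * K)) * f K) (Ioi 0) := by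
  have hint0 : IntegrableOn (fun K : ℝ => Real.exp (-δ * K) * M) (Ioi 0) :=
    (integrableOn_exp_mul_Ioi (by linarith) 0).mul_const M
  refine Integrable.mono' hint0 (by fun_prop) (Eventually.of_forall fun K => ?_)
  rw [norm_mul, Real.norm_eq_abs, Real.norm_eq_abs, Real.abs_exp, neg_mul]
  exact mul_le_mul_of_nonneg_left (hM K) (Real.exp_pos _).le

theorem HasAbelIntegral.congr {f g : ℝ → ℝ} {L : ℝ} (hf : HasAbelIntegral f L)
    (hfg : ∀ K : ℝ, 0 < K → g K = f K) : HasAbelIntegral g L := by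
  refine ⟨fun δ hδ => (hf.1 δ hδ).congr_fun (fun K hK => ?_) measurableSet_Ioi,
    hf.2.congr fun δ => setIntegral_congr_fun measurableSet_Ioi fun K hK => ?_⟩ <;>
  simp only [hfg K hK]

theorem HasAbelIntegral.add {f g : ℝ → ℝ} {L M : ℝ} (hf : HasAbelIntegral f L)
    (hg : HasAbelIntegral g M) : HasAbelIntegral (fun K => f K + g K) (L + M) := by
  refine ⟨fun δ hδ => ((hf.1 δ hδ).add (hg.1 δ hδ)).congr_fun (fun K _ => ?_) measurableSet_Ioi,
    (hf.2.add hg.2).congr' ?_⟩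
  · simp [mul_add]
  · filter_upwards [self_mem_nhdsWithin] with δ hδ
    rw [← integral_add (hf.1 δ hδ) (hg.1 δ hδ)]
    simp only [mul_add]

theorem HasAbelIntegral.const_mul {f : ℝ → ℝ} {L : ℝ} (c : ℝ) (hf : HasAbelIntegral f L) :
    HasAbelIntegral (fun K => c * f K) (c * L) := by
  refine ⟨fun δ hδ => IntegrableOn.congr_fun ((hf.1 δ hδ).const_mul c) (fun K _ => ?_)
    measurableSet_Ioi, (hf.2.const_mul c).congr' ?_⟩
  · ring
  · filter_upwards [self_mem_nhdsWithin] with δ hδ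
    rw [← integral_const_mul]
    congr 1
    ext K
    ring

theorem HasAbelIntegral.abelIntegral_eq {f : ℝ → ℝ} {L : ℝ} (hf : HasAbelIntegral f L) :
    abelIntegral f = L := hf.2.limUnder_eq

theorem HasImproperIntegral.congr {f g : ℝ → ℝ} {L : ℝ} (hf : HasImproperIntegral f L)
    (hfg : ∀ K : ℝ, 0 < K → g K = f K) : HasImproperIntegral g L := by
  have key : ∀ b : ℝ, 0 < b → EqOn f g (uIoc 0 b) := fun b hb K hK => by
    rw [uIoc_of_le hb.le] at hK
    exact (hfg K hK.1).symm
  refine ⟨fun b hb => (hf.1 b hb).congr (key b hb), hf.2.congr' ?_⟩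
  filter_upwards [eventually_gt_atTop 0] with b hb
  refine intervalIntegral.integral_congr_ae (Eventually.of_forall fun K hK => key b hb hK)

theorem HasImproperIntegral.add {f g : ℝ → ℝ} {L M : ℝ} (hf : HasImproperIntegral f L)
    (hg : HasImproperIntegral g M) : HasImproperIntegral (fun K => f K + g K) (L + M) := by
  refine ⟨fun b hb => (hf.1 b hb).add (hg.1 b hb), (hf.2.add hg.2).congr' ?_⟩
  filter_upwards [eventually_gt_atTop 0] with b hb
  rw [intervalIntegral.integral_add (hf.1 b hb) (hg.1 b hb)]

theorem HasImproperIntegral.const_mul {f : ℝ → ℝ} {L : ℝ} (c : ℝ)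
    (hf : HasImproperIntegral f L) : HasImproperIntegral (fun K => c * f K) (c * L) := by
  refine ⟨fun b hb => (hf.1 b hb).const_mul c, (hf.2.const_mul c).congr fun b => ?_⟩
  rw [intervalIntegral.integral_const_mul]

theorem HasImproperIntegral.improperIntegral_eq {f : ℝ → ℝ} {L : ℝ}
    (hf : HasImproperIntegral f L) : improperIntegral f = L := hf.2.limUnder_eq

theorem hasAbelIntegral_sin {x : ℝ} (hx : x ≠ 0) :
    HasAbelIntegral (fun K => Real.sin (K * x)) (1 / x) := by
  refine ⟨fun δ hδ => integrableOn_exp_mul_of_bounded (M := 1) (by fun_prop)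
    (fun K => Real.abs_sin_le_one _) hδ, ?_⟩
  have h : Tendsto (fun δ : ℝ => x / (x ^ 2 + δ ^ 2)) (𝓝[>] 0) (𝓝 (x / (x ^ 2 + 0 ^ 2))) := by
    refine ContinuousAt.tendsto ?_ |>.mono_left nhdsWithin_le_nhds
    have : x ^ 2 + (0 : ℝ) ^ 2 ≠ 0 := by positivity
    fun_prop (disch := assumption)
  have e : x / (x ^ 2 + 0 ^ 2) = 1 / x := by field_simp; ring
  rw [e] at h
  refine h.congr' ?_
  filter_upwards [self_mem_nhdsWithin] with δ hδ
  rw [integral_exp_neg_mul_sin hδ]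

section transform

variable {α β : ℝ} {φ : ℝ → ℝ}

theorem continuous_sinTransform (hφ : IntervalIntegrable φ volume 0 1) :
    Continuous (fun K : ℝ => ∫ u in (0 : ℝ)..1, Real.sin (K * (α + β * u)) * φ u) := by
  refine intervalIntegral.continuous_of_dominated_interval (bound := fun u => |φ u|)
    (fun K => ?_) (fun K => Eventually.of_forall fun u _ => ?_) hφ.abs
    (Eventually.of_forall fun u _ => by fun_prop)
  · exact (Continuous.aestronglyMeasurable (by fun_prop)).mul
      (intervalIntegrable_iff.1 hφ).aestronglyMeasurable
  · rw [norm_mul, Real.norm_eq_abs, Real.norm_eq_abs]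
    exact mul_le_of_le_one_left (abs_nonneg _) (Real.abs_sin_le_one _)

theorem abs_sinTransform_le (hφ : IntervalIntegrable φ volume 0 1) (K : ℝ) :
    |∫ u in (0 : ℝ)..1, Real.sin (K * (α + β * u)) * φ u| ≤ ∫ u in (0 : ℝ)..1, |φ u| := by
  refine intervalIntegral.norm_integral_le_of_norm_le (f := fun u => Real.sin (K * (α + β * u)) * φ u)
    zero_le_one (Eventually.of_forall fun u _ => ?_) hφ.abs
  rw [norm_mul, Real.norm_eq_abs, Real.norm_eq_abs]
  exact mul_le_of_le_one_left (abs_nonneg _) (Real.abs_sin_le_one _)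

/-- The regularized frequency integral of a sine transform of `φ` along an affine phase `α + β u`
is the integral of `φ` against the reciprocal of the phase. -/
theorem hasAbelIntegral_sinTransform (hφ : IntervalIntegrable φ volume 0 1)
    (hpos : ∀ u ∈ Ioc (0 : ℝ) 1, 0 < α + β * u)
    (hq : IntervalIntegrable (fun u => φ u / (α + β * u)) volume 0 1) :
    HasAbelIntegral (fun K => ∫ u in (0 : ℝ)..1, Real.sin (K * (α + β * u)) * φ u)
      (∫ u in (0 : ℝ)..1, φ u / (α + β * u)) := by
  refine ⟨fun δ hδ => integrableOn_exp_mul_of_bounded (continuous_sinTransform hφ)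
    (abs_sinTransform_le hφ) hδ, ?_⟩
  have hφ' : IntegrableOn φ (Ioc 0 1) :=
    (intervalIntegrable_iff_integrableOn_Ioc_of_le zero_le_one).1 hφ
  have key : ∀ δ : ℝ, 0 < δ →
      ∫ K in Ioi (0 : ℝ), Real.exp (-(δ * K)) *
        ∫ u in (0 : ℝ)..1, Real.sin (K * (α + β * u)) * φ u
      = ∫ u in (0 : ℝ)..1, (α + β * u) / ((α + β * u) ^ 2 + δ ^ 2) * φ u := by
    intro δ hδ
    have hint0 : IntegrableOn (fun K : ℝ => Real.exp (-(δ * K))) (Ioi 0) := by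
      simpa using integrableOn_exp_mul_Ioi (a := -δ) (by linarith) 0
    have hprod : Integrable (Function.uncurry fun K u : ℝ =>
        Real.exp (-(δ * K)) * (Real.sin (K * (α + β * u)) * φ u))
        ((volume.restrict (Ioi 0)).prod (volume.restrict (Ioc 0 1))) := by
      have h1 := hint0.mul_prod hφ'
      refine (h1.bdd_mul (c := 1) (f := fun p : ℝ × ℝ => Real.sin (p.1 * (α + β * p.2)))
        (Continuous.aestronglyMeasurable (by fun_prop))
        (Eventually.of_forall fun p => Real.abs_sin_le_one _)).congr
        (Eventually.of_forall fun p => ?_)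
      simp only [Function.uncurry]
      ring
    calc _ = ∫ K in Ioi (0 : ℝ), ∫ u in Ioc (0 : ℝ) 1,
          Real.exp (-(δ * K)) * (Real.sin (K * (α + β * u)) * φ u) := by
            congr 1; ext K
            rw [integral_const_mul, intervalIntegral.integral_of_le zero_le_one]
      _ = ∫ u in Ioc (0 : ℝ) 1, ∫ K in Ioi (0 : ℝ),
          Real.exp (-(δ * K)) * (Real.sin (K * (α + β * u)) * φ u) :=
            integral_integral_swap hprod
      _ = _ := by
            rw [intervalIntegral.integral_of_le zero_le_one]
            congr 1; ext u
            rw [← integral_exp_neg_mul_sin hδ, ← integral_mul_const]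
            congr 1; ext K; ring
  have hlim : Tendsto (fun δ : ℝ => ∫ u in (0 : ℝ)..1,
      (α + β * u) / ((α + β * u) ^ 2 + δ ^ 2) * φ u) (𝓝[>] 0)
      (𝓝 (∫ u in (0 : ℝ)..1, φ u / (α + β * u))) := by
    refine intervalIntegral.tendsto_integral_filter_of_dominated_convergence
      (fun u => |φ u / (α + β * u)|) ?_ ?_ hq.abs ?_
    · refine Eventually.of_forall fun δ => ?_
      exact (Measurable.aestronglyMeasurable (by fun_prop)).mul
        (intervalIntegrable_iff.1 hφ).aestronglyMeasurable
    · refine Eventually.of_forall fun δ => Eventually.of_forall fun u hu => ?_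
      rw [uIoc_of_le zero_le_one] at hu
      have hp := hpos u hu
      rw [norm_mul, Real.norm_eq_abs, Real.norm_eq_abs, abs_div (φ u), div_eq_mul_inv |φ u|,
        mul_comm, abs_of_pos hp,
        abs_of_pos (by positivity : 0 < (α + β * u) / ((α + β * u) ^ 2 + δ ^ 2))]
      refine mul_le_mul_of_nonneg_left ?_ (abs_nonneg _)
      rw [inv_eq_one_div, div_le_div_iff₀ (by positivity) hp]
      nlinarith [sq_nonneg δ]
    · refine Eventually.of_forall fun u hu => ?_
      rw [uIoc_of_le zero_le_one] at hu
      have hp := hpos u hu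
      have h : ContinuousAt (fun δ : ℝ => (α + β * u) / ((α + β * u) ^ 2 + δ ^ 2) * φ u) 0 := by
        have : (α + β * u) ^ 2 + (0 : ℝ) ^ 2 ≠ 0 := by positivity
        fun_prop (disch := assumption)
      have h2 := h.tendsto.mono_left (nhdsWithin_le_nhds (s := Ioi 0))
      have e : (α + β * u) / ((α + β * u) ^ 2 + 0 ^ 2) * φ u = φ u / (α + β * u) := by
        field_simp; ring
      rwa [e] at h2
  refine hlim.congr' ?_
  filter_upwards [self_mem_nhdsWithin] with δ hδ
  exact (key δ hδ).symm

/-- The Riemann-Lebesgue lemma for the real phase `b (α + β u)`, `β ≠ 0`, on `[0, 1]`. -/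
theorem tendsto_integral_cos_atTop (hβ : β ≠ 0) (ψ : ℝ → ℝ) (hψ : IntervalIntegrable ψ volume 0 1) :
    Tendsto (fun b : ℝ => ∫ u in (0 : ℝ)..1, Real.cos (b * (α + β * u)) * ψ u) atTop (𝓝 0) := by
  have hψ' : IntegrableOn ψ (Ioc 0 1) :=
    (intervalIntegrable_iff_integrableOn_Ioc_of_le zero_le_one).1 hψ
  set f : ℝ → ℂ := (Ioc (0 : ℝ) 1).indicator fun u => (ψ u : ℂ) with hf
  have hfi : Integrable f := (integrable_indicator_iff measurableSet_Ioc).2 (hψ'.ofReal (𝕜 := ℂ))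
  have hpi := Real.pi_pos
  have hcoc : Tendsto (fun b : ℝ => -(b * β / (2 * Real.pi))) atTop (cocompact ℝ) := by
    have : Tendsto (fun b : ℝ => b * (-(β / (2 * Real.pi)))) atTop (cocompact ℝ) := by
      refine (Homeomorph.mulRight₀ (-(β / (2 * Real.pi))) ?_).isClosedEmbedding.tendsto_cocompact.comp
        (atTop_le_cocompact)
      simp [hβ, hpi.ne']
    refine this.congr fun b => by ring
  have h0 := (Real.tendsto_integral_exp_smul_cocompact f).comp hcoc
  have h1 : Tendsto (fun b : ℝ => Complex.exp (Complex.I * ((b * α : ℝ) : ℂ)) *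
      ∫ v : ℝ, Real.fourierChar (-(v * (-(b * β / (2 * Real.pi))))) • f v) atTop (𝓝 0) := by
    refine Tendsto.zero_mul_isBoundedUnder_le
      (f := fun b : ℝ => ∫ v : ℝ, Real.fourierChar (-(v * (-(b * β / (2 * Real.pi))))) • f v)
      h0 ?_ |>.congr fun b => mul_comm _ _
    refine isBoundedUnder_of ⟨1, fun b => ?_⟩
    simp only [Function.comp]
    rw [mul_comm, Complex.norm_exp_ofReal_mul_I]
  have h2 := (Complex.continuous_re.tendsto _).comp h1
  rw [Complex.zero_re] at h2
  refine h2.congr fun b => ?_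
  simp only [Function.comp]
  have hgi : Integrable (fun v => Complex.exp (Complex.I * ((b * α : ℝ) : ℂ)) *
      (Real.fourierChar (-(v * (-(b * β / (2 * Real.pi))))) • f v)) := by
    refine Integrable.const_mul ?_ _
    refine hfi.bdd_mul (c := 1)
      (f := fun v => ((Real.fourierChar (-(v * (-(b * β / (2 * Real.pi))))) : Circle) : ℂ)) ?_ ?_
    · exact Continuous.aestronglyMeasurable (by fun_prop)
    · exact Eventually.of_forall fun v => (Circle.norm_coe _).le
  rw [← integral_const_mul, ← RCLike.re_eq_complex_re, ← integral_re hgi,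
    intervalIntegral.integral_of_le zero_le_one, ← integral_indicator measurableSet_Ioc]
  congr 1; ext v
  by_cases hv : v ∈ Ioc (0 : ℝ) 1
  · simp only [hf, indicator_of_mem hv, Circle.smul_def, Real.fourierChar_apply, smul_eq_mul]
    rw [← mul_assoc, ← Complex.exp_add, RCLike.re_eq_complex_re, Complex.re_mul_ofReal]
    congr 1
    have : Complex.I * ((b * α : ℝ) : ℂ) +
        ((2 * Real.pi * (-(v * (-(b * β / (2 * Real.pi))))) : ℝ) : ℂ) * Complex.I
        = ((b * (α + β * v) : ℝ) : ℂ) * Complex.I := by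
      push_cast
      have : (Real.pi : ℂ) ≠ 0 := by exact_mod_cast hpi.ne'
      field_simp
    rw [this, Complex.exp_ofReal_mul_I_re]
  · simp [hf, indicator_of_notMem hv]

/-- The improper frequency integral of a sine transform: `φ` integrated against the reciprocal of
the phase. Convergence at infinity is the Riemann-Lebesgue lemma. -/
theorem hasImproperIntegral_sinTransform (hβ : β ≠ 0) (hφ : IntervalIntegrable φ volume 0 1)
    (hpos : ∀ u ∈ Ioc (0 : ℝ) 1, 0 < α + β * u)
    (hq : IntervalIntegrable (fun u => φ u / (α + β * u)) volume 0 1) :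
    HasImproperIntegral (fun K => ∫ u in (0 : ℝ)..1, Real.sin (K * (α + β * u)) * φ u)
      (∫ u in (0 : ℝ)..1, φ u / (α + β * u)) := by
  refine ⟨fun b _ => (continuous_sinTransform hφ).intervalIntegrable _ _, ?_⟩
  have hφ' : IntegrableOn φ (Ioc 0 1) :=
    (intervalIntegrable_iff_integrableOn_Ioc_of_le zero_le_one).1 hφ
  have key : ∀ b : ℝ, 0 < b →
      ∫ K in (0 : ℝ)..b, ∫ u in (0 : ℝ)..1, Real.sin (K * (α + β * u)) * φ u
      = (∫ u in (0 : ℝ)..1, φ u / (α + β * u))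
        - ∫ u in (0 : ℝ)..1, Real.cos (b * (α + β * u)) * (φ u / (α + β * u)) := by
    intro b hb
    have hprod : Integrable (Function.uncurry fun K u : ℝ =>
        Real.sin (K * (α + β * u)) * φ u)
        ((volume.restrict (Ioc 0 b)).prod (volume.restrict (Ioc 0 1))) := by
      have h1 := (integrable_const (μ := volume.restrict (Ioc 0 b)) (1 : ℝ)).mul_prod hφ'
      refine (h1.bdd_mul (c := 1) (f := fun p : ℝ × ℝ => Real.sin (p.1 * (α + β * p.2)))
        (Continuous.aestronglyMeasurable (by fun_prop))
        (Eventually.of_forall fun p => Real.abs_sin_le_one _)).congr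
        (Eventually.of_forall fun p => ?_)
      simp only [Function.uncurry]
      ring
    have hc : IntervalIntegrable
        (fun u => Real.cos (b * (α + β * u)) * (φ u / (α + β * u))) volume 0 1 :=
      hq.continuousOn_mul (by fun_prop)
    rw [← intervalIntegral.integral_sub hq hc]
    simp only [intervalIntegral.integral_of_le zero_le_one, intervalIntegral.integral_of_le hb.le]
    rw [integral_integral_swap hprod]
    refine setIntegral_congr_fun measurableSet_Ioc fun u hu => ?_
    have hp := hpos u hu
    rw [integral_mul_const, ← intervalIntegral.integral_of_le hb.le,
      intervalIntegral.integral_comp_mul_right (fun t => Real.sin t) hp.ne', integral_sin]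
    simp
    field_simp
  have hlim := (tendsto_const_nhds (x := ∫ u in (0 : ℝ)..1, φ u / (α + β * u))).sub
    (tendsto_integral_cos_atTop (α := α) hβ _ hq)
  rw [sub_zero] at hlim
  refine hlim.congr' ?_
  filter_upwards [eventually_gt_atTop 0] with b hb
  exact (key b hb).symm

end transform

/-- The cosine difference quotient as a sine transform over the segment from `p` to `q`. -/
theorem cos_sub_cos_div_eq {p q K : ℝ} (hK : 0 < K) :
    (Real.cos (K * p) - Real.cos (K * q)) / K
      = ∫ u in (0 : ℝ)..1, Real.sin (K * (p + (q - p) * u)) * (q - p) := by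
  rcases eq_or_ne q p with rfl | hne
  · simp
  have hne' : q - p ≠ 0 := sub_ne_zero.2 hne
  have h1 : ∀ u : ℝ, Real.sin (K * (p + (q - p) * u)) * (q - p)
      = Real.sin (K * p + (K * (q - p)) * u) * (q - p) := fun u => by ring_nf
  simp only [h1]
  rw [intervalIntegral.integral_mul_const,
    intervalIntegral.integral_comp_add_mul (fun t => Real.sin t) (mul_ne_zero hK.ne' hne'),
    integral_sin]
  have e : K * p + K * (q - p) * 1 = K * q := by ring
  rw [e]
  simp
  field_simp

theorem integral_segment_inv {p q : ℝ} (hp : 0 < p) (hq : 0 < q) :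
    ∫ u in (0 : ℝ)..1, (q - p) / (p + (q - p) * u) = Real.log (q / p) := by
  rcases eq_or_ne q p with rfl | hne
  · simp [hp.ne']
  have hne' : q - p ≠ 0 := sub_ne_zero.2 hne
  simp only [div_eq_mul_inv (q - p)]
  rw [intervalIntegral.integral_const_mul,
    intervalIntegral.integral_comp_add_mul (fun t => t⁻¹) hne']
  have e : p + (q - p) * 1 = q := by ring
  rw [e, mul_zero, add_zero, integral_inv_of_pos hp hq, smul_eq_mul, mul_inv_cancel_left₀ hne']

theorem segment_pos {p q : ℝ} (hp : 0 < p) (hq : 0 < q) :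
    ∀ u ∈ Icc (0 : ℝ) 1, 0 < p + (q - p) * u := by
  rintro u ⟨h0, h1⟩
  rcases eq_or_lt_of_le h0 with rfl | h
  · simpa
  · nlinarith

theorem hasAbelIntegral_cos_sub_cos {p q : ℝ} (hp : 0 < p) (hq : 0 < q) :
    HasAbelIntegral (fun K => (Real.cos (K * p) - Real.cos (K * q)) / K) (Real.log (q / p)) := by
  rw [← integral_segment_inv hp hq]
  refine (hasAbelIntegral_sinTransform (by simp)
    (fun u hu => segment_pos hp hq u (Ioc_subset_Icc_self hu)) ?_).congr
    fun K hK => cos_sub_cos_div_eq hK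
  refine ContinuousOn.intervalIntegrable ?_
  rw [uIcc_of_le zero_le_one]
  exact ContinuousOn.div (by fun_prop) (by fun_prop) fun u hu => (segment_pos hp hq u hu).ne'

theorem hasImproperIntegral_cos_sub_cos {p q : ℝ} (hp : 0 < p) (hq : 0 < q) (hne : q ≠ p) :
    HasImproperIntegral (fun K => (Real.cos (K * p) - Real.cos (K * q)) / K)
      (Real.log (q / p)) := by
  rw [← integral_segment_inv hp hq]
  refine (hasImproperIntegral_sinTransform (sub_ne_zero.2 hne) (by simp)
    (fun u hu => segment_pos hp hq u (Ioc_subset_Icc_self hu)) ?_).congr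
    fun K hK => cos_sub_cos_div_eq hK
  refine ContinuousOn.intervalIntegrable ?_
  rw [uIcc_of_le zero_le_one]
  exact ContinuousOn.div (by fun_prop) (by fun_prop) fun u hu => (segment_pos hp hq u hu).ne'


/-! ### The amplification factor and the profile near the end of the formation -/

/-- The logarithmic derivative `cot ∘ h = B' / B` of `B`; on `(0, 1)` it equals `1 / g`. -/
noncomputable def rate (h : ℝ → ℝ) (z : ℝ) : ℝ := Real.cot (h z)

/-- The derivative of `B` on `z < 1`, as an explicit product. -/
noncomputable def Bd (h : ℝ → ℝ) (z : ℝ) : ℝ := rate h z * B h z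

/-- A function continuous at `1` and vanishing on `z > 1` vanishes at `1`. -/
theorem eq_zero_of_eventually_right {f : ℝ → ℝ} (hf : ContinuousAt f 1)
    (h0 : ∀ z : ℝ, 1 < z → f z = 0) : f 1 = 0 := by
  have h1 : Tendsto f (𝓝[>] 1) (𝓝 (f 1)) := hf.tendsto.mono_left nhdsWithin_le_nhds
  have h2 : Tendsto f (𝓝[>] 1) (𝓝 0) := tendsto_const_nhds.congr' (by
    filter_upwards [self_mem_nhdsWithin] with z hz
    exact (h0 z hz).symm)
  exact tendsto_nhds_unique h1 h2

namespace IsSwitchingProfile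

variable {h : ℝ → ℝ} (hh : IsSwitchingProfile h)
include hh

theorem sin_pos {z : ℝ} (hz : z < 1) : 0 < Real.sin (h z) := by
  rcases le_or_gt z 0 with h0 | h0
  · rw [hh.before z h0, Real.sin_pi_div_two]; exact one_pos
  · obtain ⟨h1, h2⟩ := hh.during z h0 hz
    exact Real.sin_pos_of_pos_of_lt_pi h1 (by linarith [Real.pi_pos])

theorem cos_pos {z : ℝ} (hz : 0 < z) : 0 < Real.cos (h z) := by
  rcases lt_or_ge z 1 with h1 | h1
  · obtain ⟨h2, h3⟩ := hh.during z hz h1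
    exact Real.cos_pos_of_mem_Ioo ⟨by linarith [Real.pi_pos], h3⟩
  · rw [hh.after z h1, Real.cos_zero]; exact one_pos

theorem rate_of_nonpos {z : ℝ} (hz : z ≤ 0) : rate h z = 0 := by
  rw [rate, hh.before z hz, Real.cot_eq_cos_div_sin, Real.cos_pi_div_two, zero_div]

theorem contDiffOn_rate : ContDiffOn ℝ ∞ (rate h) (Iio 1) := by
  have : rate h = fun z => Real.cos (h z) / Real.sin (h z) := by
    ext z; rw [rate, Real.cot_eq_cos_div_sin]
  rw [this]
  exact (Real.contDiff_cos.comp hh.smooth).contDiffOn.div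
    (Real.contDiff_sin.comp hh.smooth).contDiffOn fun z hz => (hh.sin_pos hz).ne'

theorem continuousOn_rate : ContinuousOn (rate h) (Iio 1) := hh.contDiffOn_rate.continuousOn

theorem B_eq (T : ℝ) : B h T = Real.exp (∫ z in (0 : ℝ)..T, rate h z) := by
  rw [B]
  split_ifs with hT
  · have : ∫ z in (0 : ℝ)..T, rate h z = ∫ z in (0 : ℝ)..T, (0 : ℝ) := by
      refine intervalIntegral.integral_congr fun z hz => ?_
      rw [uIcc_of_ge hT] at hz
      exact hh.rate_of_nonpos hz.2
    rw [this]; simp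
  · rfl

omit hh in
theorem B_of_nonpos {T : ℝ} (hT : T ≤ 0) : B h T = 1 := by rw [B, if_pos hT]

theorem Bd_of_nonpos {T : ℝ} (hT : T ≤ 0) : Bd h T = 0 := by
  rw [Bd, hh.rate_of_nonpos hT, zero_mul]

theorem B_pos (T : ℝ) : 0 < B h T := by rw [hh.B_eq]; exact Real.exp_pos _

theorem hasDerivAt_B {z : ℝ} (hz : z < 1) : HasDerivAt (B h) (Bd h z) z := by
  have hB : B h = fun T => Real.exp (∫ z in (0 : ℝ)..T, rate h z) := funext hh.B_eq
  have hcont : ContinuousOn (rate h) (uIcc 0 z) := by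
    refine hh.continuousOn_rate.mono fun x hx => ?_
    exact hx.2.trans_lt (max_lt one_pos hz)
  have h1 : HasDerivAt (fun T => ∫ z in (0 : ℝ)..T, rate h z) (rate h z) z :=
    intervalIntegral.integral_hasDerivAt_right hcont.intervalIntegrable
      (hh.continuousOn_rate.stronglyMeasurableAtFilter isOpen_Iio z hz)
      (hh.continuousOn_rate.continuousAt (isOpen_Iio.mem_nhds hz))
  have h2 := h1.exp
  rw [← hB] at h2
  refine h2.congr_deriv ?_
  rw [Bd, hh.B_eq z, mul_comm]

theorem deriv_B {z : ℝ} (hz : z < 1) : deriv (B h) z = Bd h z := (hh.hasDerivAt_B hz).deriv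

theorem continuousOn_B : ContinuousOn (B h) (Iio 1) :=
  fun _ hz => (hh.hasDerivAt_B hz).continuousAt.continuousWithinAt

theorem continuousOn_Bd : ContinuousOn (Bd h) (Iio 1) := hh.continuousOn_rate.mul hh.continuousOn_B

theorem rate_nonneg {z : ℝ} (hz : z < 1) : 0 ≤ rate h z := by
  rcases le_or_gt z 0 with h0 | h0
  · rw [hh.rate_of_nonpos h0]
  · rw [rate, Real.cot_eq_cos_div_sin]
    exact (div_pos (hh.cos_pos h0) (hh.sin_pos hz)).le

theorem Bd_nonneg {z : ℝ} (hz : z < 1) : 0 ≤ Bd h z :=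
  mul_nonneg (hh.rate_nonneg hz) (hh.B_pos z).le

theorem monotoneOn_B : MonotoneOn (B h) (Iio 1) := by
  refine monotoneOn_of_deriv_nonneg (convex_Iio 1) hh.continuousOn_B ?_ ?_
  · rw [interior_Iio]
    exact fun z hz => (hh.hasDerivAt_B hz).differentiableAt.differentiableWithinAt
  · rw [interior_Iio]
    intro z hz
    rw [hh.deriv_B hz]
    exact hh.Bd_nonneg hz

theorem one_le_B {z : ℝ} (hz : z < 1) : 1 ≤ B h z := by
  rcases le_or_gt z 0 with h0 | h0
  · rw [B_of_nonpos h0]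
  · rw [← B_of_nonpos (h := h) le_rfl]
    exact hh.monotoneOn_B (mem_Iio.2 one_pos) hz h0.le

/-- The rate is Lipschitz away from the end of the formation. -/
theorem exists_rate_lipschitz {s : ℝ} (hs : s < 1) :
    ∃ M : ℝ, 0 ≤ M ∧ ∀ x ∈ Icc (-1 : ℝ) s, ∀ y ∈ Icc (-1 : ℝ) s,
      |rate h x - rate h y| ≤ M * |x - y| := by
  have hd : ContinuousOn (deriv (rate h)) (Iio 1) :=
    (hh.contDiffOn_rate.deriv_of_isOpen isOpen_Iio (m := 0) (by norm_num)).continuousOn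
  have hsub : Icc (-1 : ℝ) s ⊆ Iio 1 := fun x hx => hx.2.trans_lt hs
  obtain ⟨M, hM⟩ := isCompact_Icc.exists_bound_of_continuousOn (hd.mono hsub)
  refine ⟨|M|, abs_nonneg M, fun x hx y hy => ?_⟩
  refine (convex_Icc (-1 : ℝ) s).norm_image_sub_le_of_norm_deriv_le (f := rate h)
    (fun z hz => ?_) (fun z hz => (hM z hz).trans (le_abs_self M)) hy hx
  exact ((hh.contDiffOn_rate.contDiffAt (isOpen_Iio.mem_nhds (hsub hz))).differentiableAt
    (by norm_num))

theorem contDiffOn_g : ContDiffOn ℝ ∞ (g h) (Ioi 0) := by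
  intro z hz
  exact ((Real.contDiffAt_tan.2 (hh.cos_pos hz).ne').comp z
    hh.smooth.contDiffAt).contDiffWithinAt

theorem g_of_one_le {z : ℝ} (hz : 1 ≤ z) : g h z = 0 := by
  rw [g, hh.after z hz, Real.tan_zero]

theorem g_pos {z : ℝ} (h0 : 0 < z) (h1 : z < 1) : 0 < g h z := by
  rw [g]
  exact Real.tan_pos_of_pos_of_lt_pi_div_two (hh.during z h0 h1).1 (hh.during z h0 h1).2

omit hh in
theorem rate_eq (z : ℝ) : rate h z = (g h z)⁻¹ := by
  rw [rate, g, Real.cot_eq_cos_div_sin, Real.tan_eq_sin_div_cos, inv_div]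

theorem contDiffOn_deriv_g : ContDiffOn ℝ ∞ (deriv (g h)) (Ioi 0) :=
  hh.contDiffOn_g.deriv_of_isOpen isOpen_Ioi (by norm_num)

theorem contDiffOn_deriv_deriv_g : ContDiffOn ℝ ∞ (deriv (deriv (g h))) (Ioi 0) :=
  hh.contDiffOn_deriv_g.deriv_of_isOpen isOpen_Ioi (by norm_num)

theorem hasDerivAt_g {z : ℝ} (hz : 0 < z) : HasDerivAt (g h) (deriv (g h) z) z :=
  ((hh.contDiffOn_g.contDiffAt (isOpen_Ioi.mem_nhds hz)).differentiableAt (by norm_num)).hasDerivAt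

theorem hasDerivAt_deriv_g {z : ℝ} (hz : 0 < z) :
    HasDerivAt (deriv (g h)) (deriv (deriv (g h)) z) z :=
  ((hh.contDiffOn_deriv_g.contDiffAt (isOpen_Ioi.mem_nhds hz)).differentiableAt
    (by norm_num)).hasDerivAt

theorem deriv_g_of_one_lt {z : ℝ} (hz : 1 < z) : deriv (g h) z = 0 := by
  have : g h =ᶠ[𝓝 z] fun _ => 0 := by
    filter_upwards [isOpen_Ioi.mem_nhds hz] with x hx
    exact hh.g_of_one_le (le_of_lt hx)
  rw [this.deriv_eq]; simp

theorem deriv_deriv_g_of_one_lt {z : ℝ} (hz : 1 < z) : deriv (deriv (g h)) z = 0 := by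
  have : deriv (g h) =ᶠ[𝓝 z] fun _ => 0 := by
    filter_upwards [isOpen_Ioi.mem_nhds hz] with x hx
    exact hh.deriv_g_of_one_lt hx
  rw [this.deriv_eq]; simp

theorem continuousAt_deriv_g {z : ℝ} (hz : 0 < z) : ContinuousAt (deriv (g h)) z :=
  hh.contDiffOn_deriv_g.continuousOn.continuousAt (isOpen_Ioi.mem_nhds hz)

theorem continuousAt_deriv_deriv_g {z : ℝ} (hz : 0 < z) : ContinuousAt (deriv (deriv (g h))) z :=
  hh.contDiffOn_deriv_deriv_g.continuousOn.continuousAt (isOpen_Ioi.mem_nhds hz)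

theorem deriv_g_one : deriv (g h) 1 = 0 :=
  eq_zero_of_eventually_right (hh.continuousAt_deriv_g one_pos) fun _ => hh.deriv_g_of_one_lt

theorem deriv_deriv_g_one : deriv (deriv (g h)) 1 = 0 :=
  eq_zero_of_eventually_right (hh.continuousAt_deriv_deriv_g one_pos) fun _ =>
    hh.deriv_deriv_g_of_one_lt

/-- Near `1` one has `g'' ≤ 1` and `-g' ≤ 1 / 4`, since `g'` and `g''` vanish at `1`. -/
theorem exists_flat : ∃ z₀ : ℝ, 0 < z₀ ∧ z₀ < 1 ∧ ∀ z ∈ Ico z₀ 1,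
    -deriv (g h) z ≤ 1 / 4 ∧ deriv (deriv (g h)) z ≤ 1 := by
  have h1 : ∀ᶠ z in 𝓝 (1 : ℝ), -deriv (g h) z < 1 / 4 :=
    (hh.continuousAt_deriv_g one_pos).neg.eventually_lt_const (by simp [hh.deriv_g_one])
  have h2 : ∀ᶠ z in 𝓝 (1 : ℝ), deriv (deriv (g h)) z < 1 :=
    (hh.continuousAt_deriv_deriv_g one_pos).eventually_lt_const (by simp [hh.deriv_deriv_g_one])
  obtain ⟨ε, hε, hb⟩ := Metric.eventually_nhds_iff.1 (h1.and h2)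
  refine ⟨max (1 / 2) (1 - ε / 2), by positivity, max_lt (by norm_num) (by linarith),
    fun z hz => ?_⟩
  have h3 := (le_max_right _ _).trans hz.1
  have := @hb z (by rw [Real.dist_eq, abs_of_nonpos (by linarith [hz.2])]; linarith)
  exact ⟨this.1.le, this.2.le⟩

section convex

variable (hg : ∀ T : ℝ, 0 < T → T < 1 → iteratedDeriv 3 (g h) T < 0)
include hg

theorem deriv_deriv_g_pos {z : ℝ} (h0 : 0 < z) (h1 : z < 1) : 0 < deriv (deriv (g h)) z := by
  have hsub : Icc z 1 ⊆ Ioi 0 := fun x hx => h0.trans_le hx.1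
  have : StrictAntiOn (deriv (deriv (g h))) (Icc z 1) := by
    refine strictAntiOn_of_deriv_neg (convex_Icc z 1)
      (hh.contDiffOn_deriv_deriv_g.continuousOn.mono hsub) fun x hx => ?_
    rw [interior_Icc] at hx
    have := hg x (h0.trans hx.1) hx.2
    rwa [iteratedDeriv_succ, iteratedDeriv_succ, iteratedDeriv_one] at this
  have h2 := this (left_mem_Icc.2 h1.le) (right_mem_Icc.2 h1.le) h1
  rwa [hh.deriv_deriv_g_one] at h2

theorem strictMonoOn_deriv_g : StrictMonoOn (deriv (g h)) (Ioc 0 1) := by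
  refine strictMonoOn_of_deriv_pos (convex_Ioc 0 1)
    (hh.contDiffOn_deriv_g.continuousOn.mono fun x hx => hx.1) fun x hx => ?_
  rw [interior_Ioc] at hx
  exact hh.deriv_deriv_g_pos hg hx.1 hx.2

theorem deriv_g_neg {z : ℝ} (h0 : 0 < z) (h1 : z < 1) : deriv (g h) z < 0 := by
  rw [← hh.deriv_g_one]
  exact hh.strictMonoOn_deriv_g hg ⟨h0, h1.le⟩ ⟨one_pos, le_rfl⟩ h1

/-- The graph of the convex function `g` lies above its tangents. -/
theorem mul_le_g_sub_g {z s : ℝ} (h0 : 0 < z) (hzs : z ≤ s) (hs : s ≤ 1) :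
    -deriv (g h) s * (s - z) ≤ g h z - g h s := by
  have hsub : Icc z s ⊆ Ioi 0 := fun x hx => h0.trans_le hx.1
  have := (convex_Icc z s).image_sub_le_mul_sub_of_deriv_le (f := g h) (C := deriv (g h) s)
    (hh.contDiffOn_g.continuousOn.mono hsub)
    (fun x hx => (hh.hasDerivAt_g (hsub (interior_subset hx))).differentiableAt.differentiableWithinAt)
    (fun x hx => by
      rw [interior_Icc] at hx
      exact (hh.strictMonoOn_deriv_g hg ⟨h0.trans hx.1, hx.2.le.trans hs⟩
        ⟨h0.trans_le hzs, hs⟩ hx.2).le) z (left_mem_Icc.2 hzs) s (right_mem_Icc.2 hzs) hzs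
  linarith

omit hg in
/-- A second-order upper bound for `g` to the left of `s`, where `g'' ≤ 1`. -/
theorem g_sub_g_le {z₀ z s : ℝ} (h00 : 0 < z₀)
    (hz₀ : ∀ z ∈ Ico z₀ 1, deriv (deriv (g h)) z ≤ 1)
    (h0 : z₀ ≤ z) (hzs : z ≤ s) (hs : s < 1) :
    g h z - g h s ≤ -deriv (g h) s * (s - z) + (s - z) ^ 2 := by
  have hsub : Icc z s ⊆ Ioi 0 := fun x hx => h00.trans_le (h0.trans hx.1)
  have hd : ∀ x ∈ Icc z s, deriv (g h) s - (s - z) ≤ deriv (g h) x := fun x hx => by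
    have := (convex_Icc x s).image_sub_le_mul_sub_of_deriv_le (f := deriv (g h)) (C := 1)
      (hh.contDiffOn_deriv_g.continuousOn.mono fun y hy => h00.trans_le (h0.trans (hx.1.trans hy.1)))
      (fun y hy => (hh.hasDerivAt_deriv_g (h00.trans_le (h0.trans (hx.1.trans
        (interior_subset hy).1)))).differentiableAt.differentiableWithinAt)
      (fun y hy => by
        rw [interior_Icc] at hy
        exact hz₀ y ⟨h0.trans (hx.1.trans hy.1.le), hy.2.trans hs⟩)
      x (left_mem_Icc.2 hx.2) s (right_mem_Icc.2 hx.2) hx.2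
    linarith [hx.1]
  have := (convex_Icc z s).mul_sub_le_image_sub_of_le_deriv (f := g h) (C := deriv (g h) s - (s - z))
    (hh.contDiffOn_g.continuousOn.mono hsub)
    (fun x hx => (hh.hasDerivAt_g (hsub (interior_subset hx))).differentiableAt.differentiableWithinAt)
    (fun x hx => hd x (interior_subset hx)) z (left_mem_Icc.2 hzs) s (right_mem_Icc.2 hzs) hzs
  nlinarith

/-- Convexity and `g 1 = 0` give `g ≤ |g'| (1 - s)`, so that `-g' / g` tends to infinity. -/
theorem g_le_neg_deriv_mul {s : ℝ} (h0 : 0 < s) (h1 : s < 1) :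
    g h s ≤ -deriv (g h) s * (1 - s) := by
  have hsub : Icc s 1 ⊆ Ioi 0 := fun x hx => h0.trans_le hx.1
  have := (convex_Icc s 1).mul_sub_le_image_sub_of_le_deriv (f := g h) (C := deriv (g h) s)
    (hh.contDiffOn_g.continuousOn.mono hsub)
    (fun x hx => (hh.hasDerivAt_g (hsub (interior_subset hx))).differentiableAt.differentiableWithinAt)
    (fun x hx => by
      rw [interior_Icc] at hx
      exact (hh.strictMonoOn_deriv_g hg ⟨h0, h1.le⟩ ⟨h0.trans hx.1, hx.2.le⟩ hx.1).le)
      s (left_mem_Icc.2 h1.le) 1 (right_mem_Icc.2 h1.le) h1.le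
  rw [hh.g_of_one_le le_rfl] at this
  linarith

theorem antitoneOn_g : AntitoneOn (g h) (Ioo 0 1) := by
  intro x hx y hy hxy
  have h1 := hh.mul_le_g_sub_g hg hx.1 hxy hy.2.le
  have h2 := hh.deriv_g_neg hg hy.1 hy.2
  nlinarith

theorem monotoneOn_rate : MonotoneOn (rate h) (Iio 1) := by
  intro x hx y hy hxy
  rcases le_or_gt x 0 with h0 | h0
  · rw [hh.rate_of_nonpos h0]; exact hh.rate_nonneg hy
  · rw [rate_eq, rate_eq]
    exact inv_anti₀ (hh.g_pos (h0.trans_le hxy) hy)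
      (hh.antitoneOn_g hg ⟨h0, hx⟩ ⟨h0.trans_le hxy, hy⟩ hxy)

end convex

end IsSwitchingProfile

/-! ### The mode functions in frequency space -/

/-- Fubini for a continuous function on a rectangle. -/
theorem intervalIntegral_swap_of_continuousOn {f : ℝ → ℝ → ℝ} {a b c d : ℝ} (hab : a ≤ b)
    (hcd : c ≤ d) (hf : ContinuousOn (Function.uncurry f) (Icc a b ×ˢ Icc c d)) :
    ∫ x in a..b, ∫ u in c..d, f x u = ∫ u in c..d, ∫ x in a..b, f x u := by
  have h1 : IntegrableOn (Function.uncurry f) (Icc a b ×ˢ Icc c d) (volume.prod volume) :=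
    hf.integrableOn_compact (isCompact_Icc.prod isCompact_Icc)
  have h2 : Integrable (Function.uncurry f)
      ((volume.restrict (Ioc a b)).prod (volume.restrict (Ioc c d))) := by
    rw [Measure.prod_restrict]
    exact h1.mono_set (prod_mono Ioc_subset_Icc_self Ioc_subset_Icc_self)
  simp only [intervalIntegral.integral_of_le hab, intervalIntegral.integral_of_le hcd]
  exact integral_integral_swap h2

/-- The correlation `∫₀ˢ B(x) B'(x - u) dx` of the amplification factor with its derivative. -/
noncomputable def V (h : ℝ → ℝ) (s u : ℝ) : ℝ := ∫ x in (0 : ℝ)..s, B h x * Bd h (x - u)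

/-- The antisymmetric correlation `∫₀ˢ (B'(x) B(x - u) - B(x) B'(x - u)) dx`, in integrated form;
it is of order `u` as `u → 0`. -/
noncomputable def Xi (h : ℝ → ℝ) (s u : ℝ) : ℝ := B h s * B h (s - u) - 1 - 2 * V h s u

/-- The cosine transform of `u ↦ B'(s - u)`. -/
noncomputable def cosTr (h : ℝ → ℝ) (K s : ℝ) : ℝ :=
  ∫ u in (0 : ℝ)..1, Real.cos (K * u) * Bd h (s - u)

/-- The sine transform of `u ↦ B'(s - u)`. -/
noncomputable def sinTr (h : ℝ → ℝ) (K s : ℝ) : ℝ :=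
  ∫ u in (0 : ℝ)..1, Real.sin (K * u) * Bd h (s - u)

theorem integral_sin_add {φ : ℝ → ℝ} (hφ : IntervalIntegrable φ volume 0 1) (K α : ℝ) :
    ∫ u in (0 : ℝ)..1, Real.sin (K * (α + 1 * u)) * φ u
      = Real.sin (K * α) * (∫ u in (0 : ℝ)..1, Real.cos (K * u) * φ u)
        + Real.cos (K * α) * ∫ u in (0 : ℝ)..1, Real.sin (K * u) * φ u := by
  have h1 : IntervalIntegrable (fun u => Real.cos (K * u) * φ u) volume 0 1 :=
    hφ.continuousOn_mul (by fun_prop)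
  have h2 : IntervalIntegrable (fun u => Real.sin (K * u) * φ u) volume 0 1 :=
    hφ.continuousOn_mul (by fun_prop)
  rw [← intervalIntegral.integral_const_mul, ← intervalIntegral.integral_const_mul,
    ← intervalIntegral.integral_add (h1.const_mul _) (h2.const_mul _)]
  congr 1; ext u
  rw [one_mul, mul_add, Real.sin_add]; ring

theorem integral_sin_sub {φ : ℝ → ℝ} (hφ : IntervalIntegrable φ volume 0 1) (K α : ℝ) :
    ∫ u in (0 : ℝ)..1, Real.sin (K * (α + (-1) * u)) * φ u
      = Real.sin (K * α) * (∫ u in (0 : ℝ)..1, Real.cos (K * u) * φ u)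
        - Real.cos (K * α) * ∫ u in (0 : ℝ)..1, Real.sin (K * u) * φ u := by
  have h1 : IntervalIntegrable (fun u => Real.cos (K * u) * φ u) volume 0 1 :=
    hφ.continuousOn_mul (by fun_prop)
  have h2 : IntervalIntegrable (fun u => Real.sin (K * u) * φ u) volume 0 1 :=
    hφ.continuousOn_mul (by fun_prop)
  rw [← intervalIntegral.integral_const_mul, ← intervalIntegral.integral_const_mul,
    ← intervalIntegral.integral_sub (h1.const_mul _) (h2.const_mul _)]
  congr 1; ext u
  have : K * (α + -1 * u) = K * α - K * u := by ring
  rw [this, Real.sin_sub]; ring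

namespace IsSwitchingProfile

variable {h : ℝ → ℝ} (hh : IsSwitchingProfile h)
include hh

/-- Since `B' = 0` before the formation, integrals against `B'(s - u)` over `0 ≤ u ≤ 1` only see
`u ≤ s`. -/
theorem integral_mul_Bd_sub {f : ℝ → ℝ} (hf : Continuous f) {s : ℝ} (h0 : 0 ≤ s) (h1 : s < 1) :
    ∫ u in (0 : ℝ)..1, f u * Bd h (s - u) = ∫ z in (0 : ℝ)..s, f (s - z) * Bd h z := by
  have hc : ContinuousOn (fun u => f u * Bd h (s - u)) (Ici 0) := by
    refine hf.continuousOn.mul (hh.continuousOn_Bd.comp (by fun_prop) fun u hu => ?_)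
    have : (0 : ℝ) ≤ u := hu
    exact mem_Iio.2 (by linarith)
  have hi : ∀ a b : ℝ, 0 ≤ a → a ≤ b → IntervalIntegrable (fun u => f u * Bd h (s - u)) volume a b :=
    fun a b ha hab => (hc.mono (by
      rw [uIcc_of_le hab]; exact fun x hx => ha.trans hx.1)).intervalIntegrable
  rw [← intervalIntegral.integral_add_adjacent_intervals (hi 0 s le_rfl h0) (hi s 1 h0 h1.le)]
  have h2 : ∫ u in s..1, f u * Bd h (s - u) = ∫ u in s..1, (0 : ℝ) := by
    refine intervalIntegral.integral_congr fun u hu => ?_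
    rw [uIcc_of_le h1.le] at hu
    rw [hh.Bd_of_nonpos (by linarith [hu.1]), mul_zero]
  rw [h2, intervalIntegral.integral_zero, add_zero]
  have h3 := intervalIntegral.integral_comp_sub_left (a := 0) (b := s)
    (fun z => f (s - z) * Bd h z) s
  simp only [sub_sub_cancel, sub_self, sub_zero] at h3
  exact h3

theorem intervalIntegrable_mul_Bd {f : ℝ → ℝ} (hf : Continuous f) {s : ℝ} (h1 : s < 1) :
    IntervalIntegrable (fun z => f z * Bd h z) volume 0 s := by
  refine ContinuousOn.intervalIntegrable ?_
  exact hf.continuousOn.mul (hh.continuousOn_Bd.mono fun x hx =>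
    hx.2.trans_lt (max_lt one_pos h1))

theorem hasDerivAt_integral_mul_Bd {f : ℝ → ℝ} (hf : Continuous f) {s : ℝ} (h1 : s < 1) :
    HasDerivAt (fun s => ∫ z in (0 : ℝ)..s, f z * Bd h z) (f s * Bd h s) s := by
  have hc : ContinuousOn (fun z => f z * Bd h z) (Iio 1) := hf.continuousOn.mul hh.continuousOn_Bd
  exact intervalIntegral.integral_hasDerivAt_right (hh.intervalIntegrable_mul_Bd hf h1)
    (hc.stronglyMeasurableAtFilter isOpen_Iio s h1) (hc.continuousAt (isOpen_Iio.mem_nhds h1))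

theorem cosTr_eq (K : ℝ) {s : ℝ} (h0 : 0 ≤ s) (h1 : s < 1) :
    cosTr h K s = Real.cos (K * s) * (∫ z in (0 : ℝ)..s, Real.cos (K * z) * Bd h z)
      + Real.sin (K * s) * ∫ z in (0 : ℝ)..s, Real.sin (K * z) * Bd h z := by
  rw [cosTr, hh.integral_mul_Bd_sub (by fun_prop) h0 h1, ← intervalIntegral.integral_const_mul,
    ← intervalIntegral.integral_const_mul, ← intervalIntegral.integral_add
    ((hh.intervalIntegrable_mul_Bd (by fun_prop) h1).const_mul _)
    ((hh.intervalIntegrable_mul_Bd (by fun_prop) h1).const_mul _)]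
  congr 1; ext z
  rw [mul_sub, Real.cos_sub]; ring

theorem sinTr_eq (K : ℝ) {s : ℝ} (h0 : 0 ≤ s) (h1 : s < 1) :
    sinTr h K s = Real.sin (K * s) * (∫ z in (0 : ℝ)..s, Real.cos (K * z) * Bd h z)
      - Real.cos (K * s) * ∫ z in (0 : ℝ)..s, Real.sin (K * z) * Bd h z := by
  rw [sinTr, hh.integral_mul_Bd_sub (by fun_prop) h0 h1, ← intervalIntegral.integral_const_mul,
    ← intervalIntegral.integral_const_mul, ← intervalIntegral.integral_sub
    ((hh.intervalIntegrable_mul_Bd (by fun_prop) h1).const_mul _)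
    ((hh.intervalIntegrable_mul_Bd (by fun_prop) h1).const_mul _)]
  congr 1; ext z
  rw [mul_sub, Real.sin_sub]; ring

theorem continuous_B_min {s : ℝ} (hs : s < 1) : Continuous fun x => B h (min x s) :=
  hh.continuousOn_B.comp_continuous (by fun_prop) fun x => (min_le_right x s).trans_lt hs

theorem continuous_Bd_min {s : ℝ} (hs : s < 1) : Continuous fun x => Bd h (min x s) :=
  hh.continuousOn_Bd.comp_continuous (by fun_prop) fun x => (min_le_right x s).trans_lt hs

theorem continuousOn_correlation {s : ℝ} (h1 : s < 1) :
    ContinuousOn (Function.uncurry fun x u : ℝ => B h x * Bd h (x - u))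
      (Iic s ×ˢ Ici 0) := by
  refine ContinuousOn.mul (hh.continuousOn_B.comp continuousOn_fst fun p hp => ?_)
    (hh.continuousOn_Bd.comp (by fun_prop) fun p hp => ?_)
  · exact (mem_Iic.1 hp.1).trans_lt h1
  · have h2 : p.1 ≤ s := hp.1
    have h3 : (0 : ℝ) ≤ p.2 := hp.2
    exact mem_Iio.2 (by linarith)

theorem continuousOn_V {s : ℝ} (h0 : 0 ≤ s) (h1 : s < 1) : ContinuousOn (V h s) (Ici 0) := by
  have hc : Continuous fun u : ℝ => ∫ x in (0 : ℝ)..s, B h (min x s) * Bd h (min (x - u) s) := by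
    refine intervalIntegral.continuous_parametric_intervalIntegral_of_continuous' ?_ 0 s
    exact ((hh.continuous_B_min h1).comp continuous_snd).mul
      ((hh.continuous_Bd_min h1).comp (continuous_snd.sub continuous_fst))
  refine hc.continuousOn.congr fun u hu => ?_
  refine intervalIntegral.integral_congr fun x hx => ?_
  rw [uIcc_of_le h0] at hx
  have hu' : (0 : ℝ) ≤ u := hu
  rw [min_eq_left hx.2, min_eq_left (by linarith [hx.2])]

theorem continuousOn_B_sub {s : ℝ} (h1 : s < 1) : ContinuousOn (fun u => B h (s - u)) (Ici 0) := by
  refine hh.continuousOn_B.comp (by fun_prop) fun u hu => ?_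
  have : (0 : ℝ) ≤ u := hu
  exact mem_Iio.2 (by linarith)

theorem continuousOn_Bd_sub {s : ℝ} (h1 : s < 1) : ContinuousOn (fun u => Bd h (s - u)) (Ici 0) := by
  refine hh.continuousOn_Bd.comp (by fun_prop) fun u hu => ?_
  have : (0 : ℝ) ≤ u := hu
  exact mem_Iio.2 (by linarith)

theorem continuousOn_Xi {s : ℝ} (h0 : 0 ≤ s) (h1 : s < 1) : ContinuousOn (Xi h s) (Ici 0) :=
  ((continuousOn_const.mul (hh.continuousOn_B_sub h1)).sub continuousOn_const).sub
    (continuousOn_const.mul (hh.continuousOn_V h0 h1))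

omit hh in
theorem _root_.ContinuousOn.intervalIntegrable_zero_one {f : ℝ → ℝ} (hf : ContinuousOn f (Ici 0)) :
    IntervalIntegrable f volume 0 1 := by
  refine ContinuousOn.intervalIntegrable (hf.mono ?_)
  rw [uIcc_of_le zero_le_one]; exact fun x hx => hx.1

theorem intervalIntegrable_V {s : ℝ} (h0 : 0 ≤ s) (h1 : s < 1) :
    IntervalIntegrable (V h s) volume 0 1 := (hh.continuousOn_V h0 h1).intervalIntegrable_zero_one

theorem intervalIntegrable_beta {s : ℝ} (h1 : s < 1) :
    IntervalIntegrable (fun u => B h (s - u) - 1) volume 0 1 :=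
  ((hh.continuousOn_B_sub h1).sub continuousOn_const).intervalIntegrable_zero_one

theorem intervalIntegrable_Bd_sub {s : ℝ} (h1 : s < 1) :
    IntervalIntegrable (fun u => Bd h (s - u)) volume 0 1 :=
  (hh.continuousOn_Bd_sub h1).intervalIntegrable_zero_one

theorem hasDerivAt_trig (K : ℝ) {s : ℝ} (h1 : s < 1) :
    HasDerivAt (fun s => Real.cos (K * s) * (∫ z in (0 : ℝ)..s, Real.cos (K * z) * Bd h z)
      + Real.sin (K * s) * ∫ z in (0 : ℝ)..s, Real.sin (K * z) * Bd h z)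
      (-K * (Real.sin (K * s) * (∫ z in (0 : ℝ)..s, Real.cos (K * z) * Bd h z)
      - Real.cos (K * s) * ∫ z in (0 : ℝ)..s, Real.sin (K * z) * Bd h z) + Bd h s) s ∧
    HasDerivAt (fun s => Real.sin (K * s) * (∫ z in (0 : ℝ)..s, Real.cos (K * z) * Bd h z)
      - Real.cos (K * s) * ∫ z in (0 : ℝ)..s, Real.sin (K * z) * Bd h z)
      (K * (Real.cos (K * s) * (∫ z in (0 : ℝ)..s, Real.cos (K * z) * Bd h z)
      + Real.sin (K * s) * ∫ z in (0 : ℝ)..s, Real.sin (K * z) * Bd h z)) s := by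
  have ha := hh.hasDerivAt_integral_mul_Bd (f := fun z => Real.cos (K * z)) (by fun_prop) h1
  have hb := hh.hasDerivAt_integral_mul_Bd (f := fun z => Real.sin (K * z)) (by fun_prop) h1
  have hc : HasDerivAt (fun s : ℝ => Real.cos (K * s)) (-Real.sin (K * s) * (K * 1)) s :=
    ((hasDerivAt_id s).const_mul K).cos
  have hs : HasDerivAt (fun s : ℝ => Real.sin (K * s)) (Real.cos (K * s) * (K * 1)) s :=
    ((hasDerivAt_id s).const_mul K).sin
  have e := Real.sin_sq_add_cos_sq (K * s)
  constructor
  · refine ((hc.mul ha).add (hs.mul hb)).congr_deriv ?_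
    linear_combination Bd h s * e
  · refine ((hs.mul ha).sub (hc.mul hb)).congr_deriv ?_
    ring

/-- The squared modulus of the outgoing amplitude, `|B(s) - ∫₀ˢ e^{iK(s-z)} B'(z) dz|²`, as a sine
transform. -/
theorem sq_add_sq_eq (K : ℝ) {s : ℝ} (h0 : 0 ≤ s) (h1 : s < 1) :
    (B h s - cosTr h K s) ^ 2 + sinTr h K s ^ 2
      = 1 + 2 * K * ∫ u in (0 : ℝ)..1, Real.sin (K * u) * V h s u := by
  set C : ℝ → ℝ := fun s => Real.cos (K * s) * (∫ z in (0 : ℝ)..s, Real.cos (K * z) * Bd h z)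
      + Real.sin (K * s) * ∫ z in (0 : ℝ)..s, Real.sin (K * z) * Bd h z with hC
  set S : ℝ → ℝ := fun s => Real.sin (K * s) * (∫ z in (0 : ℝ)..s, Real.cos (K * z) * Bd h z)
      - Real.cos (K * s) * ∫ z in (0 : ℝ)..s, Real.sin (K * z) * Bd h z with hS
  have hd : ∀ x ∈ uIcc 0 s, HasDerivAt (fun x => (B h x - C x) ^ 2 + S x ^ 2)
      (2 * K * (B h x * S x)) x := fun x hx => by
    have hx1 : x < 1 := by
      rw [uIcc_of_le h0] at hx; exact hx.2.trans_lt h1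
    have hC' : HasDerivAt C (-K * S x + Bd h x) x := (hh.hasDerivAt_trig K hx1).1
    have hS' : HasDerivAt S (K * C x) x := (hh.hasDerivAt_trig K hx1).2
    refine ((((hh.hasDerivAt_B hx1).sub hC').pow 2).add (hS'.pow 2)).congr_deriv ?_
    simp
    ring
  have hcont : ContinuousOn (fun x => 2 * K * (B h x * S x)) (uIcc 0 s) := by
    intro x hx
    have hx1 : x < 1 := by
      rw [uIcc_of_le h0] at hx; exact hx.2.trans_lt h1
    have hS' : HasDerivAt S (K * C x) x := (hh.hasDerivAt_trig K hx1).2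
    exact (continuousAt_const.mul
      ((hh.hasDerivAt_B hx1).continuousAt.mul hS'.continuousAt)).continuousWithinAt
  have hint := intervalIntegral.integral_eq_sub_of_hasDerivAt hd hcont.intervalIntegrable
  have hz : (B h 0 - C 0) ^ 2 + S 0 ^ 2 = 1 := by simp [hC, hS, B_of_nonpos]
  have hswap : ∫ x in (0 : ℝ)..s, B h x * S x
      = ∫ u in (0 : ℝ)..1, Real.sin (K * u) * V h s u := by
    have e1 : ∫ x in (0 : ℝ)..s, B h x * S x
        = ∫ x in (0 : ℝ)..s, ∫ u in (0 : ℝ)..1, Real.sin (K * u) * (B h x * Bd h (x - u)) := by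
      refine intervalIntegral.integral_congr fun x hx => ?_
      rw [uIcc_of_le h0] at hx
      simp only [hS]
      rw [← hh.sinTr_eq K hx.1 (hx.2.trans_lt h1), sinTr, ← intervalIntegral.integral_const_mul]
      congr 1; ext u; ring
    rw [e1, intervalIntegral_swap_of_continuousOn h0 zero_le_one]
    · simp only [intervalIntegral.integral_const_mul, V]
    · exact ContinuousOn.mul (by fun_prop) ((hh.continuousOn_correlation h1).mono
        (prod_mono (fun x hx => hx.2) fun u hu => hu.1))
  rw [hh.cosTr_eq K h0 h1, hh.sinTr_eq K h0 h1]
  rw [intervalIntegral.integral_const_mul, hz, hswap] at hint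
  simp only [hC, hS] at hint
  linarith

variable {A y : ℝ}

theorem R_eq (K : ℝ) (hy0 : -A < y) (hy1 : y < 1 - A) :
    R h A K y = ((-Real.cos (K * y) + 2 * Real.sin (A * K) / B h (y + A) *
        (∫ z in (0 : ℝ)..(y + A), Real.sin (K * z) * Bd h z) : ℝ) : ℂ)
      + ((Real.sin (K * y) + 2 * Real.sin (A * K) / B h (y + A) *
        (∫ z in (0 : ℝ)..(y + A), Real.cos (K * z) * Bd h z) : ℝ) : ℂ) * Complex.I := by
  have hs0 : 0 ≤ y + A := by linarith
  have hs1 : y + A < 1 := by linarith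
  have hexp : ∀ z : ℝ, Complex.exp (-(Complex.I * K * z))
      = ((Real.cos (K * z) : ℝ) : ℂ) - ((Real.sin (K * z) : ℝ) : ℂ) * Complex.I := fun z => by
    have : -(Complex.I * K * z) = ((-(K * z) : ℝ) : ℂ) * Complex.I := by push_cast; ring
    rw [this, Complex.exp_mul_I, ← Complex.ofReal_cos, ← Complex.ofReal_sin, Real.cos_neg,
      Real.sin_neg]
    push_cast; ring
  have hofReal : ∀ {f : ℝ → ℝ}, Continuous f →
      IntervalIntegrable (fun z => ((f z * Bd h z : ℝ) : ℂ)) volume 0 (y + A) := fun {f} hf => by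
    refine ContinuousOn.intervalIntegrable (Complex.continuous_ofReal.comp_continuousOn
      (hf.continuousOn.mul (hh.continuousOn_Bd.mono fun z hz => ?_)))
    exact hz.2.trans_lt (max_lt one_pos hs1)
  have hint : ∫ z in (0 : ℝ)..(y + A),
      Complex.exp (-(Complex.I * K * z)) * ((deriv (B h) z : ℝ) : ℂ)
      = ((∫ z in (0 : ℝ)..(y + A), Real.cos (K * z) * Bd h z : ℝ) : ℂ)
        - ((∫ z in (0 : ℝ)..(y + A), Real.sin (K * z) * Bd h z : ℝ) : ℂ) * Complex.I := by
    rw [← intervalIntegral.integral_ofReal, ← intervalIntegral.integral_ofReal,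
      ← intervalIntegral.integral_mul_const, ← intervalIntegral.integral_sub]
    · refine intervalIntegral.integral_congr fun z hz => ?_
      rw [uIcc_of_le hs0] at hz
      rw [hh.deriv_B (hz.2.trans_lt hs1), hexp]
      push_cast; ring
    · exact hofReal (by fun_prop)
    · exact (hofReal (by fun_prop)).mul_const _
  rw [R, if_neg (not_le.2 hy0), if_pos hy1, hint, hexp]
  push_cast
  linear_combination (-2 * Complex.sin (↑A * ↑K) / ((B h (y + A) : ℝ) : ℂ) *
    ((∫ z in (0 : ℝ)..(y + A), Real.sin (K * z) * Bd h z : ℝ) : ℂ)) * Complex.I_sq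

theorem hasDerivAt_R (K : ℝ) (hy0 : -A < y) (hy1 : y < 1 - A) :
    HasDerivAt (fun x => R h A K x)
      (((K * Real.sin (K * y) + 2 * Real.sin (A * K) * rate h (y + A) * (Real.sin (K * (y + A)) -
        (∫ z in (0 : ℝ)..(y + A), Real.sin (K * z) * Bd h z) / B h (y + A)) : ℝ) : ℂ)
      + ((K * Real.cos (K * y) + 2 * Real.sin (A * K) * rate h (y + A) * (Real.cos (K * (y + A)) -
        (∫ z in (0 : ℝ)..(y + A), Real.cos (K * z) * Bd h z) / B h (y + A)) : ℝ) : ℂ)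
          * Complex.I) y := by
  have hs1 : y + A < 1 := by linarith
  have hev : (fun x => R h A K x) =ᶠ[𝓝 y] fun x =>
      ((-Real.cos (K * x) + 2 * Real.sin (A * K) / B h (x + A) *
        (∫ z in (0 : ℝ)..(x + A), Real.sin (K * z) * Bd h z) : ℝ) : ℂ)
      + ((Real.sin (K * x) + 2 * Real.sin (A * K) / B h (x + A) *
        (∫ z in (0 : ℝ)..(x + A), Real.cos (K * z) * Bd h z) : ℝ) : ℂ) * Complex.I := by
    filter_upwards [isOpen_Ioo.mem_nhds (⟨hy0, hy1⟩ : y ∈ Ioo (-A) (1 - A))] with x hx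
    exact hh.R_eq K hx.1 hx.2
  refine HasDerivAt.congr_of_eventuallyEq ?_ hev
  have hB0 := (hh.B_pos (y + A)).ne'
  have hB : HasDerivAt (fun x => B h (x + A)) (Bd h (y + A)) y :=
    (hh.hasDerivAt_B hs1).comp_add_const y A
  have hcos : HasDerivAt (fun s : ℝ => Real.cos (K * s)) (-Real.sin (K * y) * (K * 1)) y :=
    ((hasDerivAt_id y).const_mul K).cos
  have hsin : HasDerivAt (fun s : ℝ => Real.sin (K * s)) (Real.cos (K * y) * (K * 1)) y :=
    ((hasDerivAt_id y).const_mul K).sin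
  have ha := (hh.hasDerivAt_integral_mul_Bd (f := fun z => Real.cos (K * z)) (by fun_prop)
    hs1).comp_add_const y A
  have hb := (hh.hasDerivAt_integral_mul_Bd (f := fun z => Real.sin (K * z)) (by fun_prop)
    hs1).comp_add_const y A
  refine HasDerivAt.add (HasDerivAt.ofReal_comp ?_) ((HasDerivAt.ofReal_comp ?_).mul_const _)
  · refine (hcos.neg.add (((hasDerivAt_const y (2 * Real.sin (A * K))).div hB hB0).mul hb)).congr_deriv ?_
    simp only [Bd, Pi.div_apply]
    field_simp
    ring
  · refine (hsin.add (((hasDerivAt_const y (2 * Real.sin (A * K))).div hB hB0).mul ha)).congr_deriv ?_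
    simp only [Bd, Pi.div_apply]
    field_simp
    ring

end IsSwitchingProfile

/-! ### Exact value of `F` -/

/-- The weighted increment of the rate, `∫₀¹ B(s - u) (c(s) - c(s - u)) du / u` with
`c = B' / B`. -/
noncomputable def rateIncr (h : ℝ → ℝ) (s : ℝ) : ℝ :=
  ∫ u in (0 : ℝ)..1, B h (s - u) * (rate h s - rate h (s - u)) / u

/-- The antisymmetric correlation integrated against `1 / u`. -/
noncomputable def XiInt (h : ℝ → ℝ) (s : ℝ) : ℝ := ∫ u in (0 : ℝ)..1, Xi h s u / u

theorem intervalIntegrable_div_of_abs_le {f : ℝ → ℝ} {M : ℝ} (hf : ContinuousOn f (Ici 0))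
    (hM : ∀ u ∈ Ioc (0 : ℝ) 1, |f u| ≤ M * u) :
    IntervalIntegrable (fun u => f u / u) volume 0 1 := by
  rw [intervalIntegrable_iff_integrableOn_Ioc_of_le zero_le_one]
  refine Integrable.mono' (integrable_const M) ?_ ?_
  · exact (((hf.mono fun x hx => le_of_lt hx.1).div continuousOn_id fun x hx => ne_of_gt hx.1
      : ContinuousOn (fun u => f u / u) (Ioc 0 1))).aestronglyMeasurable measurableSet_Ioc
  · refine (ae_restrict_iff' measurableSet_Ioc).2 (Eventually.of_forall fun u hu => ?_)
    rw [Real.norm_eq_abs, abs_div, abs_of_pos hu.1, div_le_iff₀ hu.1]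
    exact hM u hu

theorem intervalIntegrable_div_affine {f : ℝ → ℝ} {α β : ℝ} (hf : ContinuousOn f (Ici 0))
    (hpos : ∀ u ∈ Icc (0 : ℝ) 1, 0 < α + β * u) :
    IntervalIntegrable (fun u => f u / (α + β * u)) volume 0 1 := by
  refine ContinuousOn.intervalIntegrable ?_
  rw [uIcc_of_le zero_le_one]
  exact (hf.mono fun x hx => hx.1).div (by fun_prop) fun u hu => (hpos u hu).ne'

theorem hasAbelIntegral_sinTransform_of_continuousOn {f : ℝ → ℝ} {α β : ℝ}
    (hf : ContinuousOn f (Ici 0)) (hpos : ∀ u ∈ Icc (0 : ℝ) 1, 0 < α + β * u) :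
    HasAbelIntegral (fun K => ∫ u in (0 : ℝ)..1, Real.sin (K * (α + β * u)) * f u)
      (∫ u in (0 : ℝ)..1, f u / (α + β * u)) :=
  hasAbelIntegral_sinTransform hf.intervalIntegrable_zero_one
    (fun u hu => hpos u (Ioc_subset_Icc_self hu)) (intervalIntegrable_div_affine hf hpos)

theorem hasImproperIntegral_sinTransform_of_continuousOn {f : ℝ → ℝ} {α β : ℝ} (hβ : β ≠ 0)
    (hf : ContinuousOn f (Ici 0)) (hpos : ∀ u ∈ Icc (0 : ℝ) 1, 0 < α + β * u) :
    HasImproperIntegral (fun K => ∫ u in (0 : ℝ)..1, Real.sin (K * (α + β * u)) * f u)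
      (∫ u in (0 : ℝ)..1, f u / (α + β * u)) :=
  hasImproperIntegral_sinTransform hβ hf.intervalIntegrable_zero_one
    (fun u hu => hpos u (Ioc_subset_Icc_self hu)) (intervalIntegrable_div_affine hf hpos)

namespace IsSwitchingProfile

variable {h : ℝ → ℝ} (hh : IsSwitchingProfile h)
include hh

theorem continuousOn_rate_sub {s : ℝ} (h1 : s < 1) :
    ContinuousOn (fun u => rate h (s - u)) (Ici 0) := by
  refine hh.continuousOn_rate.comp (by fun_prop) fun u hu => ?_
  have : (0 : ℝ) ≤ u := hu
  exact mem_Iio.2 (by linarith)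

theorem Xi_eq_integral {s u : ℝ} (h0 : 0 ≤ s) (h1 : s < 1) (hu : 0 ≤ u) :
    Xi h s u = ∫ x in (0 : ℝ)..s, B h x * B h (x - u) * (rate h x - rate h (x - u)) := by
  have hlt : ∀ x ∈ uIcc 0 s, x < 1 ∧ x - u < 1 := fun x hx => by
    rw [uIcc_of_le h0] at hx; exact ⟨hx.2.trans_lt h1, by linarith [hx.2]⟩
  have hsub : ContinuousOn (fun x : ℝ => x - u) (uIcc 0 s) := by fun_prop
  have c1 : ContinuousOn (fun x => Bd h x * B h (x - u)) (uIcc 0 s) :=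
    (hh.continuousOn_Bd.mono fun x hx => (hlt x hx).1).mul
      (hh.continuousOn_B.comp hsub fun x hx => (hlt x hx).2)
  have c2 : ContinuousOn (fun x => B h x * Bd h (x - u)) (uIcc 0 s) :=
    (hh.continuousOn_B.mono fun x hx => (hlt x hx).1).mul
      (hh.continuousOn_Bd.comp hsub fun x hx => (hlt x hx).2)
  have hftc := intervalIntegral.integral_eq_sub_of_hasDerivAt
    (f := fun x => B h x * B h (x - u))
    (f' := fun x => Bd h x * B h (x - u) + B h x * Bd h (x - u))
    (fun x hx => (hh.hasDerivAt_B (hlt x hx).1).mul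
      ((hh.hasDerivAt_B (hlt x hx).2).comp_sub_const x u))
    (c1.add c2).intervalIntegrable
  rw [intervalIntegral.integral_add c1.intervalIntegrable c2.intervalIntegrable] at hftc
  have hB0 : B h 0 = 1 := B_of_nonpos le_rfl
  have hBu : B h (0 - u) = 1 := B_of_nonpos (by linarith)
  rw [hB0, hBu] at hftc
  have e : ∫ x in (0 : ℝ)..s, B h x * B h (x - u) * (rate h x - rate h (x - u))
      = (∫ x in (0 : ℝ)..s, Bd h x * B h (x - u)) - ∫ x in (0 : ℝ)..s, B h x * Bd h (x - u) := by
    rw [← intervalIntegral.integral_sub c1.intervalIntegrable c2.intervalIntegrable]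
    congr 1; ext x; simp only [Bd]; ring
  rw [e, Xi, V]
  linarith

/-- All densities that get divided by `u` are of order `u`, uniformly for `s` away from `1`. -/
theorem exists_abs_Xi_le {s₁ : ℝ} (h1 : s₁ < 1) : ∃ M : ℝ, 0 ≤ M ∧ ∀ s ∈ Icc (0 : ℝ) s₁,
    ∀ u ∈ Ioc (0 : ℝ) 1, |Xi h s u| ≤ M * u ∧
      |B h (s - u) * (rate h s - rate h (s - u))| ≤ M * u ∧
      |B h s * B h (s - u) * (rate h s - rate h (s - u))| ≤ M * u := by
  obtain ⟨M, hM0, hM⟩ := hh.exists_rate_lipschitz h1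
  have hB : ∀ x : ℝ, x ≤ s₁ → |B h x| ≤ B h s₁ := fun x hx => by
    rw [abs_of_pos (hh.B_pos x)]
    exact hh.monotoneOn_B (hx.trans_lt h1) h1 hx
  have hB1 := hh.one_le_B h1
  have hr : ∀ x ∈ Icc (0 : ℝ) s₁, ∀ u ∈ Ioc (0 : ℝ) 1,
      |rate h x - rate h (x - u)| ≤ M * u := fun x hx u hu => by
    have := hM x ⟨by linarith [hx.1], hx.2⟩ (x - u)
      ⟨by linarith [hx.1, hu.2], by linarith [hx.2, hu.1]⟩
    rwa [sub_sub_cancel, abs_of_pos hu.1] at this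
  have hp : ∀ x ∈ Icc (0 : ℝ) s₁, ∀ u ∈ Ioc (0 : ℝ) 1,
      |B h x * B h (x - u) * (rate h x - rate h (x - u))| ≤ B h s₁ ^ 2 * M * u :=
    fun x hx u hu => by
      rw [abs_mul, abs_mul]
      calc _ ≤ (B h s₁ * B h s₁) * (M * u) :=
            mul_le_mul (mul_le_mul (hB x hx.2) (hB _ (by linarith [hx.2, hu.1])) (abs_nonneg _)
              (by linarith)) (hr x hx u hu) (abs_nonneg _) (by positivity)
        _ = _ := by ring
  refine ⟨B h s₁ ^ 2 * M, by positivity, fun s hs u hu => ⟨?_, ?_, hp s hs u hu⟩⟩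
  · rw [hh.Xi_eq_integral hs.1 (hs.2.trans_lt h1) hu.1.le]
    have := intervalIntegral.norm_integral_le_of_norm_le_const (a := 0) (b := s)
      (f := fun x => B h x * B h (x - u) * (rate h x - rate h (x - u))) (C := B h s₁ ^ 2 * M * u)
      (fun x hx => by
        rw [uIoc_of_le hs.1] at hx
        exact hp x ⟨hx.1.le, hx.2.trans hs.2⟩ u hu)
    rw [Real.norm_eq_abs, sub_zero, abs_of_nonneg hs.1] at this
    refine this.trans (mul_le_of_le_one_right ?_ (hs.2.trans h1.le))
    have := hu.1
    positivity
  · rw [abs_mul]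
    calc _ ≤ B h s₁ * (M * u) :=
          mul_le_mul (hB _ (by linarith [hs.2, hu.1])) (hr s hs u hu) (abs_nonneg _) (by linarith)
      _ ≤ _ := by
          have := hu.1
          rw [pow_two, mul_assoc, mul_assoc]
          refine le_mul_of_one_le_left (by positivity) hB1

theorem intervalIntegrable_Xi_div {s : ℝ} (h0 : 0 ≤ s) (h1 : s < 1) :
    IntervalIntegrable (fun u => Xi h s u / u) volume 0 1 := by
  obtain ⟨M, -, hM⟩ := hh.exists_abs_Xi_le h1
  exact intervalIntegrable_div_of_abs_le (hh.continuousOn_Xi h0 h1)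
    fun u hu => (hM s ⟨h0, le_rfl⟩ u hu).1

theorem continuousOn_incr {s : ℝ} (h1 : s < 1) :
    ContinuousOn (fun u => B h (s - u) * (rate h s - rate h (s - u))) (Ici 0) :=
  (hh.continuousOn_B_sub h1).mul (continuousOn_const.sub (hh.continuousOn_rate_sub h1))

theorem intervalIntegrable_incr_div {s : ℝ} (h0 : 0 ≤ s) (h1 : s < 1) :
    IntervalIntegrable (fun u => B h (s - u) * (rate h s - rate h (s - u)) / u) volume 0 1 := by
  obtain ⟨M, -, hM⟩ := hh.exists_abs_Xi_le h1
  exact intervalIntegrable_div_of_abs_le (hh.continuousOn_incr h1)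
    fun u hu => (hM s ⟨h0, le_rfl⟩ u hu).2.1

variable {A y w : ℝ}

/-- The integrand of `F` in terms of the sine and cosine transforms. -/
theorem FIntegrand_eq {K : ℝ} (hK : 0 < K) (hy0 : -A < y) (hy1 : y < 1 - A) :
    FIntegrand h A y K =
      2 * rate h (y + A) * Real.sin (2 * A * K) * (1 - cosTr h K (y + A) / B h (y + A))
      - 4 * Real.sin (A * K) ^ 2 * (rate h (y + A) / B h (y + A)) * sinTr h K (y + A)
      + 4 * Real.sin (A * K) ^ 2 * (rate h (y + A) / B h (y + A)) ^ 2 *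
        (1 / K + 2 * ∫ u in (0 : ℝ)..1, Real.sin (K * u) * V h (y + A) u) := by
  have hs0 : 0 ≤ y + A := by linarith
  have hs1 : y + A < 1 := by linarith
  have hen := hh.sq_add_sq_eq K hs0 hs1
  have hB0 := (hh.B_pos (y + A)).ne'
  rw [FIntegrand, (hh.hasDerivAt_R K hy0 hy1).deriv, Complex.sq_norm, Complex.normSq_add_mul_I]
  rw [hh.cosTr_eq K hs0 hs1, hh.sinTr_eq K hs0 hs1] at hen ⊢
  set a := ∫ z in (0 : ℝ)..(y + A), Real.cos (K * z) * Bd h z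
  set b := ∫ z in (0 : ℝ)..(y + A), Real.sin (K * z) * Bd h z
  set I₁ := ∫ u in (0 : ℝ)..1, Real.sin (K * u) * V h (y + A) u
  set b₀ := B h (y + A)
  set c := rate h (y + A)
  have e1 : Real.sin (2 * A * K) = 2 * Real.sin (A * K) * Real.cos (A * K) := by
    rw [mul_assoc, Real.sin_two_mul]
  have e2 : Real.sin (K * y) = Real.sin (K * (y + A)) * Real.cos (A * K)
      - Real.cos (K * (y + A)) * Real.sin (A * K) := by
    rw [← Real.sin_sub]; ring_nf
  have e3 : Real.cos (K * y) = Real.cos (K * (y + A)) * Real.cos (A * K)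
      + Real.sin (K * (y + A)) * Real.sin (A * K) := by
    rw [← Real.cos_sub]; ring_nf
  have p1 := Real.sin_sq_add_cos_sq (K * (y + A))
  have p2 := Real.sin_sq_add_cos_sq (A * K)
  rw [e1, e2, e3]
  set σ := Real.sin (K * (y + A))
  set κ := Real.cos (K * (y + A))
  set S := Real.sin (A * K)
  set C := Real.cos (A * K)
  have hen' : 1 / K + 2 * I₁ = ((b₀ - (κ * a + σ * b)) ^ 2 + (σ * a - κ * b) ^ 2) / K := by
    rw [hen]; field_simp
  rw [hen']
  field_simp
  have q1 : κ ^ 2 = 1 - σ ^ 2 := by linarith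
  have q2 : C ^ 2 = 1 - S ^ 2 := by linarith
  ring_nf
  simp only [q1, q2]
  ring

/-- The value of `F(y)`: the terms not written as logarithms come from the sine transforms of the
correlations of `B`. -/
theorem hasAbelIntegral_FIntegrand (hA : 1 < A) (hy0 : -A < y) (hy1 : y < 1 - A) :
    HasAbelIntegral (FIntegrand h A y)
      (2 * (rate h (y + A) / B h (y + A) * rateIncr h (y + A)
          - (rate h (y + A) / B h (y + A)) ^ 2 * XiInt h (y + A))
        + 2 * (rate h (y + A) / B h (y + A)) ^ 2 * Real.log (2 * A)
        + 2 * (rate h (y + A) / B h (y + A)) ^ 2 *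
          ((∫ u in (0 : ℝ)..1, V h (y + A) u / (2 * A + (-1) * u))
            - ∫ u in (0 : ℝ)..1, V h (y + A) u / (2 * A + 1 * u))
        - 2 * (rate h (y + A) / B h (y + A)) *
          (∫ u in (0 : ℝ)..1, Bd h (y + A - u) / (2 * A + (-1) * u))
        + rate h (y + A) / A) := by
  have hs0 : 0 ≤ y + A := by linarith
  have hs1 : y + A < 1 := by linarith
  set s := y + A with hs
  set b₀ := B h s with hb₀
  set c := rate h s with hc
  have hB0 : b₀ ≠ 0 := (hh.B_pos s).ne'
  -- The terms with phase `u` are collected in `η`, which is of order `u` at `0`: one by one they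
  -- would diverge against `1 / u`. A term `1 / K` is absorbed through
  -- `∫₀¹ sin (K u) du = (1 - cos K) / K`, which leaves cosine differences with `p = 1`.
  set η : ℝ → ℝ := fun u => (c / b₀) * (B h (s - u) * (c - rate h (s - u)))
    - (c / b₀) ^ 2 * Xi h s u with hη
  have hηc : ContinuousOn η (Ici 0) :=
    (continuousOn_const.mul (hh.continuousOn_incr hs1)).sub
      (continuousOn_const.mul (hh.continuousOn_Xi hs0 hs1))
  have hηe : ∀ u, η u = 2 * (c / b₀) ^ 2 * V h s u - c / b₀ * Bd h (s - u)
      + (c / b₀) ^ 2 := fun u => by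
    simp only [hη, Xi, Bd, ← hb₀]
    field_simp
    ring
  have hηd : (fun u => η u / u) = fun u => c / b₀ * (B h (s - u) * (c - rate h (s - u)) / u)
      - (c / b₀) ^ 2 * (Xi h s u / u) := by
    ext u; simp only [hη]; ring
  have i1 := hh.intervalIntegrable_incr_div hs0 hs1
  have i2 := hh.intervalIntegrable_Xi_div hs0 hs1
  have hηi : IntervalIntegrable (fun u => η u / u) volume 0 1 := by
    rw [hηd]; exact (i1.const_mul _).sub (i2.const_mul _)
  have hηint : ∫ u in (0 : ℝ)..1, η u / u = c / b₀ * rateIncr h s - (c / b₀) ^ 2 * XiInt h s := by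
    rw [hηd, intervalIntegral.integral_sub (i1.const_mul _) (i2.const_mul _),
      intervalIntegral.integral_const_mul, intervalIntegral.integral_const_mul, rateIncr, XiInt]
  have t1 : HasAbelIntegral (fun K => ∫ u in (0 : ℝ)..1, Real.sin (K * (0 + 1 * u)) * η u)
      (∫ u in (0 : ℝ)..1, η u / u) := by
    have := hasAbelIntegral_sinTransform (α := 0) (β := 1) hηc.intervalIntegrable_zero_one
      (fun u hu => by simpa using hu.1) (by simpa using hηi)
    simpa using this
  have hm : ∀ u ∈ Icc (0 : ℝ) 1, 0 < 2 * A + (-1) * u := fun u hu => by linarith [hu.2]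
  have hp : ∀ u ∈ Icc (0 : ℝ) 1, 0 < 2 * A + 1 * u := fun u hu => by linarith [hu.1]
  have t2 := hasAbelIntegral_cos_sub_cos (p := 1) (q := 2 * A) one_pos (by linarith)
  have t3 := hasAbelIntegral_sinTransform_of_continuousOn (hh.continuousOn_V hs0 hs1) hm
  have t4 := hasAbelIntegral_sinTransform_of_continuousOn (hh.continuousOn_V hs0 hs1) hp
  have t5 := hasAbelIntegral_sinTransform_of_continuousOn (hh.continuousOn_Bd_sub hs1) hm
  have t6 := hasAbelIntegral_sin (x := 2 * A) (by linarith)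
  have T := ((((t1.const_mul 2).add (t2.const_mul (2 * (c / b₀) ^ 2))).add
    ((t3.add (t4.const_mul (-1))).const_mul (2 * (c / b₀) ^ 2))).add
    (t5.const_mul (-(2 * (c / b₀))))).add (t6.const_mul (2 * c))
  have T' := T.congr (g := FIntegrand h A y) fun K hK => ?_
  · convert T' using 1
    rw [hηint]
    simp only [div_one]
    field_simp
    ring
  · rw [hh.FIntegrand_eq hK hy0 hy1, ← hs, ← hb₀, ← hc]
    rw [integral_sin_add hηc.intervalIntegrable_zero_one,
      integral_sin_sub (hh.intervalIntegrable_V hs0 hs1),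
      integral_sin_add (hh.intervalIntegrable_V hs0 hs1),
      integral_sin_sub (hh.intervalIntegrable_Bd_sub hs1)]
    have hsv : IntervalIntegrable (fun u => Real.sin (K * u) * V h s u) volume 0 1 :=
      (hh.intervalIntegrable_V hs0 hs1).continuousOn_mul (by fun_prop)
    have hsb : IntervalIntegrable (fun u => Real.sin (K * u) * Bd h (s - u)) volume 0 1 :=
      (hh.intervalIntegrable_Bd_sub hs1).continuousOn_mul (by fun_prop)
    have hsone : ∫ u in (0 : ℝ)..1, Real.sin (K * u) = (1 - Real.cos K) / K := by
      rw [intervalIntegral.integral_comp_mul_left (fun t => Real.sin t) hK.ne', integral_sin]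
      simp; field_simp
    have hse : ∫ u in (0 : ℝ)..1, Real.sin (K * u) * η u
        = 2 * (c / b₀) ^ 2 * (∫ u in (0 : ℝ)..1, Real.sin (K * u) * V h s u)
          - c / b₀ * (∫ u in (0 : ℝ)..1, Real.sin (K * u) * Bd h (s - u))
          + (c / b₀) ^ 2 * ((1 - Real.cos K) / K) := by
      rw [← hsone, ← intervalIntegral.integral_const_mul, ← intervalIntegral.integral_const_mul,
        ← intervalIntegral.integral_const_mul, ← intervalIntegral.integral_sub (hsv.const_mul _)
        (hsb.const_mul _), ← intervalIntegral.integral_add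
        ((hsv.const_mul _).sub (hsb.const_mul _))
        ((Continuous.intervalIntegrable (by fun_prop) _ _))]
      congr 1; ext u
      rw [hηe]; ring
    rw [hse]
    change _ = 2 * (Real.sin (K * 0) * _ + _) + _ + _ + _ * (_ * cosTr h K s - _ * sinTr h K s) + _
    change _ = 2 * (_ + _ * (_ - _ * sinTr h K s + _)) + _ + _ + _ + _
    have e1 : Real.sin (A * K) ^ 2 = (1 - Real.cos (K * (2 * A))) / 2 := by
      rw [show K * (2 * A) = 2 * (A * K) by ring, Real.cos_two_mul, Real.cos_sq']; ring
    have e2 : Real.sin (2 * A * K) = Real.sin (K * (2 * A)) := by ring_nf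
    rw [e1, e2, mul_zero, Real.sin_zero, Real.cos_zero, mul_one]
    field_simp
    ring

end IsSwitchingProfile

/-! ### Exact values of `𝒢_out` -/

/-- The value of `𝒢_out` in the intermediate region as a function of `s = y + A` and
`d = w - y - A`. -/
noncomputable def goutValue (h : ℝ → ℝ) (A s d : ℝ) : ℝ :=
  -2 * (XiInt h s / B h s ^ 2) - 2 * ((B h s - 1) / B h s ^ 2) * Real.log (2 * A)
    + 2 * ((∫ u in (0 : ℝ)..1, V h s u / (2 * A + (-1) * u))
        - ∫ u in (0 : ℝ)..1, V h s u / (2 * A + 1 * u)) / B h s ^ 2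
    + 2 * ((∫ u in (0 : ℝ)..1, (B h (s - u) - 1) / (2 * A + 1 * u))
        + (∫ u in (0 : ℝ)..1, (B h (s - u) - 1) / (d - A + 1 * u))
        - ∫ u in (0 : ℝ)..1, (B h (s - u) - 1) / (d + A + 1 * u)) / B h s
    - 2 * ((B h s - 1) / B h s) * Real.log ((d + A) / (d - A))

theorem exp_neg_I_mul (K z : ℝ) : Complex.exp (-(Complex.I * K * z))
    = ((Real.cos (K * z) : ℝ) : ℂ) + ((-Real.sin (K * z) : ℝ) : ℂ) * Complex.I := by
  have : -(Complex.I * K * z) = ((-(K * z) : ℝ) : ℂ) * Complex.I := by push_cast; ring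
  rw [this, Complex.exp_mul_I, ← Complex.ofReal_cos, ← Complex.ofReal_sin, Real.cos_neg,
    Real.sin_neg]

theorem sq_norm_add_mul_I (a b : ℝ) : ‖(a : ℂ) + (b : ℂ) * Complex.I‖ ^ 2 = a ^ 2 + b ^ 2 := by
  rw [Complex.sq_norm, Complex.normSq_add_mul_I]

/-- In the late region the wall is a mirror, and `𝒢_out` is an explicit logarithm. -/
theorem hasImproperIntegral_GoutIntegrand_late {h : ℝ → ℝ} {A y w : ℝ} (hA : 1 < A)
    (hy : 1 - A ≤ y) (hw : y + 2 * A < w) :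
    HasImproperIntegral (GoutIntegrand h A y w)
      (2 * Real.log ((w - y - 2 * A) / (w - y))) := by
  have h1 := (hasImproperIntegral_cos_sub_cos (p := w - y - 2 * A) (q := w - y) (by linarith)
    (by linarith) (by linarith)).const_mul (-2)
  have e : -2 * Real.log ((w - y) / (w - y - 2 * A))
      = 2 * Real.log ((w - y - 2 * A) / (w - y)) := by
    rw [← inv_div, Real.log_inv]; ring
  rw [e] at h1
  refine h1.congr fun K _ => ?_
  have hR : R h A K y = -Complex.exp (-(Complex.I * K * ((y + 2 * A : ℝ) : ℂ))) := by
    rw [R, if_neg (by linarith), if_neg (by linarith)]; push_cast; rfl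
  have n1 : ∀ v : ℝ, ‖Complex.exp (-(Complex.I * K * w)) - Complex.exp (-(Complex.I * K * v))‖ ^ 2
      = 2 - 2 * Real.cos (K * (w - v)) := fun v => by
    have : Complex.exp (-(Complex.I * K * w)) - Complex.exp (-(Complex.I * K * v))
        = ((Real.cos (K * w) - Real.cos (K * v) : ℝ) : ℂ)
          + ((-Real.sin (K * w) + Real.sin (K * v) : ℝ) : ℂ) * Complex.I := by
      rw [exp_neg_I_mul, exp_neg_I_mul]; push_cast; ring
    rw [this, sq_norm_add_mul_I, mul_sub, Real.cos_sub]
    linear_combination Real.sin_sq_add_cos_sq (K * w) + Real.sin_sq_add_cos_sq (K * v)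
  rw [GoutIntegrand, hR, ← sub_eq_add_neg, n1, n1]
  ring_nf

namespace IsSwitchingProfile

variable {h : ℝ → ℝ} (hh : IsSwitchingProfile h) {A y w : ℝ}
include hh

/-- Integration by parts replaces `B'` by `B - 1`; the factor `K` gained cancels the `1 / K` of the
frequency integral of `𝒢_out`. -/
theorem transforms_by_parts (K : ℝ) {s : ℝ} (h1 : s < 1) :
    cosTr h K s = (B h s - 1) - K * ∫ u in (0 : ℝ)..1, Real.sin (K * u) * (B h (s - u) - 1) ∧
    sinTr h K s = K * ∫ u in (0 : ℝ)..1, Real.cos (K * u) * (B h (s - u) - 1) := by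
  have hβ : ∀ u ∈ uIcc (0 : ℝ) 1, HasDerivAt (fun u => B h (s - u) - 1) (-Bd h (s - u)) u :=
    fun u hu => by
      rw [uIcc_of_le zero_le_one] at hu
      have : HasDerivAt (fun u => B h (s - u)) (-Bd h (s - u)) u := by
        simpa using (hh.hasDerivAt_B (z := s - u) (by linarith [hu.1])).comp_const_sub s u
      exact this.sub_const 1
  have hc : ∀ u : ℝ, HasDerivAt (fun s : ℝ => Real.cos (K * s)) (-Real.sin (K * u) * (K * 1)) u :=
    fun u => ((hasDerivAt_id u).const_mul K).cos
  have hs : ∀ u : ℝ, HasDerivAt (fun s : ℝ => Real.sin (K * s)) (Real.cos (K * u) * (K * 1)) u :=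
    fun u => ((hasDerivAt_id u).const_mul K).sin
  have i0 : IntervalIntegrable (fun u => -Bd h (s - u)) volume 0 1 :=
    (hh.intervalIntegrable_Bd_sub h1).neg
  have b1 : B h (s - 1) = 1 := B_of_nonpos (by linarith)
  have k1 := intervalIntegral.integral_mul_deriv_eq_deriv_mul (fun u _ => hc u) hβ
    (Continuous.intervalIntegrable (by fun_prop) _ _) i0
  have k2 := intervalIntegral.integral_mul_deriv_eq_deriv_mul (fun u _ => hs u) hβ
    (Continuous.intervalIntegrable (by fun_prop) _ _) i0
  simp only [mul_neg, intervalIntegral.integral_neg, b1, sub_self, mul_zero, Real.cos_zero,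
    sub_zero, one_mul, Real.sin_zero, zero_mul] at k1 k2
  have e1 : ∀ u : ℝ, -Real.sin (K * u) * (K * 1) * (B h (s - u) - 1)
      = -K * (Real.sin (K * u) * (B h (s - u) - 1)) := fun u => by ring
  have e2 : ∀ u : ℝ, Real.cos (K * u) * (K * 1) * (B h (s - u) - 1)
      = K * (Real.cos (K * u) * (B h (s - u) - 1)) := fun u => by ring
  simp only [e1, e2, intervalIntegral.integral_const_mul] at k1 k2
  constructor
  · rw [cosTr]; linarith
  · rw [sinTr]; linarith

theorem GoutIntegrand_eq (K : ℝ) (hy0 : -A < y) (hy1 : y < 1 - A) :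
    GoutIntegrand h A y w K =
      (4 * Real.sin (A * K) ^ 2 / B h (y + A) ^ 2 * (cosTr h K (y + A) ^ 2 + sinTr h K (y + A) ^ 2)
        - 4 * Real.sin (A * K) / B h (y + A) *
          (sinTr h K (y + A) * (Real.cos (K * (w - (y + A))) - Real.cos (A * K))
            + cosTr h K (y + A) * (Real.sin (K * (w - (y + A))) + Real.sin (A * K)))) / K := by
  have hs0 : 0 ≤ y + A := by linarith
  have hs1 : y + A < 1 := by linarith
  have hB0 := (hh.B_pos (y + A)).ne'
  rw [GoutIntegrand, hh.R_eq K hy0 hy1, hh.cosTr_eq K hs0 hs1, hh.sinTr_eq K hs0 hs1,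
    exp_neg_I_mul, exp_neg_I_mul]
  set a := ∫ z in (0 : ℝ)..(y + A), Real.cos (K * z) * Bd h z
  set b := ∫ z in (0 : ℝ)..(y + A), Real.sin (K * z) * Bd h z
  set b₀ := B h (y + A)
  congr 1
  have e1 : ∀ p q r t : ℝ, ((p : ℂ) + (q : ℂ) * Complex.I) + ((r : ℂ) + (t : ℂ) * Complex.I)
      = ((p + r : ℝ) : ℂ) + ((q + t : ℝ) : ℂ) * Complex.I := fun p q r t => by push_cast; ring
  have e2 : ∀ p q r t : ℝ, ((p : ℂ) + (q : ℂ) * Complex.I) - ((r : ℂ) + (t : ℂ) * Complex.I)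
      = ((p - r : ℝ) : ℂ) + ((q - t : ℝ) : ℂ) * Complex.I := fun p q r t => by push_cast; ring
  rw [e1, e2, sq_norm_add_mul_I, sq_norm_add_mul_I]
  have f2 : Real.sin (K * y) = Real.sin (K * (y + A)) * Real.cos (A * K)
      - Real.cos (K * (y + A)) * Real.sin (A * K) := by
    rw [← Real.sin_sub]; ring_nf
  have f3 : Real.cos (K * y) = Real.cos (K * (y + A)) * Real.cos (A * K)
      + Real.sin (K * (y + A)) * Real.sin (A * K) := by
    rw [← Real.cos_sub]; ring_nf
  have f4 : Real.sin (K * w) = Real.sin (K * (y + A)) * Real.cos (K * (w - (y + A)))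
      + Real.cos (K * (y + A)) * Real.sin (K * (w - (y + A))) := by
    rw [← Real.sin_add]; ring_nf
  have f5 : Real.cos (K * w) = Real.cos (K * (y + A)) * Real.cos (K * (w - (y + A)))
      - Real.sin (K * (y + A)) * Real.sin (K * (w - (y + A))) := by
    rw [← Real.cos_add]; ring_nf
  have p1 := Real.sin_sq_add_cos_sq (K * (y + A))
  rw [f2, f3, f4, f5]
  set σ := Real.sin (K * (y + A))
  set κ := Real.cos (K * (y + A))
  set S := Real.sin (A * K)
  field_simp
  linear_combination (-(a ^ 2 + b ^ 2) * 4 * S ^ 2) * p1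

/-- The value of `𝒢_out` in the intermediate region. -/
theorem hasImproperIntegral_GoutIntegrand (hA : 1 < A) (hy0 : -A < y) (hy1 : y < 1 - A)
    (hw : y + 2 * A < w) :
    HasImproperIntegral (GoutIntegrand h A y w) (goutValue h A (y + A) (w - (y + A))) := by
  have hs0 : 0 ≤ y + A := by linarith
  have hs1 : y + A < 1 := by linarith
  have hd : A < w - (y + A) := by linarith
  set s := y + A with hs
  set d := w - s with hd'
  set b₀ := B h s with hb₀
  have hB0 : b₀ ≠ 0 := (hh.B_pos s).ne'
  have hβc : ContinuousOn (fun u => B h (s - u) - 1) (Ici 0) :=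
    (hh.continuousOn_B_sub hs1).sub continuousOn_const
  have hβi := hh.intervalIntegrable_beta hs1
  have hVi := hh.intervalIntegrable_V hs0 hs1
  have hXi := (hh.continuousOn_Xi hs0 hs1).intervalIntegrable_zero_one
  have t1 : HasImproperIntegral (fun K => ∫ u in (0 : ℝ)..1, Real.sin (K * (0 + 1 * u)) * Xi h s u)
      (XiInt h s) := by
    have := hasImproperIntegral_sinTransform (α := 0) (β := 1) one_ne_zero hXi
      (fun u hu => by simpa using hu.1) (by simpa using hh.intervalIntegrable_Xi_div hs0 hs1)
    simpa [XiInt] using this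
  have hm : ∀ u ∈ Icc (0 : ℝ) 1, 0 < 2 * A + (-1) * u := fun u hu => by linarith [hu.2]
  have hp : ∀ u ∈ Icc (0 : ℝ) 1, 0 < 2 * A + 1 * u := fun u hu => by linarith [hu.1]
  have hdm : ∀ u ∈ Icc (0 : ℝ) 1, 0 < d - A + 1 * u := fun u hu => by linarith [hu.1]
  have hdp : ∀ u ∈ Icc (0 : ℝ) 1, 0 < d + A + 1 * u := fun u hu => by linarith [hu.1]
  have t2 := hasImproperIntegral_cos_sub_cos (p := 1) (q := 2 * A) one_pos (by linarith)
    (by linarith)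
  have t3 := hasImproperIntegral_sinTransform_of_continuousOn (by norm_num)
    (hh.continuousOn_V hs0 hs1) hm
  have t4 := hasImproperIntegral_sinTransform_of_continuousOn (by norm_num)
    (hh.continuousOn_V hs0 hs1) hp
  have t5 := hasImproperIntegral_sinTransform_of_continuousOn (by norm_num) hβc hp
  have t6 := hasImproperIntegral_sinTransform_of_continuousOn (by norm_num) hβc hdm
  have t7 := hasImproperIntegral_sinTransform_of_continuousOn (by norm_num) hβc hdp
  have t8 := hasImproperIntegral_cos_sub_cos (p := d - A) (q := d + A) (by linarith) (by linarith)
    (by linarith)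
  have T := (((((t1.const_mul (-2 / b₀ ^ 2)).add (t2.const_mul (-2 * ((b₀ - 1) / b₀ ^ 2)))).add
    ((t3.add (t4.const_mul (-1))).const_mul (2 / b₀ ^ 2))).add
    ((t5.add (t6.add (t7.const_mul (-1)))).const_mul (2 / b₀)))).add
    (t8.const_mul (-2 * ((b₀ - 1) / b₀)))
  have T' := T.congr (g := GoutIntegrand h A y w) fun K hK => ?_
  · convert T' using 1
    rw [goutValue, ← hb₀]
    simp only [div_one]
    field_simp
    ring
  · rw [hh.GoutIntegrand_eq K hy0 hy1, ← hs, ← hb₀, ← hd']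
    rw [integral_sin_add hXi, integral_sin_sub hVi, integral_sin_add hVi, integral_sin_add hβi,
      integral_sin_add hβi, integral_sin_add hβi]
    have hsv : IntervalIntegrable (fun u => Real.sin (K * u) * V h s u) volume 0 1 :=
      hVi.continuousOn_mul (by fun_prop)
    have hsb : IntervalIntegrable (fun u => Real.sin (K * u) * (B h (s - u) - 1)) volume 0 1 :=
      hβi.continuousOn_mul (by fun_prop)
    have hsone : ∫ u in (0 : ℝ)..1, Real.sin (K * u) = (1 - Real.cos K) / K := by
      rw [intervalIntegral.integral_comp_mul_left (fun t => Real.sin t) hK.ne', integral_sin]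
      simp; field_simp
    have hse : ∫ u in (0 : ℝ)..1, Real.sin (K * u) * Xi h s u
        = b₀ * (∫ u in (0 : ℝ)..1, Real.sin (K * u) * (B h (s - u) - 1))
          + (b₀ - 1) * ((1 - Real.cos K) / K)
          - 2 * (∫ u in (0 : ℝ)..1, Real.sin (K * u) * V h s u) := by
      rw [← hsone, ← intervalIntegral.integral_const_mul, ← intervalIntegral.integral_const_mul,
        ← intervalIntegral.integral_const_mul, ← intervalIntegral.integral_add (hsb.const_mul _)
        ((Continuous.intervalIntegrable (by fun_prop) _ _)), ← intervalIntegral.integral_sub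
        ((hsb.const_mul _).add ((Continuous.intervalIntegrable (by fun_prop) _ _)))
        (hsv.const_mul _)]
      congr 1; ext u
      rw [Xi, ← hb₀]; ring
    have hen := hh.sq_add_sq_eq K hs0 hs1
    obtain ⟨hC, hS⟩ := hh.transforms_by_parts K hs1
    have hen' : cosTr h K s ^ 2 + sinTr h K s ^ 2
        = 1 + 2 * K * (∫ u in (0 : ℝ)..1, Real.sin (K * u) * V h s u) - b₀ ^ 2
          + 2 * b₀ * cosTr h K s := by
      rw [← hb₀] at hen; linear_combination hen
    rw [hen', hse, hC, hS, ← hb₀]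
    set I₁ := ∫ u in (0 : ℝ)..1, Real.sin (K * u) * V h s u
    set I₂ := ∫ u in (0 : ℝ)..1, Real.cos (K * u) * V h s u
    set J₁ := ∫ u in (0 : ℝ)..1, Real.sin (K * u) * (B h (s - u) - 1)
    set J₂ := ∫ u in (0 : ℝ)..1, Real.cos (K * u) * (B h (s - u) - 1)
    have e1 : Real.cos (K * (2 * A)) = 1 - 2 * Real.sin (A * K) ^ 2 := by
      rw [show K * (2 * A) = 2 * (A * K) by ring, Real.cos_two_mul, Real.cos_sq']; ring
    have e2 : Real.sin (K * (2 * A)) = 2 * Real.sin (A * K) * Real.cos (A * K) := by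
      rw [show K * (2 * A) = 2 * (A * K) by ring, Real.sin_two_mul]
    have e3 : K * (d - A) = K * d - A * K := by ring
    have e4 : K * (d + A) = K * d + A * K := by ring
    rw [e1, e2, e3, e4, mul_zero, Real.sin_zero, Real.cos_zero, mul_one, Real.cos_sub,
      Real.cos_add, Real.sin_sub, Real.sin_add]
    field_simp
    ring

end IsSwitchingProfile

/-! ### Differentiation of the position-space formulas -/

/-- Differentiation under the integral over `(0, 1]`, with a constant bound on the derivative. -/
theorem hasDerivAt_integral_Ioc {Φ Φ' : ℝ → ℝ → ℝ} {r₀ M : ℝ} {U : Set ℝ} (hU : U ∈ 𝓝 r₀)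
    (hc : ∀ r ∈ U, ContinuousOn (Φ r) (Ioc 0 1)) (hi : IntervalIntegrable (Φ r₀) volume 0 1)
    (hc' : ContinuousOn (Φ' r₀) (Ioc 0 1)) (hM : ∀ r ∈ U, ∀ u ∈ Ioc (0 : ℝ) 1, |Φ' r u| ≤ M)
    (hd : ∀ r ∈ U, ∀ u ∈ Ioc (0 : ℝ) 1, HasDerivAt (fun r => Φ r u) (Φ' r u) r) :
    HasDerivAt (fun r => ∫ u in (0 : ℝ)..1, Φ r u) (∫ u in (0 : ℝ)..1, Φ' r₀ u) r₀ := by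
  have hI : uIoc (0 : ℝ) 1 = Ioc 0 1 := uIoc_of_le zero_le_one
  refine (intervalIntegral.hasDerivAt_integral_of_dominated_loc_of_deriv_le (bound := fun _ => M)
    hU ?_ hi ?_ ?_ intervalIntegrable_const ?_).2
  · filter_upwards [hU] with r hr
    rw [hI]; exact (hc r hr).aestronglyMeasurable measurableSet_Ioc
  · rw [hI]; exact hc'.aestronglyMeasurable measurableSet_Ioc
  · rw [hI]; exact Eventually.of_forall fun u hu r hr => hM r hr u hu
  · rw [hI]; exact Eventually.of_forall fun u hu r hr => hd r hr u hu

/-- The integral of `V s u` against `1 / (α + β u)`. -/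
noncomputable def VInt (h : ℝ → ℝ) (α β s : ℝ) : ℝ := ∫ u in (0 : ℝ)..1, V h s u / (α + β * u)

/-- The integral of `B'(s - u)` against `1 / (α + β u)`. -/
noncomputable def BdInt (h : ℝ → ℝ) (α β s : ℝ) : ℝ :=
  ∫ u in (0 : ℝ)..1, Bd h (s - u) / (α + β * u)

/-- The integral of `B(s - u) - 1` against `1 / (α + u)`. -/
noncomputable def betaInt (h : ℝ → ℝ) (α s : ℝ) : ℝ :=
  ∫ u in (0 : ℝ)..1, (B h (s - u) - 1) / (α + 1 * u)

/-- The integral of `B(s - u) - 1` against `1 / (α + u) ^ 2`. -/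
noncomputable def betaSqInt (h : ℝ → ℝ) (α s : ℝ) : ℝ :=
  ∫ u in (0 : ℝ)..1, (B h (s - u) - 1) / (α + 1 * u) ^ 2

/-- The integral of `B - 1` up to `s`, written over `0 ≤ u ≤ 1`. -/
noncomputable def betaMass (h : ℝ → ℝ) (s : ℝ) : ℝ := ∫ u in (0 : ℝ)..1, (B h (s - u) - 1)

theorem goutValue_eq (h : ℝ → ℝ) (A s d : ℝ) : goutValue h A s d =
    -2 * (XiInt h s / B h s ^ 2) - 2 * ((B h s - 1) / B h s ^ 2) * Real.log (2 * A)
    + 2 * (VInt h (2 * A) (-1) s - VInt h (2 * A) 1 s) / B h s ^ 2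
    + 2 * (betaInt h (2 * A) s + betaInt h (d - A) s - betaInt h (d + A) s) / B h s
    - 2 * ((B h s - 1) / B h s) * Real.log ((d + A) / (d - A)) := rfl

namespace IsSwitchingProfile

variable {h : ℝ → ℝ} (hh : IsSwitchingProfile h)
include hh

theorem hasDerivAt_V {s u : ℝ} (h1 : s < 1) (hu : 0 ≤ u) :
    HasDerivAt (fun s => V h s u) (B h s * Bd h (s - u)) s := by
  have hc : ContinuousOn (fun x => B h x * Bd h (x - u)) (Iio 1) :=
    hh.continuousOn_B.mul (hh.continuousOn_Bd.comp (by fun_prop) fun x hx => by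
      have : x < 1 := hx
      exact mem_Iio.2 (by linarith))
  refine intervalIntegral.integral_hasDerivAt_right ?_
    (hc.stronglyMeasurableAtFilter isOpen_Iio s h1) (hc.continuousAt (isOpen_Iio.mem_nhds h1))
  refine (hc.mono fun x hx => ?_).intervalIntegrable
  exact hx.2.trans_lt (max_lt one_pos h1)

theorem hasDerivAt_B_sub {s u : ℝ} (h1 : s < 1) (hu : 0 ≤ u) :
    HasDerivAt (fun s => B h (s - u)) (Bd h (s - u)) s :=
  (hh.hasDerivAt_B (by linarith)).comp_sub_const s u

theorem hasDerivAt_Xi {s u : ℝ} (h1 : s < 1) (hu : 0 ≤ u) :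
    HasDerivAt (fun s => Xi h s u)
      (B h s * B h (s - u) * (rate h s - rate h (s - u))) s := by
  refine ((((hh.hasDerivAt_B h1).mul (hh.hasDerivAt_B_sub h1 hu)).sub_const 1).sub
    ((hh.hasDerivAt_V h1 hu).const_mul 2)).congr_deriv ?_
  simp only [Bd]; ring

theorem hasDerivAt_XiInt {s : ℝ} (h0 : 0 < s) (h1 : s < 1) :
    HasDerivAt (XiInt h) (B h s * rateIncr h s) s := by
  obtain ⟨M, -, hM⟩ := hh.exists_abs_Xi_le (s₁ := (s + 1) / 2) (by linarith)
  have hU : Ioo 0 ((s + 1) / 2) ∈ 𝓝 s := isOpen_Ioo.mem_nhds ⟨h0, by linarith⟩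
  have hlt : ∀ r ∈ Ioo 0 ((s + 1) / 2), r < 1 := fun r hr => hr.2.trans (by linarith)
  have hsub : Ioc (0 : ℝ) 1 ⊆ Ici 0 := fun x hx => hx.1.le
  have := hasDerivAt_integral_Ioc (Φ := fun s u => Xi h s u / u)
    (Φ' := fun s u => B h s * B h (s - u) * (rate h s - rate h (s - u)) / u) (M := M) hU
    (fun r hr => ((hh.continuousOn_Xi hr.1.le (hlt r hr)).mono hsub).div continuousOn_id
      fun u hu => hu.1.ne') (hh.intervalIntegrable_Xi_div h0.le h1)
    (by
      refine ContinuousOn.div ?_ continuousOn_id fun u hu => hu.1.ne'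
      exact ((continuousOn_const.mul (hh.continuousOn_B_sub h1)).mul
        (continuousOn_const.sub (hh.continuousOn_rate_sub h1))).mono hsub)
    (fun r hr u hu => by
      rw [abs_div, abs_of_pos hu.1, div_le_iff₀ hu.1]
      exact (hM r ⟨hr.1.le, hr.2.le⟩ u hu).2.2)
    (fun r hr u hu => (hh.hasDerivAt_Xi (hlt r hr) hu.1.le).div_const u)
  refine this.congr_deriv ?_
  rw [rateIncr, ← intervalIntegral.integral_const_mul]
  congr 1; ext u; ring

theorem exists_abs_Bd_le {s : ℝ} (h1 : s < 1) : ∃ M : ℝ, 0 ≤ M ∧ ∀ x ≤ s, |Bd h x| ≤ M := by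
  obtain ⟨M, hM⟩ := isCompact_Icc.exists_bound_of_continuousOn
    (hh.continuousOn_Bd.mono (fun z hz => hz.2.trans_lt h1 : Icc 0 s ⊆ Iio 1))
  refine ⟨|M|, abs_nonneg M, fun x hx => ?_⟩
  rcases le_or_gt x 0 with h0 | h0
  · rw [hh.Bd_of_nonpos h0, abs_zero]; exact abs_nonneg M
  · exact (hM x ⟨h0.le, hx⟩).trans (le_abs_self M)

theorem beta_nonneg {x : ℝ} (hx : x < 1) : 0 ≤ B h x - 1 := by linarith [hh.one_le_B hx]

theorem hasDerivAt_VInt {α β s : ℝ} (hpos : ∀ u ∈ Icc (0 : ℝ) 1, 1 ≤ α + β * u) (h0 : 0 < s)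
    (h1 : s < 1) : HasDerivAt (VInt h α β) (B h s * BdInt h α β s) s := by
  obtain ⟨M, hM0, hM⟩ := hh.exists_abs_Bd_le (s := (s + 1) / 2) (by linarith)
  have hU : Ioo 0 ((s + 1) / 2) ∈ 𝓝 s := isOpen_Ioo.mem_nhds ⟨h0, by linarith⟩
  have hlt : ∀ r ∈ Ioo 0 ((s + 1) / 2), r < 1 := fun r hr => hr.2.trans (by linarith)
  have hsub : Ioc (0 : ℝ) 1 ⊆ Ici 0 := fun x hx => hx.1.le
  have hp : ∀ u ∈ Icc (0 : ℝ) 1, 0 < α + β * u := fun u hu => one_pos.trans_le (hpos u hu)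
  have := hasDerivAt_integral_Ioc (Φ := fun s u => V h s u / (α + β * u))
    (Φ' := fun s u => B h s * Bd h (s - u) / (α + β * u)) (M := B h ((s + 1) / 2) * M) hU
    (fun r hr => ((hh.continuousOn_V hr.1.le (hlt r hr)).mono hsub).div (by fun_prop)
      fun u hu => (hp u (Ioc_subset_Icc_self hu)).ne')
    (intervalIntegrable_div_affine (hh.continuousOn_V h0.le h1) hp)
    (((continuousOn_const.mul (hh.continuousOn_Bd_sub h1)).mono hsub).div (by fun_prop)
      fun u hu => (hp u (Ioc_subset_Icc_self hu)).ne')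
    (fun r hr u hu => by
      have hu' := Ioc_subset_Icc_self hu
      rw [abs_div, abs_of_pos (hp u hu'), abs_mul, abs_of_pos (hh.B_pos r)]
      refine (div_le_self (by have := hh.B_pos r; positivity) (hpos u hu')).trans ?_
      exact mul_le_mul (hh.monotoneOn_B (hlt r hr) (mem_Iio.2 (by linarith)) hr.2.le)
        (hM _ (by linarith [hr.2, hu.1])) (abs_nonneg _) (hh.B_pos _).le)
    (fun r hr u hu => (hh.hasDerivAt_V (hlt r hr) hu.1.le).div_const _)
  refine this.congr_deriv ?_
  rw [BdInt, ← intervalIntegral.integral_const_mul]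
  congr 1; ext u; ring

/-- The derivative of `betaInt` when both arguments move along affine functions. -/
theorem hasDerivAt_betaInt {s₀ σ p₀ ρ r : ℝ} (h1 : s₀ + σ * r < 1) (hp : 0 < p₀ + ρ * r) :
    HasDerivAt (fun r => betaInt h (p₀ + ρ * r) (s₀ + σ * r))
      (σ * BdInt h (p₀ + ρ * r) 1 (s₀ + σ * r) - ρ * betaSqInt h (p₀ + ρ * r) (s₀ + σ * r)) r := by
  set s₁ := (s₀ + σ * r + 1) / 2 with hs₁
  set p₁ := (p₀ + ρ * r) / 2 with hp₁
  have hs₁1 : s₁ < 1 := by linarith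
  have hp₁0 : 0 < p₁ := by linarith
  obtain ⟨M, hM0, hM⟩ := hh.exists_abs_Bd_le hs₁1
  have hU : {x : ℝ | s₀ + σ * x < s₁} ∩ {x : ℝ | p₁ < p₀ + ρ * x} ∈ 𝓝 r := by
    refine IsOpen.mem_nhds ?_ ⟨show s₀ + σ * r < s₁ by linarith, show p₁ < p₀ + ρ * r by linarith⟩
    exact (isOpen_lt (by fun_prop) (by fun_prop)).inter (isOpen_lt (by fun_prop) (by fun_prop))
  have hsub : Ioc (0 : ℝ) 1 ⊆ Ici 0 := fun x hx => hx.1.le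
  have hpu : ∀ x, p₁ < p₀ + ρ * x → ∀ u ∈ Icc (0 : ℝ) 1, p₁ < p₀ + ρ * x + 1 * u :=
    fun x hx u hu => by linarith [hu.1]
  have hcβ : ∀ x, s₀ + σ * x < s₁ → ContinuousOn (fun u => B h (s₀ + σ * x - u) - 1) (Ici 0) :=
    fun x hx => (hh.continuousOn_B_sub (hx.trans hs₁1)).sub continuousOn_const
  have hr1 : s₀ + σ * r < s₁ := by linarith
  have hr2 : p₁ < p₀ + ρ * r := by linarith
  have hne : ∀ x, p₁ < p₀ + ρ * x → ∀ u ∈ Ioc (0 : ℝ) 1, p₀ + ρ * x + 1 * u ≠ 0 :=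
    fun x hx u hu => (hp₁0.trans (hpu x hx u (Ioc_subset_Icc_self hu))).ne'
  have := hasDerivAt_integral_Ioc
    (Φ := fun x u => (B h (s₀ + σ * x - u) - 1) / (p₀ + ρ * x + 1 * u))
    (Φ' := fun x u => σ * (Bd h (s₀ + σ * x - u) / (p₀ + ρ * x + 1 * u))
      - ρ * ((B h (s₀ + σ * x - u) - 1) / (p₀ + ρ * x + 1 * u) ^ 2))
    (M := |σ| * (M / p₁) + |ρ| * (B h s₁ / p₁ ^ 2)) hU
    (fun x hx => ((hcβ x hx.1).mono hsub).div (by fun_prop) (hne x hx.2))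
    (intervalIntegrable_div_affine (hcβ r hr1) fun u hu => hp₁0.trans (hpu r hr2 u hu))
    (((((hh.continuousOn_Bd_sub (hr1.trans hs₁1)).mono hsub).div (by fun_prop)
      (hne r hr2)).const_mul σ).sub ((((hcβ r hr1).mono hsub).div (by fun_prop)
      (fun u hu => pow_ne_zero 2 (hne r hr2 u hu))).const_mul ρ))
    (fun x hx u hu => by
      have hk := hpu x hx.2 u (Ioc_subset_Icc_self hu)
      have hk0 := hp₁0.trans hk
      have hx1 : s₀ + σ * x < s₁ := hx.1
      have hle : s₀ + σ * x - u ≤ s₁ := by linarith [hu.1]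
      have hb := hh.monotoneOn_B (mem_Iio.2 (hle.trans_lt hs₁1)) hs₁1 hle
      refine (abs_sub _ _).trans (add_le_add ?_ ?_)
      · rw [abs_mul, abs_div, abs_of_pos hk0]
        exact mul_le_mul_of_nonneg_left (div_le_div₀ hM0 (hM _ hle) hp₁0 hk.le) (abs_nonneg _)
      · rw [abs_mul, abs_div, abs_of_pos (pow_pos hk0 2),
          abs_of_nonneg (hh.beta_nonneg (hle.trans_lt hs₁1))]
        refine mul_le_mul_of_nonneg_left (div_le_div₀ (hh.B_pos _).le (by linarith)
          (by positivity) (pow_le_pow_left₀ hp₁0.le hk.le 2)) (abs_nonneg _))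
    (fun x hx u hu => by
      have hs : HasDerivAt (fun x => s₀ + σ * x - u) (σ * 1) x :=
        (((hasDerivAt_id x).const_mul σ).const_add s₀).sub_const u
      have hp' : HasDerivAt (fun x => p₀ + ρ * x + 1 * u) (ρ * 1) x :=
        (((hasDerivAt_id x).const_mul ρ).const_add p₀).add_const (1 * u)
      have hx1 : s₀ + σ * x < s₁ := hx.1
      have hB := ((hh.hasDerivAt_B (z := s₀ + σ * x - u) (by linarith [hu.1])).comp x hs).sub_const 1
      have hn := hne x hx.2 u hu
      refine (hB.div hp' hn).congr_deriv ?_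
      simp only [Function.comp]
      field_simp)
  refine this.congr_deriv ?_
  rw [BdInt, betaSqInt, ← intervalIntegral.integral_const_mul,
    ← intervalIntegral.integral_const_mul, ← intervalIntegral.integral_sub]
  · exact (intervalIntegrable_div_affine (hh.continuousOn_Bd_sub (hr1.trans hs₁1))
      fun u hu => hp₁0.trans (hpu r hr2 u hu)).const_mul σ
  · refine IntervalIntegrable.const_mul (ContinuousOn.intervalIntegrable ?_) ρ
    rw [uIcc_of_le zero_le_one]
    exact ((hcβ r hr1).mono fun x hx => hx.1).div (by fun_prop)
      fun u hu => pow_ne_zero 2 (hp₁0.trans (hpu r hr2 u hu)).ne'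

/-! ### Elementary bounds for the position-space integrals -/

theorem V_nonneg {s u : ℝ} (h0 : 0 ≤ s) (h1 : s < 1) (hu : 0 ≤ u) : 0 ≤ V h s u :=
  intervalIntegral.integral_nonneg h0 fun x hx =>
    mul_nonneg (hh.B_pos x).le (hh.Bd_nonneg (by linarith [hx.2]))

theorem V_le {s u : ℝ} (h0 : 0 ≤ s) (h1 : s < 1) (hu : 0 ≤ u) :
    V h s u ≤ B h s * (B h (s - u) - 1) := by
  have hlt : ∀ x ∈ uIcc 0 s, x < 1 ∧ x - u < 1 := fun x hx => by
    rw [uIcc_of_le h0] at hx; exact ⟨hx.2.trans_lt h1, by linarith [hx.2]⟩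
  have c2 : ContinuousOn (fun x => Bd h (x - u)) (uIcc 0 s) :=
    hh.continuousOn_Bd.comp (by fun_prop) fun x hx => (hlt x hx).2
  have hftc := intervalIntegral.integral_eq_sub_of_hasDerivAt
    (f := fun x => B h (x - u)) (f' := fun x => Bd h (x - u))
    (fun x hx => (hh.hasDerivAt_B (hlt x hx).2).comp_sub_const x u) c2.intervalIntegrable
  rw [B_of_nonpos (h := h) (by linarith : 0 - u ≤ 0)] at hftc
  rw [← hftc, ← intervalIntegral.integral_const_mul]
  refine intervalIntegral.integral_mono_on h0
    (((hh.continuousOn_B.mono fun x hx => (hlt x hx).1).mul c2).intervalIntegrable)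
    (c2.intervalIntegrable.const_mul _) fun x hx => ?_
  exact mul_le_mul_of_nonneg_right (hh.monotoneOn_B (mem_Iio.2 (hx.2.trans_lt h1)) h1 hx.2)
    (hh.Bd_nonneg (by linarith [hx.2]))

omit hh in
/-- A nonnegative integrand divided by a function bounded below. -/
theorem _root_.ShellFormation.integral_div_bounds {f k : ℝ → ℝ} {m : ℝ} (hf : ContinuousOn f (Ici 0))
    (hf0 : ∀ u ∈ Icc (0 : ℝ) 1, 0 ≤ f u) (hm : 0 < m) (hk : Continuous k)
    (hpos : ∀ u ∈ Icc (0 : ℝ) 1, m ≤ k u) :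
    |∫ u in (0 : ℝ)..1, f u / k u| ≤ (∫ u in (0 : ℝ)..1, f u) / m := by
  have hi : IntervalIntegrable (fun u => f u / k u) volume 0 1 := by
    refine ContinuousOn.intervalIntegrable ?_
    rw [uIcc_of_le zero_le_one]
    exact (hf.mono fun x hx => hx.1).div hk.continuousOn fun u hu => (hm.trans_le (hpos u hu)).ne'
  rw [abs_of_nonneg (intervalIntegral.integral_nonneg zero_le_one fun u hu =>
    div_nonneg (hf0 u hu) (hm.le.trans (hpos u hu))), div_eq_mul_inv,
    ← intervalIntegral.integral_mul_const]
  refine intervalIntegral.integral_mono_on zero_le_one hi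
    (hf.intervalIntegrable_zero_one.mul_const _) fun u hu => ?_
  rw [← div_eq_mul_inv]
  exact div_le_div_of_nonneg_left (hf0 u hu) hm (hpos u hu)

theorem integral_Bd_sub {s : ℝ} (h1 : s < 1) :
    ∫ u in (0 : ℝ)..1, Bd h (s - u) = B h s - 1 := by
  have h2 := (hh.transforms_by_parts 0 h1).1
  simpa [cosTr] using h2

theorem abs_BdInt_le {α β m s : ℝ} (hm : 0 < m) (hpos : ∀ u ∈ Icc (0 : ℝ) 1, m ≤ α + β * u)
    (h1 : s < 1) : |BdInt h α β s| ≤ B h s / m := by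
  have h2 := integral_div_bounds (hh.continuousOn_Bd_sub h1)
    (fun u hu => hh.Bd_nonneg (by linarith [hu.1])) hm (k := fun u => α + β * u) (by fun_prop) hpos
  rw [hh.integral_Bd_sub h1] at h2
  exact h2.trans (div_le_div_of_nonneg_right (by linarith) hm.le)

theorem abs_betaInt_le {α s : ℝ} (hα : 0 < α) (h1 : s < 1) :
    |betaInt h α s| ≤ betaMass h s / α :=
  integral_div_bounds ((hh.continuousOn_B_sub h1).sub continuousOn_const)
    (fun u hu => hh.beta_nonneg (by linarith [hu.1])) hα (k := fun u => α + 1 * u) (by fun_prop)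
    fun u hu => by linarith [hu.1]

theorem abs_betaSqInt_le {α s : ℝ} (hα : 0 < α) (h1 : s < 1) :
    |betaSqInt h α s| ≤ betaMass h s / α ^ 2 :=
  integral_div_bounds ((hh.continuousOn_B_sub h1).sub continuousOn_const)
    (fun u hu => hh.beta_nonneg (by linarith [hu.1])) (by positivity)
    (k := fun u => (α + 1 * u) ^ 2) (by fun_prop)
    fun u hu => pow_le_pow_left₀ hα.le (by linarith [hu.1]) 2

theorem abs_VInt_le {α β s : ℝ} (hpos : ∀ u ∈ Icc (0 : ℝ) 1, 1 ≤ α + β * u) (h0 : 0 ≤ s)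
    (h1 : s < 1) : |VInt h α β s| ≤ B h s * betaMass h s := by
  have h2 := integral_div_bounds (hh.continuousOn_V h0 h1)
    (fun u hu => hh.V_nonneg h0 h1 hu.1) one_pos (k := fun u => α + β * u) (by fun_prop) hpos
  rw [div_one] at h2
  refine h2.trans ?_
  rw [betaMass, ← intervalIntegral.integral_const_mul]
  exact intervalIntegral.integral_mono_on zero_le_one (hh.intervalIntegrable_V h0 h1)
    ((hh.intervalIntegrable_beta h1).const_mul _) fun u hu => hh.V_le h0 h1 hu.1

theorem betaMass_nonneg {s : ℝ} (h1 : s < 1) : 0 ≤ betaMass h s :=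
  intervalIntegral.integral_nonneg zero_le_one fun u hu => hh.beta_nonneg (by linarith [hu.1])

end IsSwitchingProfile

/-! ### Asymptotics at the end of the formation -/

/-- A function on `[a, 1)` is bounded by its initial value when its derivative is nonpositive. -/
theorem le_of_hasDerivAt_nonpos {f f' : ℝ → ℝ} {a : ℝ}
    (hf : ∀ z ∈ Ico a 1, HasDerivAt f (f' z) z) (hf' : ∀ z ∈ Ico a 1, f' z ≤ 0) :
    ∀ s ∈ Ico a 1, f s ≤ f a := by
  have : AntitoneOn f (Ico a 1) := by
    refine antitoneOn_of_deriv_nonpos (convex_Ico a 1)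
      (fun z hz => (hf z hz).continuousAt.continuousWithinAt)
      (fun z hz => (hf z (interior_subset hz)).differentiableAt.differentiableWithinAt)
      fun z hz => ?_
    rw [(hf z (interior_subset hz)).deriv]
    exact hf' z (interior_subset hz)
  exact fun s hs => this ⟨le_rfl, hs.1.trans_lt hs.2⟩ hs hs.1

namespace IsSwitchingProfile

variable {h : ℝ → ℝ} (hh : IsSwitchingProfile h)
include hh

theorem hasDerivAt_rate {z : ℝ} (h0 : 0 < z) (h1 : z < 1) :
    HasDerivAt (rate h) (-deriv (g h) z * rate h z ^ 2) z := by
  have e : rate h = fun z => (g h z)⁻¹ := funext rate_eq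
  rw [e]
  refine ((hh.hasDerivAt_g h0).inv (hh.g_pos h0 h1).ne').congr_deriv ?_
  field_simp

theorem rate_mul_g {z : ℝ} (h0 : 0 < z) (h1 : z < 1) : rate h z * g h z = 1 := by
  rw [rate_eq]; exact inv_mul_cancel₀ (hh.g_pos h0 h1).ne'

theorem Bd_mul_g {z : ℝ} (h0 : 0 < z) (h1 : z < 1) : Bd h z * g h z = B h z := by
  rw [Bd, mul_right_comm, hh.rate_mul_g h0 h1, one_mul]

theorem betaMass_eq {s : ℝ} (h0 : 0 ≤ s) (h1 : s < 1) :
    betaMass h s = ∫ z in (0 : ℝ)..s, (B h z - 1) := by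
  have hc : ContinuousOn (fun z => B h z - 1) (Iio 1) := hh.continuousOn_B.sub continuousOn_const
  have hi : ∀ a b : ℝ, a ≤ s → b ≤ s → IntervalIntegrable (fun z => B h z - 1) volume a b :=
    fun a b ha hb => (hc.mono fun x hx =>
      hx.2.trans_lt (max_lt (ha.trans_lt h1) (hb.trans_lt h1))).intervalIntegrable
  rw [betaMass, intervalIntegral.integral_comp_sub_left (fun z => B h z - 1), sub_zero,
    ← intervalIntegral.integral_add_adjacent_intervals (hi (s - 1) 0 (by linarith) h0)
      (hi 0 s h0 le_rfl)]
  have : ∫ z in (s - 1)..0, (B h z - 1) = ∫ z in (s - 1)..0, (0 : ℝ) := by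
    refine intervalIntegral.integral_congr fun z hz => ?_
    rw [uIcc_of_le (by linarith)] at hz
    simp [B_of_nonpos hz.2]
  rw [this]; simp

theorem hasDerivAt_integral_B_sub_one {s : ℝ} (h1 : s < 1) :
    HasDerivAt (fun s => ∫ z in (0 : ℝ)..s, (B h z - 1)) (B h s - 1) s := by
  have hc : ContinuousOn (fun z => B h z - 1) (Iio 1) := hh.continuousOn_B.sub continuousOn_const
  exact intervalIntegral.integral_hasDerivAt_right
    (hc.mono fun x hx => hx.2.trans_lt (max_lt one_pos h1)).intervalIntegrable
    (hc.stronglyMeasurableAtFilter isOpen_Iio s h1) (hc.continuousAt (isOpen_Iio.mem_nhds h1))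

theorem integral_mul_Bd_eq_betaMass {s : ℝ} (h1 : s < 1) :
    ∫ u in (0 : ℝ)..1, u * Bd h (s - u) = betaMass h s := by
  have hβ : ∀ u ∈ uIcc (0 : ℝ) 1, HasDerivAt (fun u => B h (s - u) - 1) (-Bd h (s - u)) u :=
    fun u hu => by
      rw [uIcc_of_le zero_le_one] at hu
      have : HasDerivAt (fun u => B h (s - u)) (-Bd h (s - u)) u := by
        simpa using (hh.hasDerivAt_B (z := s - u) (by linarith [hu.1])).comp_const_sub s u
      exact this.sub_const 1
  have b1 : B h (s - 1) = 1 := B_of_nonpos (by linarith)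
  have k1 := intervalIntegral.integral_mul_deriv_eq_deriv_mul (u := fun u => u)
    (u' := fun _ => 1) (fun u _ => hasDerivAt_id u) hβ
    intervalIntegrable_const (hh.intervalIntegrable_Bd_sub h1).neg
  simp only [mul_neg, intervalIntegral.integral_neg, b1, sub_self, mul_zero, zero_mul,
    one_mul] at k1
  rw [betaMass]; linarith

/-- The ratio `c ^ 3 / B` decreases once `-g' ≤ 1 / 3`, because `c' = -g' c ^ 2` and `B' = c B`. -/
theorem exists_rate_cube_le {z₀ : ℝ} (h0 : 0 < z₀)
    (hz₀ : ∀ z ∈ Ico z₀ 1, -deriv (g h) z ≤ 1 / 4) :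
    ∃ C : ℝ, 0 ≤ C ∧ ∀ s ∈ Ico z₀ 1, rate h s ^ 3 ≤ C * B h s := by
  refine ⟨|rate h z₀ ^ 3 / B h z₀|, abs_nonneg _, fun s hs => ?_⟩
  have := le_of_hasDerivAt_nonpos (f := fun z => rate h z ^ 3 / B h z)
    (f' := fun z => rate h z ^ 4 * (3 * -deriv (g h) z - 1) / B h z) (a := z₀)
    (fun z hz => by
      have hb := (hh.B_pos z).ne'
      refine (((hh.hasDerivAt_rate (h0.trans_le hz.1) hz.2).pow 3).div
        (hh.hasDerivAt_B hz.2) hb).congr_deriv ?_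
      simp only [Bd, Pi.pow_apply]
      field_simp
      ring)
    (fun z hz => by
      have := hz₀ z hz
      refine div_nonpos_of_nonpos_of_nonneg ?_ (hh.B_pos z).le
      exact mul_nonpos_of_nonneg_of_nonpos (by positivity) (by linarith)) s hs
  have h2 := this.trans (le_abs_self _)
  rwa [div_le_iff₀ (hh.B_pos s)] at h2

/-- The integral of `B` grows no faster than `2 B g`, whose derivative is `2 B (1 + g')`. -/
theorem betaMass_le {z₀ : ℝ} (h0 : 0 < z₀)
    (hz₀ : ∀ z ∈ Ico z₀ 1, -deriv (g h) z ≤ 1 / 4) :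
    ∀ s ∈ Ico z₀ 1, betaMass h s ≤ 2 * (B h s * g h s) + betaMass h z₀ := by
  intro s hs
  have := le_of_hasDerivAt_nonpos
    (f := fun z => (∫ x in (0 : ℝ)..z, (B h x - 1)) - 2 * (B h z * g h z))
    (f' := fun z => (B h z - 1) - 2 * (Bd h z * g h z + B h z * deriv (g h) z)) (a := z₀)
    (fun z hz => (hh.hasDerivAt_integral_B_sub_one hz.2).sub
      (((hh.hasDerivAt_B hz.2).mul (hh.hasDerivAt_g (h0.trans_le hz.1))).const_mul 2))
    (fun z hz => by
      rw [hh.Bd_mul_g (h0.trans_le hz.1) hz.2]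
      have := hz₀ z hz
      have := hh.B_pos z
      nlinarith) s hs
  rw [← hh.betaMass_eq (h0.le.trans hs.1) hs.2,
    ← hh.betaMass_eq h0.le (hs.1.trans_lt hs.2)] at this
  have h3 := mul_pos (hh.B_pos z₀) (hh.g_pos h0 (hs.1.trans_lt hs.2))
  linarith

section convex

variable (hg : ∀ T : ℝ, 0 < T → T < 1 → iteratedDeriv 3 (g h) T < 0)
include hg

theorem incr_nonneg {s u : ℝ} (h1 : s < 1) (hu : 0 < u) :
    0 ≤ B h (s - u) * (rate h s - rate h (s - u)) / u :=
  div_nonneg (mul_nonneg (hh.B_pos _).le (sub_nonneg.2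
    (hh.monotoneOn_rate hg (mem_Iio.2 (by linarith)) h1 (by linarith)))) hu.le

/-- On `s - u ≥ z₀` the increment of the rate is compared with the increment of `g`, since
`B (1 / g(s) - 1 / g) = B' (g - g(s)) / g(s)`. -/
theorem incr_bounds {z₀ s u : ℝ} (h0 : 0 < z₀)
    (hz₀ : ∀ z ∈ Ico z₀ 1, deriv (deriv (g h)) z ≤ 1) (h1 : s < 1) (hu : 0 < u)
    (hus : z₀ ≤ s - u) :
    rate h s * -deriv (g h) s * Bd h (s - u)
      ≤ B h (s - u) * (rate h s - rate h (s - u)) / u ∧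
    B h (s - u) * (rate h s - rate h (s - u)) / u
      ≤ rate h s * -deriv (g h) s * Bd h (s - u) + rate h s * (u * Bd h (s - u)) := by
  have hz0 : 0 < s - u := h0.trans_le hus
  have hz1 : s - u < 1 := by linarith
  have hs0 : 0 < s := by linarith
  have l := hh.mul_le_g_sub_g hg hz0 (by linarith : s - u ≤ s) h1.le
  have r := hh.g_sub_g_le h0 hz₀ hus (by linarith : s - u ≤ s) h1
  rw [sub_sub_cancel] at l r
  have e : B h (s - u) * (rate h s - rate h (s - u)) / u
      = rate h s * Bd h (s - u) * ((g h (s - u) - g h s) / u) := by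
    have e1 := hh.rate_mul_g hs0 h1
    have e2 := hh.rate_mul_g hz0 hz1
    rw [Bd]
    have : B h (s - u) * (rate h s - rate h (s - u))
        = rate h s * (rate h (s - u) * B h (s - u)) * (g h (s - u) - g h s) := by
      linear_combination (-B h (s - u) * rate h s) * e2 + (B h (s - u) * rate h (s - u)) * e1
    rw [this, mul_div_assoc]
  have hp : 0 ≤ rate h s * Bd h (s - u) :=
    mul_nonneg (hh.rate_nonneg h1) (hh.Bd_nonneg hz1)
  rw [e]
  constructor
  · have : -deriv (g h) s ≤ (g h (s - u) - g h s) / u := by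
      rw [le_div_iff₀ hu]; exact l
    calc _ = rate h s * Bd h (s - u) * -deriv (g h) s := by ring
      _ ≤ _ := mul_le_mul_of_nonneg_left this hp
  · have : (g h (s - u) - g h s) / u ≤ -deriv (g h) s + u := by
      rw [div_le_iff₀ hu]; linarith
    calc _ ≤ rate h s * Bd h (s - u) * (-deriv (g h) s + u) :=
          mul_le_mul_of_nonneg_left this hp
      _ = _ := by ring

/-- The leading behaviour of the weighted increment of the rate is `c' B / c`. -/
theorem rateIncr_bounds {z₀ s : ℝ} (h0 : 0 < z₀)
    (hz₀ : ∀ z ∈ Ico z₀ 1, deriv (deriv (g h)) z ≤ 1) (hs : (z₀ + 1) / 2 ≤ s) (h1 : s < 1)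
    (hz1 : z₀ < 1) :
    rate h s * -deriv (g h) s * (B h s - 1 - Bd h z₀) ≤ rateIncr h s ∧
    rateIncr h s ≤ rate h s * -deriv (g h) s * (B h s - 1) + rate h s * betaMass h s
      + rate h s * (B h z₀ * (2 / (1 - z₀))) := by
  have hs0 : 0 < s := by linarith
  have hi := hh.intervalIntegrable_incr_div hs0.le h1
  have hb := hh.intervalIntegrable_Bd_sub h1
  have hub : IntervalIntegrable (fun u => u * Bd h (s - u)) volume 0 1 :=
    hb.continuousOn_mul continuousOn_id
  have hv : 0 ≤ rate h s * -deriv (g h) s :=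
    mul_nonneg (hh.rate_nonneg h1) (by linarith [hh.deriv_g_neg hg hs0 h1])
  have hBm : ∀ u, s - u < z₀ → B h (s - u) ≤ B h z₀ := fun u hu =>
    hh.monotoneOn_B (mem_Iio.2 (hu.trans hz1)) hz1 hu.le
  constructor
  · have e : rate h s * -deriv (g h) s * (B h s - 1 - Bd h z₀)
        = ∫ u in (0 : ℝ)..1, rate h s * -deriv (g h) s * (Bd h (s - u) - Bd h z₀) := by
      rw [intervalIntegral.integral_const_mul, intervalIntegral.integral_sub hb
        intervalIntegrable_const, hh.integral_Bd_sub h1]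
      simp
    rw [e]
    refine intervalIntegral.integral_mono_on_of_le_Ioo zero_le_one
      ((hb.sub intervalIntegrable_const).const_mul _) hi fun u hu => ?_
    have hd0 := hh.Bd_nonneg hz1
    rcases le_or_gt z₀ (s - u) with h2 | h2
    · refine le_trans ?_ (hh.incr_bounds hg h0 hz₀ h1 hu.1 h2).1
      exact mul_le_mul_of_nonneg_left (by linarith) hv
    · refine le_trans ?_ (hh.incr_nonneg hg h1 hu.1)
      refine mul_nonpos_of_nonneg_of_nonpos hv (sub_nonpos.2 ?_)
      exact mul_le_mul (hh.monotoneOn_rate hg (mem_Iio.2 (h2.trans hz1)) hz1 h2.le) (hBm u h2)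
        (hh.B_pos _).le (hh.rate_nonneg hz1)
  · have e : rate h s * -deriv (g h) s * (B h s - 1) + rate h s * betaMass h s
          + rate h s * (B h z₀ * (2 / (1 - z₀)))
        = ∫ u in (0 : ℝ)..1, (rate h s * -deriv (g h) s * Bd h (s - u)
            + rate h s * (u * Bd h (s - u)) + rate h s * (B h z₀ * (2 / (1 - z₀)))) := by
      rw [intervalIntegral.integral_add ((hb.const_mul _).add (hub.const_mul _))
        intervalIntegrable_const, intervalIntegral.integral_add (hb.const_mul _)
        (hub.const_mul _), intervalIntegral.integral_const_mul,
        intervalIntegral.integral_const_mul, hh.integral_Bd_sub h1,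
        hh.integral_mul_Bd_eq_betaMass h1]
      simp
    rw [e]
    refine intervalIntegral.integral_mono_on_of_le_Ioo zero_le_one hi
      (((hb.const_mul _).add (hub.const_mul _)).add intervalIntegrable_const) fun u hu => ?_
    have hr := hh.rate_nonneg h1
    have hE : 0 ≤ rate h s * (B h z₀ * (2 / (1 - z₀))) :=
      mul_nonneg hr (mul_nonneg (hh.B_pos _).le (div_nonneg zero_le_two (by linarith)))
    rcases le_or_gt z₀ (s - u) with h2 | h2
    · exact (hh.incr_bounds hg h0 hz₀ h1 hu.1 h2).2.trans (by linarith)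
    · have hd := hh.Bd_nonneg (z := s - u) (by linarith [hu.1])
      have hu2 : (1 - z₀) / 2 ≤ u := by linarith
      have h3 : B h (s - u) * (rate h s - rate h (s - u)) / u
          ≤ rate h s * (B h z₀ * (2 / (1 - z₀))) := by
        have hrn := hh.rate_nonneg (z := s - u) (by linarith [hu.1])
        calc B h (s - u) * (rate h s - rate h (s - u)) / u
            ≤ B h z₀ * rate h s / ((1 - z₀) / 2) := by
              refine div_le_div₀ (mul_nonneg (hh.B_pos _).le hr) ?_ (by linarith) hu2
              exact (mul_le_mul_of_nonneg_left (by linarith) (hh.B_pos _).le).trans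
                (mul_le_mul_of_nonneg_right (hBm u h2) hr)
          _ = _ := by field_simp
      have h4 : 0 ≤ rate h s * -deriv (g h) s * Bd h (s - u) := mul_nonneg hv hd
      have h5 : 0 ≤ rate h s * (u * Bd h (s - u)) := mul_nonneg hr (mul_nonneg hu.1.le hd)
      linarith

/-- The estimates near the end of the formation: powers of the rate are dominated by `B`, the mass
of `B - 1` is `O(B / c)`, and both nonlocal quantities entering `F` equal `c' / c + O(1)`. -/
theorem exists_bounds : ∃ C z₁ : ℝ, 1 ≤ C ∧ 0 < z₁ ∧ z₁ < 1 ∧ ∀ s ∈ Ico z₁ 1,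
    rate h s ^ 3 ≤ C * B h s ∧ rate h s ≤ C * B h s ∧ rate h s * betaMass h s ≤ C * B h s ∧
    |rateIncr h s / B h s - rate h s * -deriv (g h) s| ≤ C ∧
    |2 * rate h s * XiInt h s / B h s ^ 2 - rate h s * -deriv (g h) s| ≤ C := by
  obtain ⟨z₀, h0, h1, hz⟩ := hh.exists_flat
  have hz1 : ∀ z ∈ Ico z₀ 1, -deriv (g h) z ≤ 1 / 4 := fun z hz' => (hz z hz').1
  have hz2 : ∀ z ∈ Ico z₀ 1, deriv (deriv (g h)) z ≤ 1 := fun z hz' => (hz z hz').2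
  obtain ⟨C₁, hC₁, hcube⟩ := hh.exists_rate_cube_le h0 hz1
  set z₁ := (z₀ + 1) / 2 with hz₁
  have hz01 : z₀ ≤ z₁ := by linarith
  have hz₁0 : 0 < z₁ := by linarith
  have hz₁1 : z₁ < 1 := by linarith
  have hsub : ∀ s ∈ Ico z₁ 1, s ∈ Ico z₀ 1 := fun s hs => ⟨hz01.trans hs.1, hs.2⟩
  have hpos : ∀ s ∈ Ico z₁ 1, 0 < s := fun s hs => hz₁0.trans_le hs.1
  have hrate : ∀ s ∈ Ico z₁ 1, rate h s ≤ (1 + C₁) * B h s := fun s hs => by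
    have k1 := hcube s (hsub s hs)
    have k2 := hh.one_le_B hs.2
    have k3 := hh.rate_nonneg hs.2
    rcases le_or_gt (rate h s) 1 with k | k
    · nlinarith [mul_nonneg hC₁ (hh.B_pos s).le]
    · have : rate h s ≤ rate h s ^ 3 := le_self_pow₀ k.le (by norm_num)
      linarith
  set C₂ := 2 + (1 + C₁) * betaMass h z₀ with hC₂
  have hm0 := hh.betaMass_nonneg h1
  have hmass : ∀ s ∈ Ico z₁ 1, rate h s * betaMass h s ≤ C₂ * B h s := fun s hs => by
    have k1 := hh.betaMass_le h0 hz1 s (hsub s hs)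
    have k3 := hh.rate_nonneg hs.2
    calc rate h s * betaMass h s ≤ rate h s * (2 * (B h s * g h s) + betaMass h z₀) :=
          mul_le_mul_of_nonneg_left k1 k3
      _ = 2 * B h s * (rate h s * g h s) + rate h s * betaMass h z₀ := by ring
      _ ≤ 2 * B h s * 1 + (1 + C₁) * B h s * betaMass h z₀ := by
          rw [hh.rate_mul_g (hpos s hs) hs.2]
          exact add_le_add le_rfl (mul_le_mul_of_nonneg_right (hrate s hs) hm0)
      _ = _ := by rw [hC₂]; ring
  have hd0 := hh.Bd_nonneg h1
  set E := B h z₀ * (2 / (1 - z₀)) with hE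
  have hE0 : 0 ≤ E := mul_nonneg (hh.B_pos _).le (div_nonneg zero_le_two (by linarith))
  set C₃ := (1 + C₁) * (1 + Bd h z₀) + C₂ + (1 + C₁) * E with hC₃
  have hC₂0 : 0 ≤ C₂ := by positivity
  have hC₃0 : 0 ≤ C₃ := by positivity
  have hincr : ∀ s ∈ Ico z₁ 1,
      |rateIncr h s / B h s - rate h s * -deriv (g h) s| ≤ C₃ := fun s hs => by
    have hB := hh.B_pos s
    obtain ⟨k1, k2⟩ := hh.rateIncr_bounds hg h0 hz2 hs.1 hs.2 h1
    have k3 := hh.rate_nonneg hs.2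
    have k4 := hz1 s (hsub s hs)
    have k5 := hh.deriv_g_neg hg (hpos s hs) hs.2
    have k6 := hrate s hs
    have k7 := hmass s hs
    have k8 : rate h s * -deriv (g h) s ≤ (1 + C₁) * B h s := by nlinarith
    have k9 : 0 ≤ rate h s * -deriv (g h) s := mul_nonneg k3 (by linarith)
    have hdiv : rateIncr h s / B h s - rate h s * -deriv (g h) s
        = (rateIncr h s - rate h s * -deriv (g h) s * B h s) / B h s := by field_simp
    rw [hdiv, abs_div, abs_of_pos hB, div_le_iff₀ hB, abs_le]
    have k10 : rate h s * -deriv (g h) s * (1 + Bd h z₀) ≤ (1 + C₁) * B h s * (1 + Bd h z₀) :=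
      mul_le_mul_of_nonneg_right k8 (by linarith)
    have k11 : rate h s * E ≤ (1 + C₁) * B h s * E := mul_le_mul_of_nonneg_right k6 hE0
    have p1 : 0 ≤ C₂ * B h s := by positivity
    have p2 : 0 ≤ (1 + C₁) * E * B h s := by positivity
    have p3 : 0 ≤ (1 + C₁) * (1 + Bd h z₀) * B h s := by positivity
    constructor
    · rw [hC₃]; linarith
    · rw [hC₃]; linarith
  -- `2 * XiInt` and `B ^ 2 * (-g')` have the same derivative up to `O (B ^ 2)`, and `B ^ 2 * g` has
  -- derivative `B ^ 2 * (2 + g') ≥ B ^ 2`.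
  set Δ : ℝ → ℝ := fun s => 2 * XiInt h s - B h s ^ 2 * -deriv (g h) s with hΔ
  set Δ' : ℝ → ℝ := fun s => 2 * (B h s * rateIncr h s) - (2 * B h s * Bd h s * -deriv (g h) s
    + B h s ^ 2 * -deriv (deriv (g h)) s) with hΔ'
  set N := 2 * C₃ + 1 with hN
  have hN0 : 0 ≤ N := by positivity
  have dΔ : ∀ s ∈ Ico z₁ 1, HasDerivAt Δ (Δ' s) s := fun s hs => by
    refine (((hh.hasDerivAt_XiInt (hpos s hs) hs.2).const_mul 2).sub
      (((hh.hasDerivAt_B hs.2).pow 2).mul (hh.hasDerivAt_deriv_g (hpos s hs)).neg)).congr_deriv ?_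
    simp [hΔ']
  have dG : ∀ s ∈ Ico z₁ 1, HasDerivAt (fun s => B h s ^ 2 * g h s)
      (2 * B h s ^ 2 + B h s ^ 2 * deriv (g h) s) s := fun s hs => by
    refine (((hh.hasDerivAt_B hs.2).pow 2).mul (hh.hasDerivAt_g (hpos s hs))).congr_deriv ?_
    have := hh.Bd_mul_g (hpos s hs) hs.2
    simp only [Pi.pow_apply]
    push_cast
    linear_combination 2 * B h s * this
  have hΔb : ∀ s ∈ Ico z₁ 1, |Δ' s| ≤ N * (2 * B h s ^ 2 + B h s ^ 2 * deriv (g h) s) :=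
    fun s hs => by
      have hB := hh.B_pos s
      have e : Δ' s = 2 * B h s ^ 2 * (rateIncr h s / B h s - rate h s * -deriv (g h) s)
          + B h s ^ 2 * deriv (deriv (g h)) s := by
        simp only [hΔ', Bd]; field_simp; ring
      have k1 := hz2 s (hsub s hs)
      have k2 := hh.deriv_deriv_g_pos hg (hpos s hs) hs.2
      have k3 := hz1 s (hsub s hs)
      rw [e]
      refine (abs_add_le _ _).trans ?_
      rw [abs_mul (2 * B h s ^ 2), abs_mul (B h s ^ 2), abs_of_pos (by positivity : 0 < 2 * B h s ^ 2),
        abs_of_pos (by positivity : 0 < B h s ^ 2), abs_of_pos k2]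
      have k4 := mul_le_mul_of_nonneg_left (hincr s hs) (by positivity : 0 ≤ 2 * B h s ^ 2)
      have k5 := mul_le_mul_of_nonneg_left k1 (by positivity : 0 ≤ B h s ^ 2)
      have k6 : B h s ^ 2 * 1 ≤ B h s ^ 2 * (2 + deriv (g h) s) :=
        mul_le_mul_of_nonneg_left (by linarith) (by positivity)
      have k7 := mul_le_mul_of_nonneg_left k6 hN0
      rw [hN] at k7 ⊢
      linarith
  have up := le_of_hasDerivAt_nonpos (fun s hs => (dΔ s hs).sub ((dG s hs).const_mul N))
    fun s hs => by linarith [(abs_le.1 (hΔb s hs)).2]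
  have lo := le_of_hasDerivAt_nonpos (fun s hs => (dΔ s hs).neg.sub ((dG s hs).const_mul N))
    fun s hs => by linarith [(abs_le.1 (hΔb s hs)).1]
  set C₄ := |Δ z₁| with hC₄
  have hg1 : 0 ≤ N * (B h z₁ ^ 2 * g h z₁) :=
    mul_nonneg hN0 (mul_nonneg (by positivity) (hh.g_pos hz₁0 hz₁1).le)
  have hΔfin : ∀ s ∈ Ico z₁ 1, |Δ s| ≤ C₄ + N * (B h s ^ 2 * g h s) := fun s hs => by
    have u1 : Δ s - N * (B h s ^ 2 * g h s) ≤ Δ z₁ - N * (B h z₁ ^ 2 * g h z₁) := up s hs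
    have l1 : -Δ s - N * (B h s ^ 2 * g h s) ≤ -Δ z₁ - N * (B h z₁ ^ 2 * g h z₁) := lo s hs
    rw [abs_le]
    constructor
    · linarith [neg_abs_le (Δ z₁)]
    · linarith [le_abs_self (Δ z₁)]
  have hxi : ∀ s ∈ Ico z₁ 1, |2 * rate h s * XiInt h s / B h s ^ 2 - rate h s * -deriv (g h) s|
      ≤ (1 + C₁) * C₄ + N := fun s hs => by
    have hB := hh.B_pos s
    have hB1 := hh.one_le_B hs.2
    have hr := hh.rate_nonneg hs.2
    have e : 2 * rate h s * XiInt h s / B h s ^ 2 - rate h s * -deriv (g h) s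
        = rate h s * Δ s / B h s ^ 2 := by
      simp only [hΔ]; field_simp
    rw [e, abs_div, abs_mul, abs_of_nonneg hr, abs_of_pos (by positivity : 0 < B h s ^ 2),
      div_le_iff₀ (by positivity)]
    have hC₄0 : 0 ≤ C₄ := abs_nonneg _
    calc rate h s * |Δ s| ≤ rate h s * (C₄ + N * (B h s ^ 2 * g h s)) :=
          mul_le_mul_of_nonneg_left (hΔfin s hs) hr
      _ = rate h s * C₄ + N * B h s ^ 2 * (rate h s * g h s) := by ring
      _ ≤ (1 + C₁) * B h s * C₄ * B h s + N * B h s ^ 2 * 1 := by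
          rw [hh.rate_mul_g (hpos s hs) hs.2]
          refine add_le_add ?_ le_rfl
          exact (mul_le_mul_of_nonneg_right (hrate s hs) hC₄0).trans
            (le_mul_of_one_le_right (by positivity) hB1)
      _ = _ := by ring
  refine ⟨(1 + C₁) + C₂ + C₃ + ((1 + C₁) * C₄ + N), z₁, ?_, hz₁0, hz₁1, fun s hs => ?_⟩
  · have : 0 ≤ (1 + C₁) * C₄ := mul_nonneg (by linarith) (abs_nonneg _)
    linarith
  · have hB := hh.B_pos s
    have hC₄' : 0 ≤ (1 + C₁) * C₄ := mul_nonneg (by linarith) (abs_nonneg _)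
    refine ⟨(hcube s (hsub s hs)).trans (mul_le_mul_of_nonneg_right (by linarith) hB.le),
      (hrate s hs).trans (mul_le_mul_of_nonneg_right (by linarith) hB.le),
      (hmass s hs).trans (mul_le_mul_of_nonneg_right (by linarith) hB.le),
      (hincr s hs).trans (by linarith), (hxi s hs).trans (by linarith)⟩

end convex
end IsSwitchingProfile

/-! ### The radial derivative of `𝒢_out` -/

namespace IsSwitchingProfile

variable {h : ℝ → ℝ} (hh : IsSwitchingProfile h)
include hh

/-- The expression inside the absolute value is the derivative of `VInt / B ^ 2`. -/
theorem abs_deriv_VInt_div_le {α β C s : ℝ} (hpos : ∀ u ∈ Icc (0 : ℝ) 1, 1 ≤ α + β * u)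
    (h0 : 0 ≤ s) (h1 : s < 1) (hC : rate h s * betaMass h s ≤ C * B h s) :
    |BdInt h α β s / B h s - 2 * rate h s * VInt h α β s / B h s ^ 2| ≤ 1 + 2 * C := by
  have hB := hh.B_pos s
  have hr := hh.rate_nonneg h1
  refine (abs_sub _ _).trans (add_le_add ?_ ?_)
  · rw [abs_div, abs_of_pos hB, div_le_iff₀ hB]
    simpa using hh.abs_BdInt_le one_pos hpos h1
  · rw [abs_div, abs_mul, abs_of_nonneg (by positivity : 0 ≤ 2 * rate h s),
      abs_of_pos (by positivity : 0 < B h s ^ 2), div_le_iff₀ (by positivity)]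
    calc 2 * rate h s * |VInt h α β s| ≤ 2 * rate h s * (B h s * betaMass h s) :=
          mul_le_mul_of_nonneg_left (hh.abs_VInt_le hpos h0 h1) (by positivity)
      _ = 2 * B h s * (rate h s * betaMass h s) := by ring
      _ ≤ 2 * B h s * (C * B h s) := mul_le_mul_of_nonneg_left hC (by positivity)
      _ = _ := by ring

theorem betaMass_le_B {s : ℝ} (h1 : s < 1) : betaMass h s ≤ B h s := by
  have : betaMass h s ≤ ∫ u in (0 : ℝ)..1, B h s := by
    refine intervalIntegral.integral_mono_on zero_le_one (hh.intervalIntegrable_beta h1)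
      intervalIntegrable_const fun u hu => ?_
    have := hh.monotoneOn_B (mem_Iio.2 (by linarith [hu.1] : s - u < 1)) h1 (by linarith [hu.1])
    linarith
  simpa using this

/-- The derivative of `betaInt / B` with `s` moving at speed `-lam` and the pole at speed `ρ`. -/
noncomputable def _root_.ShellFormation.betaSlope (h : ℝ → ℝ) (lam p ρ s : ℝ) : ℝ :=
  ((-lam) * BdInt h p 1 s - ρ * betaSqInt h p s) / B h s + lam * rate h s * betaInt h p s / B h s

theorem hasDerivAt_betaInt_div {s₀ lam p₀ ρ r : ℝ} (h1 : s₀ + (-lam) * r < 1)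
    (hp : 0 < p₀ + ρ * r) :
    HasDerivAt (fun r => betaInt h (p₀ + ρ * r) (s₀ + (-lam) * r) / B h (s₀ + (-lam) * r))
      (betaSlope h lam (p₀ + ρ * r) ρ (s₀ + (-lam) * r)) r := by
  have hs : HasDerivAt (fun x => s₀ + (-lam) * x) (-lam * 1) r :=
    ((hasDerivAt_id r).const_mul (-lam)).const_add s₀
  have hB := (hh.hasDerivAt_B h1).comp r hs
  have hB0 := (hh.B_pos (s₀ + (-lam) * r)).ne'
  refine ((hh.hasDerivAt_betaInt h1 hp).div hB hB0).congr_deriv ?_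
  simp only [betaSlope, Bd, Function.comp]
  field_simp
  ring

theorem abs_betaSlope_le {lam p ρ C m s : ℝ} (hm : 0 < m) (hmp : m ≤ p) (hlam : 0 < lam)
    (hρ : 0 ≤ ρ) (h1 : s < 1) (hC : rate h s * betaMass h s ≤ C * B h s) :
    |betaSlope h lam p ρ s| ≤ lam / m + ρ / m ^ 2 + lam * C / m := by
  have hB := hh.B_pos s
  have hr := hh.rate_nonneg h1
  have hp := hm.trans_le hmp
  have hM := hh.betaMass_nonneg h1
  have k1 : |BdInt h p 1 s| ≤ B h s / m :=
    hh.abs_BdInt_le hm (fun u hu => by linarith [hu.1]) h1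
  have k2 : |betaSqInt h p s| ≤ B h s / m ^ 2 :=
    (hh.abs_betaSqInt_le hp h1).trans (div_le_div₀ hB.le (hh.betaMass_le_B h1) (by positivity)
      (pow_le_pow_left₀ hm.le hmp 2))
  have k3 : |betaInt h p s| ≤ betaMass h s / m :=
    (hh.abs_betaInt_le hp h1).trans (div_le_div_of_nonneg_left hM hm hmp)
  rw [betaSlope]
  refine (abs_add_le _ _).trans (add_le_add ?_ ?_)
  · rw [abs_div, abs_of_pos hB, div_le_iff₀ hB]
    refine (abs_sub _ _).trans ?_
    rw [abs_mul, abs_mul, abs_neg, abs_of_pos hlam, abs_of_nonneg hρ]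
    refine (add_le_add (mul_le_mul_of_nonneg_left k1 hlam.le)
      (mul_le_mul_of_nonneg_left k2 hρ)).trans (le_of_eq (by ring))
  · rw [abs_div, abs_of_pos hB, div_le_iff₀ hB, abs_mul,
      abs_of_nonneg (mul_nonneg hlam.le hr)]
    calc lam * rate h s * |betaInt h p s| ≤ lam * rate h s * (betaMass h s / m) :=
          mul_le_mul_of_nonneg_left k3 (mul_nonneg hlam.le hr)
      _ = lam * (rate h s * betaMass h s) / m := by ring
      _ ≤ lam * (C * B h s) / m :=
          div_le_div_of_nonneg_right (mul_le_mul_of_nonneg_left hC hlam.le) hm.le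
      _ = _ := by ring

/-- The radial derivative of `𝒢_out` at fixed `t`, as a function of `s` and `r`. -/
noncomputable def _root_.ShellFormation.goutSlope (h : ℝ → ℝ) (A lam s r : ℝ) : ℝ :=
  -2 * (-lam * (rateIncr h s / B h s - 2 * rate h s * XiInt h s / B h s ^ 2))
  - 2 * (-lam * (rate h s / B h s - 2 * rate h s * (B h s - 1) / B h s ^ 2)) * Real.log (2 * A)
  + 2 * (-lam * (BdInt h (2 * A) (-1) s / B h s
        - 2 * rate h s * VInt h (2 * A) (-1) s / B h s ^ 2)
      - -lam * (BdInt h (2 * A) 1 s / B h s - 2 * rate h s * VInt h (2 * A) 1 s / B h s ^ 2))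
  + 2 * (betaSlope h lam (2 * A + 0 * r) 0 s + betaSlope h lam (-2 * A + 2 * lam * r) (2 * lam) s
      - betaSlope h lam (0 + 2 * lam * r) (2 * lam) s)
  - 2 * (-lam * (rate h s / B h s) * Real.log ((0 + 2 * lam * r) / (-2 * A + 2 * lam * r))
      + (B h s - 1) / B h s *
        (2 * lam / (0 + 2 * lam * r) - 2 * lam / (-2 * A + 2 * lam * r)))

theorem hasDerivAt_goutValue {A lam s₀ r : ℝ} (hA : 1 < A) (hlam : 0 < lam)
    (h0 : 0 < s₀ + (-lam) * r) (h1 : s₀ + (-lam) * r < 1) (hr : 0 < -2 * A + 2 * lam * r) :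
    HasDerivAt (fun x => goutValue h A (s₀ + (-lam) * x) (-A + 2 * lam * x))
      (goutSlope h A lam (s₀ + (-lam) * r) r) r := by
  have hs : HasDerivAt (fun x => s₀ + (-lam) * x) (-lam * 1) r :=
    ((hasDerivAt_id r).const_mul (-lam)).const_add s₀
  have hB := (hh.hasDerivAt_B h1).comp r hs
  have hB0 : B h (s₀ + (-lam) * r) ≠ 0 := (hh.B_pos _).ne'
  have hB2 := hB.pow 2
  have hB20 : (B h ∘ fun x => s₀ + (-lam) * x) r ^ 2 ≠ 0 := pow_ne_zero 2 hB0
  have hm : ∀ u ∈ Icc (0 : ℝ) 1, 1 ≤ 2 * A + (-1) * u := fun u hu => by linarith [hu.2]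
  have hp : ∀ u ∈ Icc (0 : ℝ) 1, 1 ≤ 2 * A + 1 * u := fun u hu => by linarith [hu.1]
  have e1 := ((hh.hasDerivAt_XiInt h0 h1).comp r hs).div hB2 hB20
  have e2 := (hB.sub_const 1).div hB2 hB20
  have e3 := ((hh.hasDerivAt_VInt hm h0 h1).comp r hs).div hB2 hB20
  have e4 := ((hh.hasDerivAt_VInt hp h0 h1).comp r hs).div hB2 hB20
  have e5 := hh.hasDerivAt_betaInt_div (p₀ := 2 * A) (ρ := 0) h1 (by linarith)
  have e6 := hh.hasDerivAt_betaInt_div (p₀ := -2 * A) (ρ := 2 * lam) h1 hr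
  have e7 := hh.hasDerivAt_betaInt_div (p₀ := 0) (ρ := 2 * lam) h1 (by linarith)
  have e8 := (hB.sub_const 1).div hB hB0
  have hl : ∀ p : ℝ, HasDerivAt (fun x => p + 2 * lam * x) (2 * lam * 1) r := fun p =>
    ((hasDerivAt_id r).const_mul (2 * lam)).const_add p
  have hr0 : 0 < 0 + 2 * lam * r := by linarith
  have e9 := ((hl 0).div (hl (-2 * A)) hr.ne').log (div_pos hr0 hr).ne'
  have H := ((((e1.const_mul (-2)).sub ((e2.const_mul 2).mul_const (Real.log (2 * A)))).add
    ((e3.sub e4).const_mul 2)).add (((e5.add e6).sub e7).const_mul 2)).sub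
    ((e8.mul e9).const_mul 2)
  have hf : (fun x => goutValue h A (s₀ + (-lam) * x) (-A + 2 * lam * x)) =
      fun x => -2 * (XiInt h (s₀ + (-lam) * x) / B h (s₀ + (-lam) * x) ^ 2)
      - 2 * ((B h (s₀ + (-lam) * x) - 1) / B h (s₀ + (-lam) * x) ^ 2) * Real.log (2 * A)
      + 2 * (VInt h (2 * A) (-1) (s₀ + (-lam) * x) / B h (s₀ + (-lam) * x) ^ 2
        - VInt h (2 * A) 1 (s₀ + (-lam) * x) / B h (s₀ + (-lam) * x) ^ 2)
      + 2 * (betaInt h (2 * A + 0 * x) (s₀ + (-lam) * x) / B h (s₀ + (-lam) * x)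
        + betaInt h (-2 * A + 2 * lam * x) (s₀ + (-lam) * x) / B h (s₀ + (-lam) * x)
        - betaInt h (0 + 2 * lam * x) (s₀ + (-lam) * x) / B h (s₀ + (-lam) * x))
      - 2 * ((B h (s₀ + (-lam) * x) - 1) / B h (s₀ + (-lam) * x)
        * Real.log ((0 + 2 * lam * x) / (-2 * A + 2 * lam * x))) := by
    ext x
    have a1 : -A + 2 * lam * x - A = -2 * A + 2 * lam * x := by ring
    have a2 : -A + 2 * lam * x + A = 0 + 2 * lam * x := by ring
    rw [goutValue_eq, a1, a2, zero_mul, add_zero]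
    ring
  rw [hf]
  refine H.congr_deriv ?_
  simp only [goutSlope, Function.comp, Bd, Pi.pow_apply, Pi.div_apply]
  set s := s₀ + (-lam) * r
  have hr' := hr.ne'
  have hr0' := hr0.ne'
  have hq : ∀ P Q : ℝ, P ≠ 0 → Q ≠ 0 → (2 * lam * 1 * P - Q * (2 * lam * 1)) / P ^ 2 / (Q / P)
      = 2 * lam / Q - 2 * lam / P := fun P Q hP hQ => by field_simp
  rw [hq _ _ hr' hr0']
  set L := Real.log ((0 + 2 * lam * r) / (-2 * A + 2 * lam * r))
  set L' := 2 * lam / (0 + 2 * lam * r) - 2 * lam / (-2 * A + 2 * lam * r)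
  field_simp
  ring

end IsSwitchingProfile

/-! ### Limits of `F`, of `𝒢_out` and of the energy density -/

namespace IsSwitchingProfile

variable {h : ℝ → ℝ} (hh : IsSwitchingProfile h)
include hh

section convex

variable (hg : ∀ T : ℝ, 0 < T → T < 1 → iteratedDeriv 3 (g h) T < 0)
include hg

/-- The radial derivative of `𝒢_out` stays bounded near the end of the formation, away from the
shell: its two nonlocal contributions of order `c' / c` cancel. -/
theorem exists_abs_goutSlope_le {A lam m : ℝ} (hA : 1 < A) (hlam : 0 < lam) (hm : 0 < m) :
    ∃ N z₁ : ℝ, z₁ < 1 ∧ ∀ s ∈ Ico z₁ 1, ∀ r : ℝ, m ≤ -2 * A + 2 * lam * r →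
      |goutSlope h A lam s r| ≤ N := by
  obtain ⟨C, z₁, hC1, hz0, hz1, hb⟩ := hh.exists_bounds hg
  refine ⟨2 * (lam * (2 * C)) + 2 * (lam * (3 * C)) * |Real.log (2 * A)|
    + 2 * (lam * (1 + 2 * C) + lam * (1 + 2 * C))
    + 2 * ((lam / 1 + 0 / 1 ^ 2 + lam * C / 1) + (lam / m + 2 * lam / m ^ 2 + lam * C / m)
      + (lam / m + 2 * lam / m ^ 2 + lam * C / m))
    + 2 * (lam * C * (2 * A / m) + 1 * (2 * lam / m + 2 * lam / m)), z₁, hz1,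
    fun s hs r hr => ?_⟩
  obtain ⟨-, k2, k3, k4, k5⟩ := hb s hs
  have hB := hh.B_pos s
  have hB1 := hh.one_le_B hs.2
  have hrate := hh.rate_nonneg hs.2
  have hs0 : 0 ≤ s := hz0.le.trans hs.1
  have hC0 : 0 ≤ C := by linarith
  have hcB : rate h s / B h s ≤ C := by rwa [div_le_iff₀ hB]
  have hcB0 : 0 ≤ rate h s / B h s := div_nonneg hrate hB.le
  have hp : ∀ u ∈ Icc (0 : ℝ) 1, 1 ≤ 2 * A + 1 * u := fun u hu => by linarith [hu.1]
  have hp' : ∀ u ∈ Icc (0 : ℝ) 1, 1 ≤ 2 * A + (-1) * u := fun u hu => by linarith [hu.2]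
  have b1 : |rateIncr h s / B h s - 2 * rate h s * XiInt h s / B h s ^ 2| ≤ 2 * C := by
    have := abs_sub (rateIncr h s / B h s - rate h s * -deriv (g h) s)
      (2 * rate h s * XiInt h s / B h s ^ 2 - rate h s * -deriv (g h) s)
    rw [sub_sub_sub_cancel_right] at this
    linarith
  have b2 : |rate h s / B h s - 2 * rate h s * (B h s - 1) / B h s ^ 2| ≤ 3 * C := by
    have e : 2 * rate h s * (B h s - 1) / B h s ^ 2
        = 2 * (rate h s / B h s) * ((B h s - 1) / B h s) := by field_simp
    have q1 : (B h s - 1) / B h s ≤ 1 := by rw [div_le_one hB]; linarith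
    have q0 : 0 ≤ (B h s - 1) / B h s := div_nonneg (by linarith) hB.le
    refine (abs_sub _ _).trans ?_
    rw [e, abs_of_nonneg hcB0, abs_of_nonneg (by positivity)]
    nlinarith
  have b3 := hh.abs_deriv_VInt_div_le hp' hs0 hs.2 k3
  have b4 := hh.abs_deriv_VInt_div_le hp hs0 hs.2 k3
  have b5 : |betaSlope h lam (2 * A + 0 * r) 0 s| ≤ lam / 1 + 0 / 1 ^ 2 + lam * C / 1 :=
    hh.abs_betaSlope_le one_pos (by linarith) hlam le_rfl hs.2 k3
  have b6 := hh.abs_betaSlope_le hm hr hlam (by positivity : 0 ≤ 2 * lam) hs.2 k3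
  have hP : 0 < -2 * A + 2 * lam * r := hm.trans_le hr
  have hQm : m ≤ 0 + 2 * lam * r := by linarith
  have b7 := hh.abs_betaSlope_le hm hQm hlam (by positivity : 0 ≤ 2 * lam) hs.2 k3
  set P := -2 * A + 2 * lam * r with hPdef
  have hQP : 0 + 2 * lam * r = P + 2 * A := by rw [hPdef]; ring
  have b8 : |Real.log ((0 + 2 * lam * r) / P)| ≤ 2 * A / m := by
    have e : (0 + 2 * lam * r) / P = 1 + 2 * A / P := by rw [hQP]; field_simp
    have h2 : 0 < 2 * A / P := by positivity
    rw [e, abs_of_nonneg (Real.log_nonneg (by linarith))]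
    refine (Real.log_le_sub_one_of_pos (by linarith)).trans ?_
    rw [add_sub_cancel_left]
    exact div_le_div_of_nonneg_left (by linarith) hm hr
  have b9 : |2 * lam / (0 + 2 * lam * r) - 2 * lam / P| ≤ 2 * lam / m + 2 * lam / m := by
    refine (abs_sub _ _).trans (add_le_add ?_ ?_)
    · rw [abs_of_nonneg (by have := hm.trans_le hQm; positivity)]
      exact div_le_div_of_nonneg_left (by positivity) hm hQm
    · rw [abs_of_nonneg (by positivity)]
      exact div_le_div_of_nonneg_left (by positivity) hm hr
  have b10 : |(B h s - 1) / B h s| ≤ 1 := by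
    rw [abs_of_nonneg (div_nonneg (by linarith) hB.le), div_le_one hB]; linarith
  have hnl : |-lam| = lam := by rw [abs_neg, abs_of_pos hlam]
  rw [goutSlope]
  refine (abs_sub _ _).trans (add_le_add ((abs_add_le _ _).trans (add_le_add
    ((abs_add_le _ _).trans (add_le_add ((abs_sub _ _).trans (add_le_add ?_ ?_)) ?_)) ?_)) ?_)
  · rw [abs_mul, abs_mul, hnl, abs_neg, abs_two]
    gcongr
  · rw [abs_mul, abs_mul, abs_mul, hnl, abs_two]
    gcongr
  · rw [abs_mul, abs_two]
    gcongr
    refine (abs_sub _ _).trans (add_le_add ?_ ?_)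
    · rw [abs_mul, hnl]; gcongr
    · rw [abs_mul, hnl]; gcongr
  · rw [abs_mul, abs_two]
    gcongr
    exact (abs_sub _ _).trans (add_le_add ((abs_add_le _ _).trans (add_le_add b5 b6)) b7)
  · rw [abs_mul, abs_two]
    gcongr
    refine (abs_add_le _ _).trans (add_le_add ?_ ?_)
    · rw [abs_mul, abs_mul, hnl, abs_of_nonneg hcB0]
      gcongr
    · rw [abs_mul]
      gcongr

omit hg in
theorem tendsto_rate : Tendsto (rate h) (𝓝[<] 1) atTop := by
  have e : rate h = fun z => (g h z)⁻¹ := funext rate_eq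
  rw [e]
  refine Tendsto.inv_tendsto_nhdsGT_zero (tendsto_nhdsWithin_iff.2 ⟨?_, ?_⟩)
  · have := (hh.hasDerivAt_g one_pos).continuousAt.tendsto
    rw [hh.g_of_one_le le_rfl] at this
    exact this.mono_left nhdsWithin_le_nhds
  · filter_upwards [Ioo_mem_nhdsLT (zero_lt_one' ℝ)] with z hz
    exact hh.g_pos hz.1 hz.2

/-- Here `c * (-g') = c' / c`, and convexity of `g` bounds it below by `1 / (1 - s)`. -/
theorem tendsto_rate_mul_neg_deriv :
    Tendsto (fun s => rate h s * -deriv (g h) s) (𝓝[<] 1) atTop := by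
  have h1 : Tendsto (fun s : ℝ => (1 - s)⁻¹) (𝓝[<] 1) atTop := by
    refine Tendsto.inv_tendsto_nhdsGT_zero (tendsto_nhdsWithin_iff.2 ⟨?_, ?_⟩)
    · have : Tendsto (fun s : ℝ => 1 - s) (𝓝 1) (𝓝 (1 - 1)) := by
        exact (continuous_const.sub continuous_id).tendsto _
      rw [sub_self] at this
      exact this.mono_left nhdsWithin_le_nhds
    · filter_upwards [self_mem_nhdsWithin] with z hz
      exact mem_Ioi.2 (sub_pos.2 (mem_Iio.1 hz))
  refine tendsto_atTop_mono' _ ?_ h1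
  filter_upwards [Ioo_mem_nhdsLT (zero_lt_one' ℝ)] with s hs
  have k1 := hh.g_le_neg_deriv_mul hg hs.1 hs.2
  have k2 := hh.rate_mul_g hs.1 hs.2
  have k3 := hh.rate_nonneg hs.2
  rw [inv_eq_one_div, div_le_iff₀ (by linarith [hs.2])]
  nlinarith

omit hh hg in
theorem neg_deriv_div_sq (s : ℝ) :
    -deriv (g h) s / g h s ^ 2 = rate h s * -deriv (g h) s * rate h s := by
  rw [rate_eq]; ring

theorem tendsto_neg_deriv_div_sq :
    Tendsto (fun s => -deriv (g h) s / g h s ^ 2) (𝓝[<] 1) atTop := by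
  simp only [neg_deriv_div_sq]
  exact (hh.tendsto_rate_mul_neg_deriv hg).atTop_mul_atTop₀ hh.tendsto_rate

/-- `F` differs from `c' = -g' / g ^ 2` by a multiple of `c`. -/
theorem exists_abs_F_sub_le {A : ℝ} (hA : 1 < A) :
    ∃ N z₁ : ℝ, 0 < z₁ ∧ z₁ < 1 ∧ ∀ s ∈ Ico z₁ 1,
      |F h A (s - A) - -deriv (g h) s / g h s ^ 2| ≤ N * rate h s := by
  obtain ⟨C, z₁, hC1, hz0, hz1, hb⟩ := hh.exists_bounds hg
  refine ⟨3 * C + 2 * C * |Real.log (2 * A)| + 4 * C + 2 + 1, z₁, hz0, hz1, fun s hs => ?_⟩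
  obtain ⟨-, k2, k3, k4, k5⟩ := hb s hs
  have hs0 : 0 < s := hz0.trans_le hs.1
  have hB := hh.B_pos s
  have hB1 := hh.one_le_B hs.2
  have hr := hh.rate_nonneg hs.2
  have hF := (hh.hasAbelIntegral_FIntegrand hA (y := s - A) (by linarith)
    (by linarith [hs.2])).abelIntegral_eq
  rw [sub_add_cancel] at hF
  change F h A (s - A) = 2 * (rate h s / B h s * rateIncr h s - (rate h s / B h s) ^ 2 * XiInt h s)
    + 2 * (rate h s / B h s) ^ 2 * Real.log (2 * A)
    + 2 * (rate h s / B h s) ^ 2 * (VInt h (2 * A) (-1) s - VInt h (2 * A) 1 s)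
    - 2 * (rate h s / B h s) * BdInt h (2 * A) (-1) s + rate h s / A at hF
  have hp : ∀ u ∈ Icc (0 : ℝ) 1, 1 ≤ 2 * A + 1 * u := fun u hu => by linarith [hu.1]
  have hp' : ∀ u ∈ Icc (0 : ℝ) 1, 1 ≤ 2 * A + (-1) * u := fun u hu => by linarith [hu.2]
  have hc0 : 0 ≤ rate h s / B h s := div_nonneg hr hB.le
  have hcC : rate h s / B h s ≤ C := by rwa [div_le_iff₀ hB]
  have hcr : rate h s / B h s ≤ rate h s := div_le_self hr hB1
  have hsq : (rate h s / B h s) ^ 2 ≤ C * rate h s := by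
    rw [pow_two]; exact mul_le_mul hcC hcr hc0 (by linarith)
  have e : F h A (s - A) - -deriv (g h) s / g h s ^ 2
      = rate h s * (2 * (rateIncr h s / B h s - rate h s * -deriv (g h) s)
          - (2 * rate h s * XiInt h s / B h s ^ 2 - rate h s * -deriv (g h) s))
        + 2 * (rate h s / B h s) ^ 2 * Real.log (2 * A)
        + 2 * (rate h s / B h s) ^ 2 * (VInt h (2 * A) (-1) s - VInt h (2 * A) 1 s)
        - 2 * (rate h s / B h s) * BdInt h (2 * A) (-1) s + rate h s / A := by
    rw [hF, neg_deriv_div_sq]; field_simp; ring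
  have t1 : |rate h s * (2 * (rateIncr h s / B h s - rate h s * -deriv (g h) s)
      - (2 * rate h s * XiInt h s / B h s ^ 2 - rate h s * -deriv (g h) s))|
      ≤ rate h s * (2 * C + C) := by
    rw [abs_mul, abs_of_nonneg hr]
    refine mul_le_mul_of_nonneg_left ((abs_sub _ _).trans (add_le_add ?_ k5)) hr
    rw [abs_mul, abs_two]; linarith
  have t2 : |2 * (rate h s / B h s) ^ 2 * Real.log (2 * A)|
      ≤ 2 * (C * rate h s) * |Real.log (2 * A)| := by
    rw [abs_mul, abs_of_nonneg (by positivity : 0 ≤ 2 * (rate h s / B h s) ^ 2)]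
    gcongr
  have t3 : |2 * (rate h s / B h s) ^ 2 * (VInt h (2 * A) (-1) s - VInt h (2 * A) 1 s)|
      ≤ 4 * (rate h s * C) := by
    have v1 := hh.abs_VInt_le hp' hs0.le hs.2
    have v2 := hh.abs_VInt_le hp hs0.le hs.2
    have v3 := (abs_sub (VInt h (2 * A) (-1) s) (VInt h (2 * A) 1 s)).trans (add_le_add v1 v2)
    rw [abs_mul, abs_of_nonneg (by positivity : 0 ≤ 2 * (rate h s / B h s) ^ 2)]
    calc _ ≤ 2 * (rate h s / B h s) ^ 2 * (B h s * betaMass h s + B h s * betaMass h s) :=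
          mul_le_mul_of_nonneg_left v3 (by positivity)
      _ = 4 * (rate h s * ((rate h s * betaMass h s) / B h s)) := by field_simp; ring
      _ ≤ 4 * (rate h s * C) := by
          have : rate h s * betaMass h s / B h s ≤ C := by rwa [div_le_iff₀ hB]
          gcongr
  have t4 : |2 * (rate h s / B h s) * BdInt h (2 * A) (-1) s| ≤ 2 * rate h s := by
    have v1 := hh.abs_BdInt_le one_pos hp' hs.2
    rw [div_one] at v1
    rw [abs_mul, abs_of_nonneg (by positivity : 0 ≤ 2 * (rate h s / B h s))]
    calc _ ≤ 2 * (rate h s / B h s) * B h s := mul_le_mul_of_nonneg_left v1 (by positivity)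
      _ = _ := by field_simp
  have t5 : |rate h s / A| ≤ rate h s := by
    rw [abs_of_nonneg (by positivity)]
    exact div_le_self hr hA.le
  rw [e]
  refine (abs_add_le _ _).trans ((add_le_add ((abs_sub _ _).trans (add_le_add
    ((abs_add_le _ _).trans (add_le_add ((abs_add_le _ _).trans (add_le_add t1 t2)) t3)) t4))
    t5).trans (le_of_eq (by ring)))

theorem isEquivalent_F {A : ℝ} (hA : 1 < A) :
    Asymptotics.IsEquivalent (𝓝[<] 1) (fun s => F h A (s - A))
      (fun s => -deriv (g h) s / g h s ^ 2) := by
  obtain ⟨N, z₁, -, hz1, hb⟩ := hh.exists_abs_F_sub_le hg hA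
  have hO : (fun s => F h A (s - A) - -deriv (g h) s / g h s ^ 2) =O[𝓝[<] 1] rate h := by
    refine Asymptotics.IsBigO.of_bound N ?_
    filter_upwards [Ico_mem_nhdsLT hz1] with s hs
    rw [Real.norm_eq_abs, Real.norm_eq_abs, abs_of_nonneg (hh.rate_nonneg hs.2)]
    exact hb s hs
  have ho : rate h =o[𝓝[<] 1] (fun s => -deriv (g h) s / g h s ^ 2) := by
    refine (Asymptotics.isLittleO_iff_tendsto' ?_).2 ?_
    · filter_upwards [(hh.tendsto_neg_deriv_div_sq hg).eventually_gt_atTop 0] with s hs h0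
      exact absurd h0 hs.ne'
    · refine (hh.tendsto_rate_mul_neg_deriv hg).inv_tendsto_atTop.congr' ?_
      filter_upwards [hh.tendsto_rate.eventually_gt_atTop 0] with s hs
      rw [neg_deriv_div_sq, Pi.inv_apply]
      field_simp
  exact hO.trans_isLittleO ho

/-- The limits of the ingredients of `𝒢_out` at the end of the formation. -/
theorem tendsto_ingredients :
    Tendsto (fun s => XiInt h s / B h s ^ 2) (𝓝[<] 1) (𝓝 0) ∧
    Tendsto (fun s => (B h s)⁻¹) (𝓝[<] 1) (𝓝 0) ∧
    Tendsto (fun s => betaMass h s / B h s) (𝓝[<] 1) (𝓝 0) := by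
  obtain ⟨C, z₁, hC1, hz0, hz1, hb⟩ := hh.exists_bounds hg
  have hr := hh.tendsto_rate
  have hrinv : Tendsto (fun s => C * (rate h s)⁻¹) (𝓝[<] 1) (𝓝 0) := by
    simpa using hr.inv_tendsto_atTop.const_mul C
  have hev : ∀ᶠ s in 𝓝[<] (1 : ℝ), s ∈ Ico z₁ 1 ∧ 0 < rate h s :=
    (eventually_mem_set.2 (Ico_mem_nhdsLT hz1)).and (hr.eventually_gt_atTop 0)
  refine ⟨?_, ?_, ?_⟩
  · have hv : Tendsto (fun s => -deriv (g h) s / 2) (𝓝[<] 1) (𝓝 0) := by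
      have := ((hh.continuousAt_deriv_g one_pos).neg.div_const 2).tendsto
      rw [Pi.neg_apply, hh.deriv_g_one] at this
      simpa using this.mono_left nhdsWithin_le_nhds
    have hdiff : Tendsto (fun s => XiInt h s / B h s ^ 2 - -deriv (g h) s / 2) (𝓝[<] 1) (𝓝 0) := by
      refine squeeze_zero_norm' ?_ hrinv
      filter_upwards [hev] with s hs
      obtain ⟨-, -, -, -, k5⟩ := hb s hs.1
      have hr0 := hs.2
      have e : XiInt h s / B h s ^ 2 - -deriv (g h) s / 2
          = (2 * rate h s * XiInt h s / B h s ^ 2 - rate h s * -deriv (g h) s)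
            / (2 * rate h s) := by field_simp
      rw [e, Real.norm_eq_abs, abs_div, abs_of_pos (by positivity : 0 < 2 * rate h s),
        div_le_iff₀ (by positivity)]
      have : C * (rate h s)⁻¹ * (2 * rate h s) = 2 * C := by field_simp
      rw [this]; linarith
    simpa using hdiff.add hv
  · refine squeeze_zero_norm' ?_ hrinv
    filter_upwards [hev] with s hs
    obtain ⟨-, k2, -⟩ := hb s hs.1
    have hB := hh.B_pos s
    have hr0 := hs.2
    rw [Real.norm_eq_abs, abs_of_pos (inv_pos.2 hB), ← div_eq_mul_inv, inv_eq_one_div,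
      div_le_div_iff₀ hB hr0]
    linarith
  · refine squeeze_zero_norm' ?_ hrinv
    filter_upwards [hev] with s hs
    obtain ⟨-, -, k3, -⟩ := hb s hs.1
    have hB := hh.B_pos s
    have hr0 := hs.2
    rw [Real.norm_eq_abs, abs_of_nonneg (div_nonneg (hh.betaMass_nonneg hs.1.2) hB.le),
      ← div_eq_mul_inv, div_le_div_iff₀ hB hr0]
    linarith

/-- Only the last logarithm of `goutValue` survives in the limit. -/
theorem tendsto_goutValue {A d₀ : ℝ} (hA : 1 < A) (hd₀ : A < d₀) {l : Filter (ℝ × ℝ)}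
    (hs : Tendsto Prod.fst l (𝓝[<] 1)) (hd : Tendsto Prod.snd l (𝓝 d₀)) :
    Tendsto (fun p : ℝ × ℝ => goutValue h A p.1 p.2) l
      (𝓝 (-2 * Real.log ((d₀ + A) / (d₀ - A)))) := by
  obtain ⟨i1, i2, i3⟩ := hh.tendsto_ingredients hg
  have hev : ∀ᶠ p in l, p.1 ∈ Ioo (0 : ℝ) 1 :=
    hs.eventually (eventually_mem_set.2 (Ioo_mem_nhdsLT one_pos))
  have hevd : ∀ᶠ p in l, (d₀ - A) / 2 < p.2 - A := by
    have : Tendsto (fun p : ℝ × ℝ => p.2 - A) l (𝓝 (d₀ - A)) := hd.sub_const A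
    exact this.eventually_const_lt (by linarith)
  have hp : ∀ u ∈ Icc (0 : ℝ) 1, 1 ≤ 2 * A + 1 * u := fun u hu => by linarith [hu.1]
  have hp' : ∀ u ∈ Icc (0 : ℝ) 1, 1 ≤ 2 * A + (-1) * u := fun u hu => by linarith [hu.2]
  have j1 := i1.comp hs
  have j2 := i2.comp hs
  have j3 := i3.comp hs
  have tV : ∀ β : ℝ, (∀ u ∈ Icc (0 : ℝ) 1, 1 ≤ 2 * A + β * u) →
      Tendsto (fun p : ℝ × ℝ => VInt h (2 * A) β p.1 / B h p.1 ^ 2) l (𝓝 0) := fun β hβ => by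
    refine squeeze_zero_norm' ?_ j3
    filter_upwards [hev] with p hp1
    have hB := hh.B_pos p.1
    rw [Real.norm_eq_abs, abs_div, abs_of_pos (by positivity : 0 < B h p.1 ^ 2)]
    refine (div_le_div_of_nonneg_right (hh.abs_VInt_le hβ hp1.1.le hp1.2)
      (by positivity)).trans (le_of_eq ?_)
    simp only [Function.comp]
    field_simp
  have tb : ∀ q : ℝ × ℝ → ℝ, ∀ m : ℝ, 0 < m → (∀ᶠ p in l, m ≤ q p) →
      Tendsto (fun p : ℝ × ℝ => betaInt h (q p) p.1 / B h p.1) l (𝓝 0) := fun q m hm hq => by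
    have j4 : Tendsto (fun p : ℝ × ℝ => betaMass h p.1 / B h p.1 / m) l (𝓝 0) := by
      simpa using j3.div_const m
    refine squeeze_zero_norm' ?_ j4
    filter_upwards [hev, hq] with p hp1 hp2
    have hB := hh.B_pos p.1
    rw [Real.norm_eq_abs, abs_div, abs_of_pos hB]
    refine (div_le_div_of_nonneg_right ((hh.abs_betaInt_le (hm.trans_le hp2) hp1.2).trans
      (div_le_div_of_nonneg_left (hh.betaMass_nonneg hp1.2) hm hp2)) hB.le).trans (le_of_eq ?_)
    rw [div_right_comm]
  have tB1 : Tendsto (fun p : ℝ × ℝ => (B h p.1 - 1) / B h p.1) l (𝓝 1) := by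
    have := (tendsto_const_nhds (x := (1 : ℝ))).sub j2
    rw [sub_zero] at this
    refine this.congr fun p => ?_
    have hB := (hh.B_pos p.1).ne'
    simp only [Function.comp]
    field_simp
  have tB2 : Tendsto (fun p : ℝ × ℝ => (B h p.1 - 1) / B h p.1 ^ 2) l (𝓝 0) := by
    have := tB1.mul j2
    rw [mul_zero] at this
    refine this.congr fun p => ?_
    have hB := (hh.B_pos p.1).ne'
    simp only [Function.comp]
    field_simp
  have tlog : Tendsto (fun p : ℝ × ℝ => Real.log ((p.2 + A) / (p.2 - A))) l
      (𝓝 (Real.log ((d₀ + A) / (d₀ - A)))) := by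
    have h1 : d₀ - A ≠ 0 := by linarith
    have h2 : (d₀ + A) / (d₀ - A) ≠ 0 := div_ne_zero (by linarith) h1
    exact ((hd.add_const A).div (hd.sub_const A) h1).log h2
  have b1 := tb (fun _ => 2 * A) 1 one_pos (Eventually.of_forall fun _ => by linarith)
  have b2 := tb (fun p => p.2 - A) ((d₀ - A) / 2) (by linarith) (hevd.mono fun p hp => hp.le)
  have b3 := tb (fun p => p.2 + A) ((d₀ - A) / 2) (by linarith)
    (hevd.mono fun p hp => by linarith)
  have T := ((((j1.const_mul (-2)).sub ((tB2.const_mul 2).mul_const (Real.log (2 * A)))).add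
    (((tV (-1) hp').sub (tV 1 hp)).const_mul 2)).add (((b1.add b2).sub b3).const_mul 2)).sub
    ((tB1.const_mul 2).mul tlog)
  have e : -2 * 0 - 2 * 0 * Real.log (2 * A) + 2 * (0 - 0) + 2 * (0 + 0 - 0)
      - 2 * 1 * Real.log ((d₀ + A) / (d₀ - A)) = -2 * Real.log ((d₀ + A) / (d₀ - A)) := by ring
  rw [e] at T
  refine T.congr fun p => ?_
  rw [goutValue_eq]
  simp only [Function.comp]
  ring

end convex

theorem Gout_eq {A y w : ℝ} (hA : 1 < A) (hy0 : -A < y) (hy1 : y < 1 - A) (hw : y + 2 * A < w) :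
    Gout h A y w = goutValue h A (y + A) (w - (y + A)) :=
  (hh.hasImproperIntegral_GoutIntegrand hA hy0 hy1 hw).improperIntegral_eq

theorem hasDerivAt_Gout {lam a t r : ℝ} (hlam : 0 < lam) (hA : 1 < lam * a) (hr : a < r)
    (h0 : -(lam * a) < lam * (t - r)) (h1 : lam * (t - r) < 1 - lam * a) :
    HasDerivAt (fun x => Gout h (lam * a) (lam * (t - x)) (lam * (t + x)))
      (goutSlope h (lam * a) lam (lam * (t - r) + lam * a) r) r := by
  have hlr : lam * a < lam * r := mul_lt_mul_of_pos_left hr hlam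
  have e : ∀ x : ℝ, lam * (t - x) + lam * a = (lam * t + lam * a) + (-lam) * x := fun x => by ring
  have H := hh.hasDerivAt_goutValue (s₀ := lam * t + lam * a) (r := r) hA hlam
    (by linarith [e r]) (by linarith [e r]) (by linarith)
  rw [← e r] at H
  refine H.congr_of_eventuallyEq ?_
  have hopen : IsOpen ({x : ℝ | a < x} ∩ {x : ℝ | -(lam * a) < lam * (t - x)} ∩
      {x : ℝ | lam * (t - x) < 1 - lam * a}) :=
    ((isOpen_lt (by fun_prop) (by fun_prop)).inter (isOpen_lt (by fun_prop) (by fun_prop))).inter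
      (isOpen_lt (by fun_prop) (by fun_prop))
  filter_upwards [hopen.mem_nhds ⟨⟨hr, h0⟩, h1⟩] with x hx
  have hlx : lam * a < lam * x := mul_lt_mul_of_pos_left hx.1.1 hlam
  rw [hh.Gout_eq hA hx.1.2 hx.2 (by linarith), e x]
  congr 1
  ring

theorem hasDerivAt_GoutOverR {lam a t r : ℝ} (hlam : 0 < lam) (hA : 1 < lam * a) (hr : a < r)
    (hr0 : r ≠ 0) (h0 : -(lam * a) < lam * (t - r)) (h1 : lam * (t - r) < 1 - lam * a) :
    HasDerivAt (fun x => GoutOverR h lam a t x)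
      ((goutSlope h (lam * a) lam (lam * (t - r) + lam * a) r * r
        - Gout h (lam * a) (lam * (t - r)) (lam * (t + r)) * 1) / r ^ 2) r :=
  (hh.hasDerivAt_Gout hlam hA hr h0 h1).div (hasDerivAt_id r) hr0

section convex

variable (hg : ∀ T : ℝ, 0 < T → T < 1 → iteratedDeriv 3 (g h) T < 0)
include hg

theorem tendsto_Gout {A w₀ : ℝ} (hA : 1 < A) (hw₀ : 1 + A < w₀) :
    Tendsto (fun p : ℝ × ℝ => Gout h A p.1 p.2) (𝓝[<] (1 - A) ×ˢ 𝓝 w₀)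
      (𝓝 (2 * Real.log ((w₀ - (1 - A) - 2 * A) / (w₀ - (1 - A))))) := by
  have hy : Tendsto (fun p : ℝ × ℝ => p.1) (𝓝[<] (1 - A) ×ˢ 𝓝 w₀) (𝓝[<] (1 - A)) := tendsto_fst
  have hw : Tendsto (fun p : ℝ × ℝ => p.2) (𝓝[<] (1 - A) ×ˢ 𝓝 w₀) (𝓝 w₀) := tendsto_snd
  have hy' := hy.mono_right (nhdsWithin_le_nhds (s := Iio (1 - A)))
  have hylt : ∀ᶠ p : ℝ × ℝ in 𝓝[<] (1 - A) ×ˢ 𝓝 w₀, p.1 < 1 - A :=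
    hy.eventually self_mem_nhdsWithin
  have hs : Tendsto (fun p : ℝ × ℝ => p.1 + A) (𝓝[<] (1 - A) ×ˢ 𝓝 w₀) (𝓝[<] 1) := by
    refine tendsto_nhdsWithin_iff.2 ⟨?_, ?_⟩
    · simpa using hy'.add_const A
    · filter_upwards [hylt] with p hp
      exact mem_Iio.2 (by linarith)
  have hd : Tendsto (fun p : ℝ × ℝ => p.2 - (p.1 + A)) (𝓝[<] (1 - A) ×ˢ 𝓝 w₀) (𝓝 (w₀ - 1)) :=
    hw.sub (by simpa using hy'.add_const A)
  have T := (hh.tendsto_goutValue hg hA (d₀ := w₀ - 1) (by linarith)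
    (l := map (fun p : ℝ × ℝ => (p.1 + A, p.2 - (p.1 + A))) (𝓝[<] (1 - A) ×ˢ 𝓝 w₀)) hs hd).comp
    tendsto_map
  have e : -2 * Real.log ((w₀ - 1 + A) / (w₀ - 1 - A))
      = 2 * Real.log ((w₀ - (1 - A) - 2 * A) / (w₀ - (1 - A))) := by
    rw [← inv_div, Real.log_inv]
    ring_nf
  rw [e] at T
  refine T.congr' ?_
  have g1 : ∀ᶠ p : ℝ × ℝ in 𝓝[<] (1 - A) ×ˢ 𝓝 w₀, -A < p.1 :=
    hy'.eventually_const_lt (by linarith)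
  have g2 : ∀ᶠ p : ℝ × ℝ in 𝓝[<] (1 - A) ×ˢ 𝓝 w₀, p.1 + 2 * A < p.2 :=
    (hy'.add_const (2 * A)).eventually_lt hw (by linarith)
  filter_upwards [g1, g2, hylt] with p k1 k2 k3
  exact (hh.Gout_eq hA k1 k3 k2).symm

theorem tendsto_F {A : ℝ} (hA : 1 < A) :
    Tendsto (fun s => F h A (s - A)) (𝓝[<] 1) atTop :=
  (hh.isEquivalent_F hg hA).symm.tendsto_atTop (hh.tendsto_neg_deriv_div_sq hg)

/-- The energy density near the light cone: `F` tends to infinity and everything else is bounded. -/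
theorem tendsto_T00 {lam a t₀ r₀ : ℝ} (hlam : 0 < lam) (hA : 1 < lam * a) (hr₀ : a < r₀)
    (ht₀ : t₀ - r₀ = 1 / lam - a) :
    Tendsto (fun p : ℝ × ℝ => T00 h lam a p.1 p.2)
      (𝓝[{p : ℝ × ℝ | p.1 - p.2 < 1 / lam - a}] (t₀, r₀)) atTop := by
  have ha : 0 < a := pos_of_mul_pos_right (one_pos.trans hA) hlam.le
  set l := 𝓝[{p : ℝ × ℝ | p.1 - p.2 < 1 / lam - a}] (t₀, r₀) with hl
  have hcone : lam * (1 / lam - a) = 1 - lam * a := by field_simp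
  have hcont : ∀ {f : ℝ × ℝ → ℝ}, Continuous f → Tendsto f l (𝓝 (f (t₀, r₀))) := fun hf =>
    (hf.tendsto _).mono_left nhdsWithin_le_nhds
  have hin : ∀ᶠ p in l, lam * (p.1 - p.2) < 1 - lam * a := by
    filter_upwards [self_mem_nhdsWithin] with p hp
    rw [← hcone]
    exact mul_lt_mul_of_pos_left hp hlam
  have hy : Tendsto (fun p : ℝ × ℝ => lam * (p.1 - p.2)) l (𝓝[<] (1 - lam * a)) := by
    refine tendsto_nhdsWithin_iff.2 ⟨?_, hin⟩
    have := hcont (f := fun p => lam * (p.1 - p.2)) (by fun_prop)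
    simp only [ht₀, hcone] at this
    exact this
  have hs : Tendsto (fun p : ℝ × ℝ => lam * (p.1 - p.2) + lam * a) l (𝓝[<] 1) := by
    refine tendsto_nhdsWithin_iff.2 ⟨?_, ?_⟩
    · simpa using (hy.mono_right nhdsWithin_le_nhds).add_const (lam * a)
    · filter_upwards [hin] with p hp
      exact mem_Iio.2 (by linarith)
  have hw : Tendsto (fun p : ℝ × ℝ => lam * (p.1 + p.2)) l (𝓝 (lam * (t₀ + r₀))) :=
    hcont (f := fun p => lam * (p.1 + p.2)) (by fun_prop)
  have hr : Tendsto (fun p : ℝ × ℝ => p.2) l (𝓝 r₀) := hcont (f := fun p => p.2) (by fun_prop)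
  have hlr : lam * a < lam * r₀ := mul_lt_mul_of_pos_left hr₀ hlam
  have hw₀ : 1 + lam * a < lam * (t₀ + r₀) := by
    have : lam * (t₀ - r₀) = 1 - lam * a := by rw [ht₀, hcone]
    linarith
  -- the leading term
  have hF : Tendsto (fun p : ℝ × ℝ => F h (lam * a) (lam * (p.1 - p.2))) l atTop := by
    refine ((hh.tendsto_F hg hA).comp hs).congr fun p => ?_
    simp only [Function.comp, add_sub_cancel_right]
  have hcoef : Tendsto (fun p : ℝ × ℝ => lam ^ 2 / (16 * Real.pi ^ 2 * p.2 ^ 2)) l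
      (𝓝 (lam ^ 2 / (16 * Real.pi ^ 2 * r₀ ^ 2))) := by
    have hne : 16 * Real.pi ^ 2 * r₀ ^ 2 ≠ 0 := by
      have := Real.pi_pos; have := ha.trans hr₀; positivity
    exact tendsto_const_nhds.div ((hr.pow 2).const_mul _) hne
  have hmain := hcoef.pos_mul_atTop (by
    have := Real.pi_pos; have := ha.trans hr₀; positivity) hF
  -- the remaining term is bounded
  set m := lam * (r₀ - a) with hm
  have hm0 : 0 < m := mul_pos hlam (by linarith)
  obtain ⟨N, z₁, hz1, hN⟩ := hh.exists_abs_goutSlope_le hg hA hlam hm0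
  have hG := (hh.tendsto_Gout hg hA hw₀).comp (hy.prodMk hw)
  set G₀ := 2 * Real.log ((lam * (t₀ + r₀) - (1 - lam * a) - 2 * (lam * a))
    / (lam * (t₀ + r₀) - (1 - lam * a))) with hG₀
  have hGb : ∀ᶠ p in l, |Gout h (lam * a) (lam * (p.1 - p.2)) (lam * (p.1 + p.2))| < |G₀| + 1 :=
    hG.abs.eventually_lt_const (by linarith)
  have hzev : ∀ᶠ p in l, lam * (p.1 - p.2) + lam * a ∈ Ico z₁ 1 :=
    hs.eventually (eventually_mem_set.2 (Ico_mem_nhdsLT hz1))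
  have hyev : ∀ᶠ p in l, -(lam * a) < lam * (p.1 - p.2) :=
    (hy.mono_right nhdsWithin_le_nhds).eventually_const_lt (by linarith)
  have hrev : ∀ᶠ p in l, (a + r₀) / 2 < p.2 := hr.eventually_const_lt (by linarith)
  have hrup : ∀ᶠ p in l, p.2 < r₀ + 1 := hr.eventually_lt_const (by linarith)
  have hbd : ∀ᶠ p in l, -(1 / (32 * Real.pi ^ 2 * a ^ 2) * ((N * (r₀ + 1) + (|G₀| + 1)) / a ^ 2))
      ≤ -(1 / (32 * Real.pi ^ 2 * p.2 ^ 2) * deriv (fun x => GoutOverR h lam a p.1 x) p.2) := by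
    filter_upwards [hGb, hzev, hyev, hrev, hrup, hin] with p q1 q2 q3 q4 q5 q6
    have hap : a < p.2 := by linarith
    have hp0 : 0 < p.2 := ha.trans hap
    have hpi := Real.pi_pos
    have hsl := hN _ q2 p.2 (by
      have : lam * ((a + r₀) / 2) < lam * p.2 := mul_lt_mul_of_pos_left q4 hlam
      rw [hm]; linarith)
    have hN0 : 0 ≤ N := (abs_nonneg _).trans hsl
    rw [(hh.hasDerivAt_GoutOverR hlam hA hap hp0.ne' q3 q6).deriv]
    have hr00 : 0 < r₀ := ha.trans hr₀
    refine neg_le_neg ((mul_le_mul_of_nonneg_left (le_abs_self _) (by positivity)).trans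
      (mul_le_mul ?_ ?_ (abs_nonneg _) (by positivity)))
    · exact one_div_le_one_div_of_le (by positivity) (by gcongr)
    · rw [abs_div, abs_of_pos (by positivity : 0 < p.2 ^ 2)]
      refine div_le_div₀ (by positivity) ?_ (by positivity) (by gcongr)
      refine (abs_sub _ _).trans (add_le_add ?_ ?_)
      · rw [abs_mul, abs_of_pos hp0]
        exact mul_le_mul hsl q5.le hp0.le hN0
      · rw [mul_one]; exact q1.le
  have := tendsto_atTop_add_right_of_le' l _ hmain hbd
  refine this.congr fun p => ?_
  rw [T00]; ring

end convex

end IsSwitchingProfile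
end ShellFormation

theorem mainTheorem4 (h : ℝ → ℝ) (lam a : ℝ)
    (hh : ShellFormation.IsSwitchingProfile h)
    (hlam : 0 < lam) (ha : 1 < lam * a)
    (hg : ∀ T : ℝ, 0 < T → T < 1 → iteratedDeriv 3 (ShellFormation.g h) T < 0) :
    -- all quantities exist in the intermediate outside region
    (∀ y : ℝ, -(lam * a) < y → y < 1 - lam * a →
      (∀ K : ℝ, DifferentiableAt ℝ (fun x : ℝ => ShellFormation.R h (lam * a) K x) y) ∧
      ShellFormation.HasAbelIntegral (ShellFormation.FIntegrand h (lam * a) y)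
        (ShellFormation.F h (lam * a) y) ∧
      ∀ w : ℝ, y + 2 * (lam * a) < w →
        ShellFormation.HasImproperIntegral (ShellFormation.GoutIntegrand h (lam * a) y w)
          (ShellFormation.Gout h (lam * a) y w)) ∧
    (∀ t r : ℝ, a < r → -(lam * a) < lam * (t - r) → lam * (t - r) < 1 - lam * a →
      DifferentiableAt ℝ (fun x : ℝ => ShellFormation.GoutOverR h lam a t x) r) ∧
    -- `F` diverges like `-g' / g²`, which tends to `+∞`
    Asymptotics.IsEquivalent (𝓝[<] (1 - lam * a))
      (fun y : ℝ => ShellFormation.F h (lam * a) y)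
      (fun y : ℝ => -deriv (ShellFormation.g h) (y + lam * a)
        / ShellFormation.g h (y + lam * a) ^ 2) ∧
    Tendsto (fun y : ℝ => -deriv (ShellFormation.g h) (y + lam * a)
        / ShellFormation.g h (y + lam * a) ^ 2) (𝓝[<] (1 - lam * a)) atTop ∧
    Tendsto (fun y : ℝ => ShellFormation.F h (lam * a) y) (𝓝[<] (1 - lam * a)) atTop ∧
    -- the limit of `𝒢_out`
    (∀ w₀ : ℝ, 1 + lam * a < w₀ →
      Tendsto (fun p : ℝ × ℝ => ShellFormation.Gout h (lam * a) p.1 p.2)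
        (𝓝[<] (1 - lam * a) ×ˢ 𝓝 w₀)
        (𝓝 (2 * Real.log ((w₀ - (1 - lam * a) - 2 * (lam * a)) / (w₀ - (1 - lam * a)))))) ∧
    -- it is the value of `𝒢_out` in the future region, boundary included
    (∀ y w : ℝ, 1 - lam * a ≤ y → y + 2 * (lam * a) < w →
      ShellFormation.HasImproperIntegral (ShellFormation.GoutIntegrand h (lam * a) y w)
        (ShellFormation.Gout h (lam * a) y w) ∧
      ShellFormation.Gout h (lam * a) y w
        = 2 * Real.log ((w - y - 2 * (lam * a)) / (w - y))) ∧
    -- the energy density tends to `+∞` just before the light cone of `(t, r) = (1 / lam, a)`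
    (∀ t₀ r₀ : ℝ, a < r₀ → t₀ - r₀ = 1 / lam - a →
      Tendsto (fun p : ℝ × ℝ => ShellFormation.T00 h lam a p.1 p.2)
        (𝓝[{p : ℝ × ℝ | p.1 - p.2 < 1 / lam - a}] (t₀, r₀)) atTop) := by
  have ha0 : 0 < a := pos_of_mul_pos_right (zero_lt_one.trans ha) hlam.le
  -- time relative to the start of the switching, `s = y + A`
  have hshift : Tendsto (fun y : ℝ => y + lam * a) (𝓝[<] (1 - lam * a)) (𝓝[<] 1) := by
    refine tendsto_nhdsWithin_iff.2 ⟨?_, ?_⟩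
    · have : Tendsto (fun y : ℝ => y + lam * a) (𝓝 (1 - lam * a)) (𝓝 (1 - lam * a + lam * a)) :=
        (continuous_id.add continuous_const).tendsto _
      rw [sub_add_cancel] at this
      exact this.mono_left nhdsWithin_le_nhds
    · filter_upwards [self_mem_nhdsWithin] with y hy
      exact mem_Iio.2 (by have := mem_Iio.1 hy; linarith)
  refine ⟨fun y hy0 hy1 => ⟨fun K => (hh.hasDerivAt_R K hy0 hy1).differentiableAt, ?_,
    fun w hw => ?_⟩, fun t r hr h0 h1 => ?_, ?_, ?_, ?_, fun w₀ hw₀ => hh.tendsto_Gout hg ha hw₀,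
    fun y w hy hw => ?_, fun t₀ r₀ hr₀ ht₀ => hh.tendsto_T00 hg hlam ha hr₀ ht₀⟩
  · have := hh.hasAbelIntegral_FIntegrand ha hy0 hy1
    rwa [ShellFormation.F, this.abelIntegral_eq]
  · have := hh.hasImproperIntegral_GoutIntegrand ha hy0 hy1 hw
    rwa [ShellFormation.Gout, this.improperIntegral_eq]
  · exact (hh.hasDerivAt_GoutOverR hlam ha hr (ha0.trans hr).ne' h0 h1).differentiableAt
  · simpa [Function.comp_def] using (hh.isEquivalent_F hg ha).comp_tendsto hshift
  · exact (hh.tendsto_neg_deriv_div_sq hg).comp hshift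
  · simpa [Function.comp_def] using (hh.tendsto_F hg ha).comp hshift
  · have := ShellFormation.hasImproperIntegral_GoutIntegrand_late (h := h) ha hy hw
    rw [ShellFormation.Gout, this.improperIntegral_eq]
    exact ⟨this, rfl⟩
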